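/- **Setting.** Let $X$ be a complex Banach space, $\alpha\in(0,1)$, and for $\theta>0$ put $\Sigma_\theta=\{\lambda\in\mathbb C\setminus\{0\}: |\arg\lambda|<\pi/2+\theta\}$. Let $A:D(A)\subset X\to X$ be a closed, densely defined linear operator which is sectorial: for some $\theta_0\in(0,\pi/2]$ and $C>0$, every $\lambda\in\Sigma_{\theta_0}$ lies in the resolvent set of $A$ and $\|(\lambda-A)^{-1}\|\le C/|\lambda|$. Put $\theta_1=\min\{\frac{\pi(1-\alpha)+2\theta_0}{2\alpha},\frac\pi2\}$; powers $\lambda^\alpha$ are principal. Consider an $s$-stage Runge–Kutta method ($s\ge1$) with real coefficients $\mathcal A=(a_{ij})$, $b^T=(b_j)$, $c=(c_i)$, and put $q(z)=b^T(\mathrm{Id}-z\mathcal A)^{-1}$, $r(z)=1+z\,q(z)\mathbb 1$, where $\mathbb 1=(1,\dots,1)^T$. Assume that the method is $L$-stable ($|r(z)|\le1$ for $\operatorname{Re}z\le0$, and $r(z)\to0$ as $\operatorname{Re}z\to-\infty$), that $b^T$ is the last row of $\mathcal A$, that $\mathcal A$ is invertible, and that all eigenvalues of $\mathcal A$ have positive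 real part. Let $h>0$. Let $\Gamma\subset\Sigma_{\theta_1}$ be a (piecewise $C^1$) contour which comes from infinity in the lower half-plane and goes to infinity in the upper half-plane, its tangent direction converging at either end to that of a ray which makes an acute angle with the negative real half-axis, and which satisfies $h\Gamma\cap\sigma(\mathcal A^{-1})=\emptyset$. For $g:\mathbb R\to X$ let $G_n=(g(nh+c_kh))_{k=1}^s\in X^s$. For $\lambda\in\Gamma$ let $(y_{\lambda,n})_{n\ge0}$ be the result of applying the Runge–Kutta method with step size $h$ to $y'=\lambda y+g(t)$, $y(0)=0$. The Runge–Kutta convolution quadrature approximation at $t_N=Nh$ is $$u_N=\frac1{2\pi i}\int_\Gamma(\lambda^\alpha-A)^{-1}y_{\lambda,N}\,d\lambda .$$ The convolution quadrature weights $W_n$ (bounded operators on $X^s$) are the coefficients of the generating function $$h\sum_{n\ge0}W_n\zeta^n=\Big(\big(\tfrac{\Delta(\zeta)}h\big)^{\alpha}\otimes\mathrm{Id}-\mathrm{Id}_s\otimes A\Big)^{-1},\qquad \Delta(\zeta)=\Big(\mathcal A+\frac{\zeta}{1-\zeta}\mathbb 1b^T\Big)^{-1},$$ for $\zeta$ near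 $0$, with the principal power of matrices. **Proposition.** 1. For every $n\ge0$ the integral $$w_n=\frac1{2\pi i}\int_\Gamma r(h\lambda)^n\,q(h\lambda)\otimes(\lambda^\alpha-A)^{-1}\,d\lambda$$ converges absolutely in the space of bounded operators $X^s\to X$. For every $g$ and every $\lambda\in\Gamma$ the sequence $(y_{\lambda,n})$ exists and is unique; and for every $N\ge0$ the integral defining $u_N$ converges absolutely and $$u_N=h\sum_{n=0}^{N-1}w_n\,G_{N-1-n}.$$ 2. The weights $W_n$ exist and are unique. If, moreover, the points of $h^{-1}\sigma(\mathcal A^{-1})$ lie to the right of $\Gamma$ (each of them can be joined, in the complement of $\Gamma$, to all sufficiently large positive real numbers), then $w_n=(e_s^T\otimes\mathrm{Id})W_n$ for all $n\ge0$, and hence for all $g$ and $N$ $$u_N=h\,(e_s^T\otimes\mathrm{Id})\sum_{n=0}^{N-1}W_n\,G_{N-1-n}=h\sum_{n=0}^{N-1}w_n\,G_{N-1-n}.$$ -/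

import Mathlib

open Filter Topology

noncomputable section

namespace FracCQ

/-! ### Sectors, resolvents, sectorial operators -/

/-- The open sector `{z ≠ 0 : |arg z| < π/2 + θ}`. -/
def sector (θ : ℝ) : Set ℂ := {z | z ≠ 0 ∧ |z.arg| < Real.pi / 2 + θ}

/-- The angle `θ₁ = min {(π(1-α) + 2θ₀)/(2α), π/2}`. -/
def theta1 (α θ₀ : ℝ) : ℝ :=
  min ((Real.pi * (1 - α) + 2 * θ₀) / (2 * α)) (Real.pi / 2)

/-- `R` is a bounded, everywhere defined, two-sided inverse of the (unbounded) operator `T`. -/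
def IsBoundedInverse {E : Type*} [NormedAddCommGroup E] [NormedSpace ℂ E]
    (T : E →ₗ.[ℂ] E) (R : E →L[ℂ] E) : Prop :=
  (∀ y : E, ∃ x : T.domain, (x : E) = R y ∧ T x = y) ∧ ∀ x : T.domain, R (T x) = x

variable {X : Type*} [NormedAddCommGroup X] [NormedSpace ℂ X]

/-- The operator `z - A`, with the domain of `A`. -/
def shiftOp (z : ℂ) (A : X →ₗ.[ℂ] X) : X →ₗ.[ℂ] X where
  domain := A.domain
  toFun := z • A.domain.subtype - A.toFun

open Classical in
/-- The resolvent `(z - A)⁻¹` (with the value `0` if `z` is not in the resolvent set). -/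
def resolventOp (A : X →ₗ.[ℂ] X) (z : ℂ) : X →L[ℂ] X :=
  if h : ∃ R, IsBoundedInverse (shiftOp z A) R then h.choose else 0

/-- `A` is closed and densely defined, the sector of angle `θ₀ ∈ (0, π/2]` lies in its resolvent
set (where the resolvent is then automatically analytic), and `‖(z - A)⁻¹‖ ≤ C / |z|` there. -/
structure IsSectorialOp (A : X →ₗ.[ℂ] X) (θ₀ : ℝ) : Prop where
  closed : A.IsClosed
  dense_domain : Dense (A.domain : Set X)
  angle_pos : 0 < θ₀
  angle_le : θ₀ ≤ Real.pi / 2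
  resolvent_exists : ∀ z ∈ sector θ₀, ∃ R, IsBoundedInverse (shiftOp z A) R
  resolvent_bound : ∃ C : ℝ, 0 < C ∧ ∀ z ∈ sector θ₀, ‖resolventOp A z‖ ≤ C / ‖z‖

/-! ### Runge–Kutta methods -/

/-- The coefficients of an `s`-stage Runge–Kutta method. -/
structure RungeKutta (s : ℕ) where
  a : Matrix (Fin s) (Fin s) ℝ
  b : Fin s → ℝ
  c : Fin s → ℝ

/-- The index of the last stage. -/
def lastStage (s : ℕ) [NeZero s] : Fin s := ⟨s - 1, Nat.sub_one_lt (NeZero.ne s)⟩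

namespace RungeKutta

variable {s : ℕ} (rk : RungeKutta s)

/-- The Runge–Kutta matrix, with complex entries. -/
def mat : Matrix (Fin s) (Fin s) ℂ := rk.a.map Complex.ofReal

/-- The weights, with complex entries. -/
def wt : Fin s → ℂ := fun j => (rk.b j : ℂ)

/-- The row vector `q(z) = bᵀ (1 - z 𝒜)⁻¹`. -/
def q (z : ℂ) : Fin s → ℂ := Matrix.vecMul rk.wt (1 - z • rk.mat)⁻¹

/-- The stability function `r(z) = 1 + z q(z) 𝟙`. -/
def r (z : ℂ) : ℂ := 1 + z * ∑ j, rk.q z j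

/-- `L`-stability: `|r(z)| ≤ 1` for `Re z ≤ 0`, and `r(z) → 0` as `Re z → -∞`. -/
def LStable : Prop :=
  (∀ z : ℂ, z.re ≤ 0 → ‖rk.r z‖ ≤ 1) ∧ Tendsto rk.r (comap Complex.re atBot) (𝓝 0)

/-- The standing assumptions on the method: it is `L`-stable, `bᵀ` is the last row of `𝒜`, and
`𝒜` is invertible with all eigenvalues in the open right half-plane. -/
structure Admissible [NeZero s] : Prop where
  lStable : rk.LStable
  last_row : ∀ j, rk.b j = rk.a (lastStage s) j
  invertible : IsUnit rk.a
  eigenvalues : ∀ z ∈ spectrum ℂ rk.mat, 0 < z.re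

/-- `y` is a sequence produced by the method with step size `h` for the initial value problem
`y' = f(t, y)`, `y(0) = y₀`. -/
def IsTrajectory (f : ℝ → X → X) (y₀ : X) (h : ℝ) (y : ℕ → X) : Prop :=
  y 0 = y₀ ∧ ∀ n : ℕ, ∃ Y : Fin s → X,
    (∀ i, Y i = y n + (h : ℂ) • ∑ j, (rk.a i j : ℂ) • f (n * h + rk.c j * h) (Y j)) ∧
    y (n + 1) = y n + (h : ℂ) • ∑ j, (rk.b j : ℂ) • f (n * h + rk.c j * h) (Y j)

/-- The right-hand side of `y' = z y + g(t)`. -/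
def linearField (g : ℝ → X) (z : ℂ) : ℝ → X → X := fun t v => z • v + g t

open Classical in
/-- The Runge–Kutta approximations `y_{z,n}` for `y' = z y + g(t)`, `y(0) = 0`
(with the value `0` if the method cannot be carried out). -/
def approx (g : ℝ → X) (h : ℝ) (z : ℂ) : ℕ → X :=
  if H : ∃ y, rk.IsTrajectory (linearField g z) 0 h y then H.choose else 0

/-- The vector `G_n = (g(t_n + c_k h))_{k=1..s}`. -/
def G (g : ℝ → X) (h : ℝ) (n : ℕ) : Fin s → X := fun k => g (n * h + rk.c k * h)

/-- `Δ(ζ) = (𝒜 + ζ/(1-ζ) 𝟙 bᵀ)⁻¹`. -/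
def delta (ζ : ℂ) : Matrix (Fin s) (Fin s) ℂ :=
  (rk.mat + (ζ / (1 - ζ)) • Matrix.vecMulVec (fun _ => 1) rk.wt)⁻¹

end RungeKutta

/-! ### Contours -/

/-- `γ` parametrizes a contour in the set `S` which comes from infinity in the lower half-plane and
goes to infinity in the upper half-plane (that is, it runs counter-clockwise around the negative
real half-axis), forming at both ends an acute angle `π/2 - φ` with the negative real half-axis.
The regularity required includes all piecewise `C¹` curves. -/
structure IsContour (S : Set ℂ) (γ : ℝ → ℂ) : Prop where
  mem : ∀ x, γ x ∈ S
  lipschitz : LocallyLipschitz γ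
  piecewise : ∃ F : Set ℝ, F.Finite ∧ ContDiffOn ℝ 1 γ Fᶜ
  top_infinity : Tendsto γ atTop (cocompact ℂ)
  bot_infinity : Tendsto γ atBot (cocompact ℂ)
  top_angle : ∃ φ : ℝ, 0 < φ ∧ φ < Real.pi / 2 ∧
    Tendsto (fun x => deriv γ x / (‖deriv γ x‖ : ℂ)) atTop
      (𝓝 (Complex.exp (((Real.pi / 2 + φ : ℝ) : ℂ) * Complex.I)))
  bot_angle : ∃ φ : ℝ, 0 < φ ∧ φ < Real.pi / 2 ∧
    Tendsto (fun x => deriv γ x / (‖deriv γ x‖ : ℂ)) atBot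
      (𝓝 (-Complex.exp (-((Real.pi / 2 + φ : ℝ) : ℂ) * Complex.I)))

/-- The point `p` lies to the right of the contour: in the complement of the contour it can be
joined to every sufficiently large real number. -/
def RightOf (γ : ℝ → ℂ) (p : ℂ) : Prop :=
  ∃ R : ℝ, ∀ x : ℝ, R ≤ x → JoinedIn (Set.range γ)ᶜ p (x : ℂ)

/-- The integrand of `∫_Γ f(z) dz` in the parametrization `γ`. -/
def pullback {E : Type*} [NormedAddCommGroup E] [NormedSpace ℂ E] (γ : ℝ → ℂ) (f : ℂ → E) :
    ℝ → E := fun x => deriv γ x • f (γ x)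

/-- `(2πi)⁻¹ ∫_Γ f(z) dz`. -/
def contourInt {E : Type*} [NormedAddCommGroup E] [NormedSpace ℂ E] (γ : ℝ → ℂ) (f : ℂ → E) : E :=
  (2 * (Real.pi : ℂ) * Complex.I)⁻¹ • ∫ x : ℝ, pullback γ f x

/-! ### Convolution quadrature -/

/-- `v ⊗ R : X^s → X` for a row vector `v` and a bounded operator `R`: `x ↦ ∑ⱼ vⱼ R xⱼ`. -/
def rowTensor {s : ℕ} (v : Fin s → ℂ) (R : X →L[ℂ] X) : (Fin s → X) →L[ℂ] X :=
  ∑ j, v j • R.comp (ContinuousLinearMap.proj j)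

/-- `P ⊗ Id - Id_s ⊗ A` on `X^s`, with domain `D(A)^s`. -/
def blockShift {s : ℕ} (P : Matrix (Fin s) (Fin s) ℂ) (A : X →ₗ.[ℂ] X) :
    (Fin s → X) →ₗ.[ℂ] (Fin s → X) where
  domain := Submodule.pi Set.univ (fun _ => A.domain)
  toFun := LinearMap.pi fun i =>
    (∑ j, P i j • LinearMap.proj j).comp (Submodule.subtype _) -
      A.toFun.comp (LinearMap.codRestrict A.domain
        ((LinearMap.proj i).comp (Submodule.subtype _)) fun x => x.2 i (Set.mem_univ i))

/-- `P = M^α` (principal branch), as a primary matrix function: `M` has no eigenvalue in `(-∞, 0]`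
and `P = p(M)` for a polynomial `p` which agrees with `z ↦ z^α` to order `s` at each eigenvalue of
the `s × s` matrix `M`. -/
def IsPrincipalPower {s : ℕ} (M : Matrix (Fin s) (Fin s) ℂ) (α : ℝ)
    (P : Matrix (Fin s) (Fin s) ℂ) : Prop :=
  (∀ μ ∈ spectrum ℂ M, μ ∈ Complex.slitPlane) ∧
  ∃ p : Polynomial ℂ, P = Polynomial.aeval M p ∧
    ∀ μ ∈ spectrum ℂ M, ∀ k < s,
      (Polynomial.derivative^[k] p).eval μ = iteratedDeriv k (fun z : ℂ => z ^ (α : ℂ)) μ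

/-- `W` is the sequence of coefficients of the generating function
`h ∑ₙ Wₙ ζⁿ = ((Δ(ζ)/h)^α - A)⁻¹`, in the operator norm, for `ζ` near `0`. -/
def IsCQWeights {s : ℕ} (rk : RungeKutta s) (A : X →ₗ.[ℂ] X) (α h : ℝ)
    (W : ℕ → (Fin s → X) →L[ℂ] (Fin s → X)) : Prop :=
  ∃ ρ : ℝ, 0 < ρ ∧ ∀ ζ : ℂ, ‖ζ‖ < ρ → ∃ P : Matrix (Fin s) (Fin s) ℂ,
    ∃ R : (Fin s → X) →L[ℂ] (Fin s → X),
      IsPrincipalPower ((h : ℂ)⁻¹ • rk.delta ζ) α P ∧ IsBoundedInverse (blockShift P A) R ∧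
      HasSum (fun n : ℕ => ζ ^ n • (h : ℂ) • W n) R

/-- `(e_sᵀ ⊗ Id) W`, the last row of an operator on `X^s`. -/
def lastRow {s : ℕ} [NeZero s] (W : (Fin s → X) →L[ℂ] (Fin s → X)) : (Fin s → X) →L[ℂ] X :=
  (ContinuousLinearMap.proj (lastStage s)).comp W

/-- The integrand `r(hz)ⁿ q(hz) ⊗ (z^α - A)⁻¹`. -/
def weightKernel {s : ℕ} (rk : RungeKutta s) (A : X →ₗ.[ℂ] X) (α h : ℝ) (n : ℕ) (z : ℂ) :
    (Fin s → X) →L[ℂ] X :=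
  rk.r (h * z) ^ n • rowTensor (rk.q (h * z)) (resolventOp A (z ^ (α : ℂ)))

/-- The weight `wₙ = (2πi)⁻¹ ∫_Γ r(hz)ⁿ q(hz) ⊗ (z^α - A)⁻¹ dz`. -/
def weight {s : ℕ} (rk : RungeKutta s) (A : X →ₗ.[ℂ] X) (α h : ℝ) (γ : ℝ → ℂ) (n : ℕ) :
    (Fin s → X) →L[ℂ] X :=
  contourInt γ (weightKernel rk A α h n)

/-- The integrand `(z^α - A)⁻¹ y_{z,N}`, where `y_{z,N}` is the Runge–Kutta approximation at
`t_N = N h` to the solution of `y' = z y + g`, `y(0) = 0`. -/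
def cqKernel {s : ℕ} (rk : RungeKutta s) (A : X →ₗ.[ℂ] X) (α h : ℝ) (g : ℝ → X) (N : ℕ) (z : ℂ) :
    X :=
  resolventOp A (z ^ (α : ℂ)) (rk.approx g h z N)

/-- The Runge–Kutta convolution quadrature approximation
`u_N = (2πi)⁻¹ ∫_Γ (z^α - A)⁻¹ y_{z,N} dz` of
`u(t_N) = (2πi)⁻¹ ∫_Γ (z^α - A)⁻¹ y_z(t_N) dz`. -/
def cqApprox {s : ℕ} (rk : RungeKutta s) (A : X →ₗ.[ℂ] X) (α h : ℝ) (γ : ℝ → ℂ) (g : ℝ → X)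
    (N : ℕ) : X :=
  contourInt γ (cqKernel rk A α h g N)

end FracCQ

end

open FracCQ

/-! Put M = h⁻¹𝒜⁻¹ and E = h⁻¹𝒜⁻¹𝟙eₛᵀ. Since bᵀ is the last row of 𝒜, bᵀ𝒜⁻¹ = eₛᵀ; as 𝟙eₛᵀ is
idempotent, Δ(ζ)/h = M − ζE is affine in ζ (`delta_eq`). For small ζ the resolvent (z − Δ(ζ)/h)⁻¹ is
therefore the Neumann series Σ ζⁿ (z − M)⁻¹(−E(z − M)⁻¹)ⁿ. The last row of (z − M)⁻¹ is −h q(hz),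
and h q(hz)E = r(hz)eₛᵀ, so the last row of the n-th coefficient is −h r(hz)ⁿq(hz)
(`lastRow_neumannTerm_mul`). This links the scalar recursion on Γ with the generating function.

For the first part, eliminating the stages gives yₙ₊₁ = r(hz)yₙ + h q(hz)Gₙ, which unrolls to a
discrete convolution (`approx_eq`). The power z^α maps the sector of angle θ₁ into that of angle θ₀,
so (z^α − A)⁻¹ = O(|z|^(-α)), and the kernels are O(|z|^(-1-α)). At the ends of Γ the arc length is
controlled by the growth of Im z, whence integrability (`IsContour.decayPath`).

The second part is a holomorphic functional calculus for F(z) = Id ⊗ (z^α − A)⁻¹ at a matrix m with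
annihilating polynomial. Dividing with remainder, F(z) = Φ + (z − m)Ψ(z) with Ψ holomorphic
(`exists_resolvent_quotient`), so (z − m)⁻¹F = (z − m)⁻¹Φ + Ψ. Around a circle enclosing the
spectrum the integral is 2πiΦ (`circleIntegral_resolvent_mul`). Along Γ, with the spectrum on its
right, it is −2πiΦ (`IsContour.integral_resolvent_mul`): partial fractions reduce the resolvent to
scalar integrals, which are evaluated by logarithms, and a primitive obtained by integrating along
rays disposes of the holomorphic remainder.

Finally Φ inverts m^α ⊗ Id − Id ⊗ A, because (1 + (z^α − 1)D)F(z) = D with D = Id ⊗ (1 − A)⁻¹ passes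
through the circle integral. Taking m = Δ(ζ)/h and expanding in ζ yields the weights. The circle
serves for existence; the contour, together with uniqueness of power series coefficients, serves for
the comparison with wₙ. -/

namespace FracCQ

open MeasureTheory Set

/-! ### Functions with power decay on closed sets -/

section Decay

variable {E : Type*} [NormedAddCommGroup E]

/-- `φ` is continuous on `K` and `φ z = O((1 + |z|)^(-k))` there. -/
def HasDecay (K : Set ℂ) (k : ℝ) (φ : ℂ → E) : Prop :=
  ContinuousOn φ K ∧ ∃ C : ℝ, 0 ≤ C ∧ ∀ z ∈ K, ‖φ z‖ ≤ C * (1 + ‖z‖) ^ (-k)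

theorem HasDecay.mono {K : Set ℂ} {k l : ℝ} {φ : ℂ → E} (hφ : HasDecay K k φ) (hl : l ≤ k) :
    HasDecay K l φ := by
  obtain ⟨hc, C, hC, hb⟩ := hφ
  refine ⟨hc, C, hC, fun z hz => (hb z hz).trans ?_⟩
  gcongr
  linarith [norm_nonneg z]

theorem HasDecay.mono_set {K L : Set ℂ} {k : ℝ} {φ : ℂ → E} (hφ : HasDecay K k φ) (hL : L ⊆ K) :
    HasDecay L k φ := by
  obtain ⟨hc, C, hC, hb⟩ := hφ
  exact ⟨hc.mono hL, C, hC, fun z hz => hb z (hL hz)⟩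

theorem HasDecay.congr {K : Set ℂ} {k : ℝ} {φ ψ : ℂ → E} (hφ : HasDecay K k φ)
    (h : ∀ z ∈ K, ψ z = φ z) : HasDecay K k ψ := by
  obtain ⟨hc, C, hC, hb⟩ := hφ
  exact ⟨hc.congr h, C, hC, fun z hz => by rw [h z hz]; exact hb z hz⟩

theorem hasDecay_const (K : Set ℂ) (c : E) : HasDecay K 0 (fun _ => c) :=
  ⟨continuousOn_const, ‖c‖, norm_nonneg _, fun z _ => by simp⟩

theorem HasDecay.add {K : Set ℂ} {k : ℝ} {φ ψ : ℂ → E} (hφ : HasDecay K k φ)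
    (hψ : HasDecay K k ψ) : HasDecay K k (fun z => φ z + ψ z) := by
  obtain ⟨hc, C, hC, hb⟩ := hφ
  obtain ⟨hc', C', hC', hb'⟩ := hψ
  refine ⟨hc.add hc', C + C', by positivity, fun z hz => (norm_add_le _ _).trans ?_⟩
  rw [add_mul]
  exact add_le_add (hb z hz) (hb' z hz)

theorem HasDecay.neg {K : Set ℂ} {k : ℝ} {φ : ℂ → E} (hφ : HasDecay K k φ) :
    HasDecay K k (fun z => -φ z) := by
  obtain ⟨hc, C, hC, hb⟩ := hφ
  exact ⟨hc.neg, C, hC, fun z hz => by rw [norm_neg]; exact hb z hz⟩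

theorem HasDecay.sub {K : Set ℂ} {k : ℝ} {φ ψ : ℂ → E} (hφ : HasDecay K k φ)
    (hψ : HasDecay K k ψ) : HasDecay K k (fun z => φ z - ψ z) := by
  simpa [sub_eq_add_neg] using hφ.add hψ.neg

theorem decay_mul_bound {k l C C' a b : ℝ} {z : ℂ} (hC : 0 ≤ C) (ha : a ≤ C * (1 + ‖z‖) ^ (-k))
    (hb : b ≤ C' * (1 + ‖z‖) ^ (-l)) (hb0 : 0 ≤ b) :
    a * b ≤ C * C' * (1 + ‖z‖) ^ (-(k + l)) := by
  have h1 : (0 : ℝ) < 1 + ‖z‖ := by positivity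
  rw [neg_add, Real.rpow_add h1]
  calc a * b ≤ (C * (1 + ‖z‖) ^ (-k)) * (C' * (1 + ‖z‖) ^ (-l)) := by gcongr
    _ = _ := by ring

theorem HasDecay.smul [NormedSpace ℂ E] {K : Set ℂ} {k l : ℝ} {φ : ℂ → ℂ} {ψ : ℂ → E}
    (hφ : HasDecay K k φ) (hψ : HasDecay K l ψ) : HasDecay K (k + l) (fun z => φ z • ψ z) := by
  obtain ⟨hc, C, hC, hb⟩ := hφ
  obtain ⟨hc', C', hC', hb'⟩ := hψ
  refine ⟨hc.smul hc', C * C', by positivity, fun z hz => ?_⟩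
  rw [norm_smul]
  exact decay_mul_bound hC (hb z hz) (hb' z hz) (norm_nonneg _)

theorem HasDecay.mul {𝔅 : Type*} [NormedRing 𝔅] {K : Set ℂ} {k l : ℝ} {φ ψ : ℂ → 𝔅}
    (hφ : HasDecay K k φ) (hψ : HasDecay K l ψ) : HasDecay K (k + l) (fun z => φ z * ψ z) := by
  obtain ⟨hc, C, hC, hb⟩ := hφ
  obtain ⟨hc', C', hC', hb'⟩ := hψ
  refine ⟨hc.mul hc', C * C', by positivity, fun z hz => (norm_mul_le _ _).trans ?_⟩
  exact decay_mul_bound hC (hb z hz) (hb' z hz) (norm_nonneg _)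

theorem HasDecay.clm {F : Type*} [NormedAddCommGroup F] [NormedSpace ℂ E] [NormedSpace ℂ F]
    (L : E →L[ℂ] F) {K : Set ℂ} {k : ℝ} {φ : ℂ → E} (hφ : HasDecay K k φ) :
    HasDecay K k (fun z => L (φ z)) := by
  obtain ⟨hc, C, hC, hb⟩ := hφ
  refine ⟨L.continuous.comp_continuousOn hc, ‖L‖ * C, by positivity, fun z hz => ?_⟩
  rw [mul_assoc]
  exact (L.le_opNorm _).trans (by gcongr; exact hb z hz)

/-- The resolvent of an element of a Banach algebra decays like `1/|z|` on closed subsets of the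
resolvent set. -/
theorem hasDecay_resolvent {𝔅 : Type*} [NormedRing 𝔅] [NormedAlgebra ℂ 𝔅] [CompleteSpace 𝔅] (m : 𝔅)
    {K : Set ℂ} (hK : IsClosed K) (hKm : K ⊆ resolventSet ℂ m) : HasDecay K 1 (resolvent m) := by
  have hc : ContinuousOn (resolvent m) K := fun z hz =>
    (spectrum.hasDerivAt_resolvent_const_left (hKm hz)).continuousAt.continuousWithinAt
  obtain ⟨C, hC⟩ := (spectrum.resolvent_isBigO_inv (𝕜 := ℂ) m).bound
  obtain ⟨R, hR⟩ : ∃ R : ℝ, ∀ z : ℂ, R < ‖z‖ → ‖resolvent m z‖ ≤ C * ‖z⁻¹‖ := by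
    rw [← comap_norm_atTop] at hC
    obtain ⟨R, hR⟩ := ((atTop_basis_Ioi (α := ℝ)).comap norm).eventually_iff.1 hC
    exact ⟨R, fun z hz => hR.2 hz⟩
  obtain ⟨B, hB⟩ := ((isCompact_closedBall (0 : ℂ) (max R 1)).inter_right hK).exists_bound_of_continuousOn
    (hc.mono inter_subset_right)
  refine ⟨hc, max (|C| * 2) (|B| * (1 + max R 1)), by positivity, fun z hz => ?_⟩
  have h1 : (0 : ℝ) < 1 + ‖z‖ := by positivity
  rw [Real.rpow_neg_one, ← div_eq_mul_inv, le_div_iff₀ h1]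
  by_cases hzR : ‖z‖ ≤ max R 1
  · refine le_max_of_le_right ?_
    have := hB z ⟨by simpa using hzR, hz⟩
    gcongr
    exact this.trans (le_abs_self _)
  · refine le_max_of_le_left ?_
    push Not at hzR
    have hz1 : 1 < ‖z‖ := (le_max_right _ _).trans_lt hzR
    have := hR z ((le_max_left _ _).trans_lt hzR)
    rw [norm_inv] at this
    calc ‖resolvent m z‖ * (1 + ‖z‖) ≤ (|C| * ‖z‖⁻¹) * (2 * ‖z‖) := by
          gcongr
          · exact this.trans (by gcongr; exact le_abs_self _)
          · linarith
      _ = |C| * 2 := by field_simp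

theorem hasDecay_inv_sub {K : Set ℂ} (hK : IsClosed K) {a : ℂ} (ha : a ∉ K) :
    HasDecay K 1 (fun z => (z - a)⁻¹) := by
  refine (hasDecay_resolvent a hK fun z hz => ?_).congr fun z _ => by
    simp [resolvent]
  simp only [resolventSet, mem_ofPred_eq, Algebra.algebraMap_self, RingHom.id_apply, isUnit_iff_ne_zero]
  exact sub_ne_zero.2 (ne_of_mem_of_not_mem hz ha)

theorem hasDecay_prod_inv {K : Set ℂ} (hK : IsClosed K) (S : Multiset ℂ) (hS : ∀ a ∈ S, a ∉ K) :
    HasDecay K (Multiset.card S) (fun z => (S.map fun a => (z - a)⁻¹).prod) := by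
  induction S using Multiset.induction_on with
  | empty => simpa using hasDecay_const K (1 : ℂ)
  | cons a S ih =>
    have := (hasDecay_inv_sub hK (hS a (by simp))).mul (ih fun b hb => hS b (by simp [hb]))
    simpa [add_comm] using this

end Decay

/-! ### Partial fractions: resolvent integrals reduced to scalar ones -/

section Paths

/-- A path `γ` with velocity `d`, parametrized over the measure `μ`, along which functions decaying
faster than `|z|^(-1-β)` are integrable. -/
structure DecayPath (d γ : ℝ → ℂ) (μ : Measure ℝ) (β : ℝ) : Prop where
  measurable : Measurable d
  continuous : Continuous γ
  closed : IsClosed (range γ)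
  integrable : Integrable (fun x => ‖d x‖ * (1 + ‖γ x‖) ^ (-(1 + β))) μ
  le_one : β ≤ 1

variable {d γ : ℝ → ℂ} {μ : Measure ℝ} {β : ℝ}

theorem DecayPath.integrable_smul {E : Type*} [NormedAddCommGroup E] [NormedSpace ℂ E]
    (hp : DecayPath d γ μ β) {φ : ℂ → E} {k : ℝ} (hφ : HasDecay (range γ) k φ) (hk : 1 + β ≤ k) :
    Integrable (fun x => d x • φ (γ x)) μ := by
  obtain ⟨hc, C, hC, hb⟩ := hφ.mono hk
  refine (hp.integrable.const_mul C).mono' ?_ (ae_of_all _ fun x => ?_)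
  · exact hp.measurable.aestronglyMeasurable.smul
      (hc.comp_continuous hp.continuous fun x => mem_range_self x).aestronglyMeasurable
  · rw [norm_smul]
    calc ‖d x‖ * ‖φ (γ x)‖ ≤ ‖d x‖ * (C * (1 + ‖γ x‖) ^ (-(1 + β))) := by
          gcongr; exact hb _ (mem_range_self x)
      _ = _ := by ring

/-- Induction on the number of factors. Two distinct poles a, b are separated by (z−a)⁻¹(z−b)⁻¹ =
(a−b)⁻¹((z−a)⁻¹ − (z−b)⁻¹), which leaves one factor fewer; if all poles coincide the product is a
pure power, covered by `h2`. -/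
theorem integral_prod_inv_eq_zero (hp : DecayPath d γ μ β) {V : Set ℂ}
    (hV : ∀ a ∈ V, a ∉ range γ)
    (h1 : ∀ a ∈ V, ∀ b ∈ V, ∫ x, d x • ((γ x - a)⁻¹ - (γ x - b)⁻¹) ∂μ = 0)
    (h2 : ∀ a ∈ V, ∀ n : ℕ, ∫ x, d x • ((γ x - a)⁻¹) ^ (n + 2) ∂μ = 0) (n : ℕ) :
    ∀ S : Multiset ℂ, Multiset.card S = n + 2 → (∀ a ∈ S, a ∈ V) →
      ∫ x, d x • (S.map fun a => (γ x - a)⁻¹).prod ∂μ = 0 := by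
  induction n with
  | zero =>
    intro S hS hSV
    obtain ⟨a, b, rfl⟩ := Multiset.card_eq_two.1 hS
    have ha := hSV a (by simp)
    have hb := hSV b (by simp)
    by_cases hab : a = b
    · subst hab
      simpa [pow_two] using h2 a ha 0
    · have : ∀ x, d x • (Multiset.map (fun a => (γ x - a)⁻¹) {a, b}).prod =
          (a - b)⁻¹ * (d x • ((γ x - a)⁻¹ - (γ x - b)⁻¹)) := fun x => by
        have hxa : γ x - a ≠ 0 := sub_ne_zero.2 fun h => hV a ha ⟨x, h⟩
        have hxb : γ x - b ≠ 0 := sub_ne_zero.2 fun h => hV b hb ⟨x, h⟩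
        have hab' : a - b ≠ 0 := sub_ne_zero.2 hab
        simp
        field_simp
        ring
      simp_rw [this]
      rw [integral_const_mul, h1 a ha b hb, mul_zero]
  | succ n ih =>
    intro S hS hSV
    by_cases hall : ∃ a ∈ S, ∃ b ∈ S, a ≠ b
    · obtain ⟨a, ha, b, hb, hab⟩ := hall
      obtain ⟨T, rfl⟩ := Multiset.exists_cons_of_mem ha
      obtain ⟨T, rfl⟩ := Multiset.exists_cons_of_mem
        ((Multiset.mem_cons.1 hb).resolve_left (Ne.symm hab))
      have hT : Multiset.card T = n + 1 := by simpa using hS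
      have hVa := hSV a (by simp)
      have hVb := hSV b (by simp)
      have : ∀ x, d x • (Multiset.map (fun a => (γ x - a)⁻¹) (a ::ₘ b ::ₘ T)).prod =
          (a - b)⁻¹ * (d x • (Multiset.map (fun a => (γ x - a)⁻¹) (a ::ₘ T)).prod -
            d x • (Multiset.map (fun a => (γ x - a)⁻¹) (b ::ₘ T)).prod) := fun x => by
        have hxa : γ x - a ≠ 0 := sub_ne_zero.2 fun h => hV a hVa ⟨x, h⟩
        have hxb : γ x - b ≠ 0 := sub_ne_zero.2 fun h => hV b hVb ⟨x, h⟩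
        have hab' : a - b ≠ 0 := sub_ne_zero.2 hab
        simp
        field_simp
        ring
      have h_int : ∀ c ∈ V, Integrable
          (fun x => d x • (Multiset.map (fun a => (γ x - a)⁻¹) (c ::ₘ T)).prod) μ := by
        intro c hc
        refine hp.integrable_smul (hasDecay_prod_inv hp.closed (c ::ₘ T) fun t ht => ?_) ?_
        · rcases Multiset.mem_cons.1 ht with rfl | ht
          · exact hV _ hc
          · exact hV _ (hSV t (by simp [ht]))
        · have := hp.le_one
          simp [hT]
          have : (0 : ℝ) ≤ n := n.cast_nonneg
          linarith
      simp_rw [this]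
      rw [integral_const_mul, integral_sub (h_int a hVa) (h_int b hVb), ih, ih]
      · simp
      · simp [hT]
      · intro t ht
        rcases Multiset.mem_cons.1 ht with rfl | ht
        · exact hVb
        · exact hSV t (by simp [ht])
      · simp [hT]
      · intro t ht
        rcases Multiset.mem_cons.1 ht with rfl | ht
        · exact hVa
        · exact hSV t (by simp [ht])
    · push Not at hall
      obtain ⟨a, ha⟩ : ∃ a, a ∈ S := Multiset.card_pos_iff_exists_mem.1 (by omega)
      have hrep : S = Multiset.replicate (n + 1 + 2) a :=
        Multiset.eq_replicate.2 ⟨hS, fun b hb => (hall a ha b hb).symm⟩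
      simp only [hrep, Multiset.map_replicate, Multiset.prod_replicate]
      exact h2 a (hSV a ha) (n + 1)

variable {𝔅 : Type*} [NormedRing 𝔅] [NormedAlgebra ℂ 𝔅]

/-- Each application gains a factor (z−a)⁻¹ at the price of multiplying N by m − a. Running through
the roots of an annihilating polynomial makes the last term vanish. -/
theorem resolvent_mul_eq {m N : 𝔅} {z a : ℂ} (hz : z ∈ resolventSet ℂ m) (hza : z - a ≠ 0) :
    resolvent m z * N = (z - a)⁻¹ • N +
      (z - a)⁻¹ • (resolvent m z * ((m - algebraMap ℂ 𝔅 a) * N)) := by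
  have h1 : resolvent m z * (algebraMap ℂ 𝔅 z - m) = 1 := Ring.inverse_mul_cancel _ hz
  have h2 : (m - algebraMap ℂ 𝔅 a) = (z - a) • 1 - (algebraMap ℂ 𝔅 z - m) := by
    rw [sub_smul, Algebra.algebraMap_eq_smul_one, Algebra.algebraMap_eq_smul_one]; abel
  rw [h2, sub_mul, mul_sub, ← mul_assoc _ _ N, ← mul_assoc _ _ N, h1, smul_sub]
  simp [smul_smul, inv_mul_cancel₀ hza]

variable [CompleteSpace 𝔅]

/-- The roots in `l` are peeled off one at a time with `resolvent_mul_eq`. Every step leaves behind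
a scalar product of at least two inverse factors, whose integral is zero, and the process stops once
the accumulated product of the m − a annihilates N. -/
theorem integral_prod_inv_resolvent_eq_zero (hp : DecayPath d γ μ β) {V : Set ℂ}
    (hV : ∀ a ∈ V, a ∉ range γ)
    (h1 : ∀ a ∈ V, ∀ b ∈ V, ∫ x, d x • ((γ x - a)⁻¹ - (γ x - b)⁻¹) ∂μ = 0)
    (h2 : ∀ a ∈ V, ∀ n : ℕ, ∫ x, d x • ((γ x - a)⁻¹) ^ (n + 2) ∂μ = 0)
    (m : 𝔅) (hm : range γ ⊆ resolventSet ℂ m) (l : List ℂ) (hl : ∀ a ∈ l, a ∈ V) :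
    ∀ (N : 𝔅) (S : Multiset ℂ), (∀ a ∈ S, a ∈ V) → 1 ≤ Multiset.card S →
      l.foldl (fun N a => (m - algebraMap ℂ 𝔅 a) * N) N = 0 →
      ∫ x, d x • ((S.map fun a => (γ x - a)⁻¹).prod • (resolvent m (γ x) * N)) ∂μ = 0 := by
  induction l with
  | nil =>
    intro N S _ _ hN
    simp only [List.foldl_nil] at hN
    simp [hN]
  | cons a l ih =>
    intro N S hS hS1 hN
    have ha := hl a (by simp)
    have hcard : (2 : ℝ) ≤ Multiset.card (a ::ₘ S) := by
      rw [Multiset.card_cons]; exact_mod_cast Nat.succ_le_succ hS1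
    have hmem : ∀ t ∈ a ::ₘ S, t ∈ V := fun t ht => by
      rcases Multiset.mem_cons.1 ht with rfl | ht
      · exact ha
      · exact hS t ht
    have hdec := hasDecay_prod_inv hp.closed (a ::ₘ S) fun t ht => hV t (hmem t ht)
    have hβ := hp.le_one
    have hi1 : Integrable (fun x => d x • (((a ::ₘ S).map fun a => (γ x - a)⁻¹).prod • N)) μ :=
      hp.integrable_smul (hdec.smul (hasDecay_const _ N)) (by linarith)
    have hi2 : Integrable (fun x => d x • (((a ::ₘ S).map fun a => (γ x - a)⁻¹).prod •
        (resolvent m (γ x) * ((m - algebraMap ℂ 𝔅 a) * N)))) μ :=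
      hp.integrable_smul (hdec.smul ((hasDecay_resolvent m hp.closed hm).mul
        (hasDecay_const _ ((m - algebraMap ℂ 𝔅 a) * N)))) (by linarith)
    have key : ∀ x, d x • ((S.map fun a => (γ x - a)⁻¹).prod • (resolvent m (γ x) * N)) =
        d x • (((a ::ₘ S).map fun a => (γ x - a)⁻¹).prod • N) +
        d x • (((a ::ₘ S).map fun a => (γ x - a)⁻¹).prod •
        (resolvent m (γ x) * ((m - algebraMap ℂ 𝔅 a) * N))) := fun x => by
      have hxa : γ x - a ≠ 0 := sub_ne_zero.2 fun h => hV a ha ⟨x, h⟩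
      rw [resolvent_mul_eq (hm (mem_range_self x)) hxa (N := N), Multiset.map_cons,
        Multiset.prod_cons]
      simp only [smul_add, smul_smul]
      congr 2 <;> ring
    simp_rw [key]
    rw [integral_add hi1 hi2, ih (fun t ht => hl t (by simp [ht])) _ _ hmem (by simp) hN, add_zero]
    have : ∀ x, d x • (((a ::ₘ S).map fun a => (γ x - a)⁻¹).prod • N) =
        (d x • ((a ::ₘ S).map fun a => (γ x - a)⁻¹).prod) • N := fun x => (smul_assoc _ _ _).symm
    simp_rw [this]
    rw [integral_smul_const, integral_prod_inv_eq_zero hp hV h1 h2 (Multiset.card S - 1) _ _ hmem,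
      zero_smul]
    simp; omega

/-- The integral of the resolvent of an algebraic element agrees with that of `(z - a)⁻¹`. -/
theorem integral_resolvent_sub_eq_zero (hp : DecayPath d γ μ β) {V : Set ℂ}
    (hV : ∀ a ∈ V, a ∉ range γ)
    (h1 : ∀ a ∈ V, ∀ b ∈ V, ∫ x, d x • ((γ x - a)⁻¹ - (γ x - b)⁻¹) ∂μ = 0)
    (h2 : ∀ a ∈ V, ∀ n : ℕ, ∫ x, d x • ((γ x - a)⁻¹) ^ (n + 2) ∂μ = 0)
    (m : 𝔅) (hm : range γ ⊆ resolventSet ℂ m) (a : ℂ) (l : List ℂ) (ha : a ∈ V)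
    (hl : ∀ b ∈ l, b ∈ V)
    (hml : (a :: l).foldl (fun N b => (m - algebraMap ℂ 𝔅 b) * N) 1 = 0) :
    ∫ x, d x • (resolvent m (γ x) - (γ x - a)⁻¹ • (1 : 𝔅)) ∂μ = 0 := by
  -- The first root is treated by hand: it turns (z−m)⁻¹ − (z−a)⁻¹ into (z−a)⁻¹(z−m)⁻¹(m−a), which
  -- decays fast enough for the induction.
  have := integral_prod_inv_resolvent_eq_zero hp hV h1 h2 m hm l hl (m - algebraMap ℂ 𝔅 a) {a}
    (by simpa using ha) (by simp) (by simpa using hml)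
  rw [← this]
  congr 1
  ext1 x
  have hxa : γ x - a ≠ 0 := sub_ne_zero.2 fun h => hV a ha ⟨x, h⟩
  have h3 := resolvent_mul_eq (hm (mem_range_self x)) hxa (N := 1)
  rw [mul_one, mul_one] at h3
  nth_rewrite 1 [h3]
  simp

end Paths

/-! ### Integrability at an end of a contour -/

section Ends

/-- Integrating the bound gives |η(x) − η(a)| ≤ C (Im η(x) − Im η(a)), so Im η must carry η to
infinity. The integrand is then at most C times (Im η)' (Im η)^(-1-β), the derivative of −(Im
η)^(-β)/β, which tends to zero. -/
theorem tendsto_im_atTop_of_deriv_bound {η : ℝ → ℂ} {F : Set ℝ} (hF : F.Finite)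
    (hd : ∀ x ∉ F, DifferentiableAt ℝ η x) (hinf : Tendsto η atTop (cocompact ℂ)) {C : ℝ}
    (hC : 0 < C) (hb : ∀ᶠ x in atTop, ‖deriv η x‖ ≤ C * (deriv η x).im) :
    Tendsto (fun x => (η x).im) atTop atTop ∧
    ∀ β : ℝ, 0 < β → IntegrableAtFilter (fun x => ‖deriv η x‖ * (1 + ‖η x‖) ^ (-(1 + β))) atTop := by
  have hd' : ∀ᶠ x in atTop, DifferentiableAt ℝ η x := by
    obtain ⟨b, hb⟩ := hF.bddAbove
    filter_upwards [eventually_gt_atTop b] with x hx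
    exact hd x fun h => (hb h).not_gt hx
  obtain ⟨a, ha⟩ := eventually_atTop.1 (hb.and hd')
  have him : ∀ x, a ≤ x → HasDerivAt (fun x => (η x).im) (deriv η x).im x := fun x hx =>
    Complex.imCLM.hasFDerivAt.comp_hasDerivAt x (ha x hx).2.hasDerivAt
  have key : ∀ x, a ≤ x → ‖η x - η a‖ ≤ C * ((η x).im - (η a).im) := by
    intro x hx
    refine image_norm_le_of_norm_deriv_right_le_deriv_boundary' (f := fun x => η x - η a)
      (f' := deriv η) (B := fun x => C * ((η x).im - (η a).im))
      (B' := fun x => C * (deriv η x).im) (a := a) (b := x) ?_ ?_ ?_ ?_ ?_ ?_ ⟨hx, le_rfl⟩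
    · exact fun y hy => ((ha y hy.1).2.continuousAt.sub continuousAt_const).continuousWithinAt
    · exact fun y hy => ((ha y hy.1).2.hasDerivAt.sub_const _).hasDerivWithinAt
    · simp
    · exact fun y hy => (((him y hy.1).continuousAt.sub continuousAt_const).const_smul C).continuousWithinAt
    · exact fun y hy => (((him y hy.1).sub_const _).const_mul C).hasDerivWithinAt
    · exact fun y hy => (ha y hy.1).1
  have hlim : Tendsto (fun x => (η x).im) atTop atTop := by
    have h1 : Tendsto (fun x => ‖η x‖) atTop atTop := (tendsto_norm_cocompact_atTop (E := ℂ)).comp hinf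
    have h2 : Tendsto (fun x => C⁻¹ * (‖η x‖ - ‖η a‖) + (η a).im) atTop atTop :=
      tendsto_atTop_add_const_right _ _
        ((tendsto_atTop_add_const_right _ _ h1).const_mul_atTop (inv_pos.2 hC))
    refine tendsto_atTop_mono' _ ?_ h2
    filter_upwards [eventually_ge_atTop a] with x hx
    have h3 := (norm_sub_norm_le (η x) (η a)).trans (key x hx)
    rw [← le_sub_iff_add_le, inv_mul_le_iff₀ hC]
    exact h3
  refine ⟨hlim, fun β hβ => ?_⟩
  obtain ⟨b, hb⟩ := eventually_atTop.1 ((hlim.eventually_ge_atTop 1).and (eventually_ge_atTop a))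
  refine ⟨Ioi b, Ioi_mem_atTop b, ?_⟩
  have hderiv : ∀ x ∈ Ici b, HasDerivAt (fun x => -(((η x).im) ^ (-β) / β))
      ((deriv η x).im * (η x).im ^ (-(1 + β))) x := by
    intro x hx
    have h1 : (η x).im ≠ 0 := by have := (hb x hx).1; linarith
    have := (((him x (hb x hx).2).rpow_const (p := -β) (Or.inl h1)).div_const β).neg
    refine this.congr_deriv ?_
    rw [show -β - 1 = -(1 + β) by ring]
    field_simp
  have hnn : ∀ x ∈ Ici b, 0 ≤ (deriv η x).im := fun x hx =>
    nonneg_of_mul_nonneg_right ((norm_nonneg _).trans (ha x (hb x hx).2).1) hC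
  have h_int := integrableOn_Ioi_deriv_of_nonneg' hderiv (fun x hx =>
    mul_nonneg (hnn x (mem_Ici_of_Ioi hx)) (Real.rpow_nonneg (by linarith [(hb x (le_of_lt hx)).1]) _))
    (l := 0) (by
      have := (((tendsto_rpow_neg_atTop hβ).comp hlim).div_const β).neg
      simpa using this)
  refine (h_int.const_mul C).mono' ?_ ?_
  · have hη : ContinuousOn η (Ioi b) := fun x hx =>
      (ha x (hb x (le_of_lt hx)).2).2.continuousAt.continuousWithinAt
    refine (measurable_deriv η).norm.aestronglyMeasurable.mul ?_
    refine ContinuousOn.aestronglyMeasurable ?_ measurableSet_Ioi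
    exact (continuousOn_const.add hη.norm).rpow_const fun x _ =>
      Or.inl (show (1 : ℝ) + ‖η x‖ ≠ 0 by positivity)
  · refine (ae_restrict_iff' measurableSet_Ioi).2 (ae_of_all _ fun x hx => ?_)
    have hx' := hb x (le_of_lt hx)
    have h0 : 0 < (η x).im := by linarith [hx'.1]
    rw [Real.norm_of_nonneg (by positivity), ← mul_assoc]
    refine mul_le_mul (ha x hx'.2).1 ?_ (by positivity)
      (mul_nonneg hC.le (hnn x (mem_Ici_of_Ioi hx)))
    refine Real.rpow_le_rpow_of_nonpos h0 ?_ (by linarith)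
    linarith [Complex.im_le_norm (η x)]

end Ends

/-! ### Contours as paths of integration -/

section Contour

variable {S : Set ℂ} {γ : ℝ → ℂ}

/-- Eventually the unit tangent has imaginary part above Im e / 2, hence the constant 2 / Im e.
Where the derivative vanishes the quotient is 0 by convention and the bound is trivial. -/
theorem exists_deriv_bound_of_tendsto {l : Filter ℝ} {e : ℂ} (he : 0 < e.im)
    (h : Tendsto (fun x => deriv γ x / (‖deriv γ x‖ : ℂ)) l (𝓝 e)) :
    ∃ C : ℝ, 0 < C ∧ ∀ᶠ x in l, ‖deriv γ x‖ ≤ C * (deriv γ x).im := by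
  refine ⟨2 / e.im, by positivity, ?_⟩
  have h1 := (Complex.continuous_im.tendsto e).comp h
  filter_upwards [h1.eventually (lt_mem_nhds (show e.im / 2 < e.im by linarith))] with x hx
  simp only [Function.comp_apply, Complex.div_ofReal_im] at hx
  rcases eq_or_ne (deriv γ x) 0 with h0 | h0
  · simp [h0]
  · have : 0 < ‖deriv γ x‖ := norm_pos_iff.2 h0
    rw [lt_div_iff₀ this] at hx
    rw [div_mul_eq_mul_div, le_div_iff₀ he]
    linarith

theorem IsContour.differentiableAt (hγ : IsContour S γ) :
    ∃ F : Set ℝ, F.Finite ∧ ∀ x ∉ F, DifferentiableAt ℝ γ x := by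
  obtain ⟨F, hF, h⟩ := hγ.piecewise
  exact ⟨F, hF, fun x hx => (h.differentiableOn (by simp)).differentiableAt
    (hF.isClosed.isOpen_compl.mem_nhds hx)⟩

theorem IsContour.top_im (hγ : IsContour S γ) : Tendsto (fun x => (γ x).im) atTop atTop ∧
    ∀ β : ℝ, 0 < β → IntegrableAtFilter (fun x => ‖deriv γ x‖ * (1 + ‖γ x‖) ^ (-(1 + β))) atTop := by
  obtain ⟨F, hF, hd⟩ := hγ.differentiableAt
  obtain ⟨φ, h0, h1, h⟩ := hγ.top_angle
  obtain ⟨C, hC, hb⟩ := exists_deriv_bound_of_tendsto (by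
    rw [Complex.exp_ofReal_mul_I_im, add_comm, Real.sin_add_pi_div_two]
    exact Real.cos_pos_of_mem_Ioo ⟨by linarith, h1⟩) h
  exact tendsto_im_atTop_of_deriv_bound hF hd hγ.top_infinity hC hb

/-- The reflection x ↦ conj γ(−x) exchanges the two ends, so the lower end is reduced to the upper
one. -/
theorem deriv_conj_comp_neg (γ : ℝ → ℂ) (x : ℝ) :
    deriv (fun x => (starRingEnd ℂ) (γ (-x))) x = -(starRingEnd ℂ) (deriv γ (-x)) := by
  rw [deriv_comp_neg (fun y => (starRingEnd ℂ) (γ y))]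
  congr 1
  exact deriv.star (f := γ)

theorem IsContour.bot_im (hγ : IsContour S γ) : Tendsto (fun x => (γ x).im) atBot atBot ∧
    ∀ β : ℝ, 0 < β → IntegrableAtFilter (fun x => ‖deriv γ x‖ * (1 + ‖γ x‖) ^ (-(1 + β))) atBot := by
  obtain ⟨F, hF, hd⟩ := hγ.differentiableAt
  obtain ⟨φ, h0, h1, h⟩ := hγ.bot_angle
  obtain ⟨C, hC, hb⟩ := exists_deriv_bound_of_tendsto (by
    rw [Complex.neg_im, ← Complex.ofReal_neg, Complex.exp_ofReal_mul_I_im, Real.sin_neg, neg_neg,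
      add_comm, Real.sin_add_pi_div_two]
    exact Real.cos_pos_of_mem_Ioo ⟨by linarith, h1⟩) h
  obtain ⟨h1, h2⟩ := tendsto_im_atTop_of_deriv_bound (η := fun x => (starRingEnd ℂ) (γ (-x)))
    (F := Neg.neg ⁻¹' F) (hF.preimage neg_injective.injOn) (fun x hx => by
      have h3 : DifferentiableAt ℝ (fun y => γ (-y)) x :=
        (hd (-x) hx).comp x differentiableAt_id.neg
      exact Complex.conjCLE.differentiableAt.comp x h3)
    ((Complex.conjCLE.toHomeomorph.isClosedEmbedding.tendsto_cocompact).comp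
      (hγ.bot_infinity.comp tendsto_neg_atTop_atBot)) hC (by
      filter_upwards [tendsto_neg_atTop_atBot.eventually hb] with x hx
      rw [deriv_conj_comp_neg]
      simpa using hx)
  refine ⟨?_, fun β hβ => ?_⟩
  · have := tendsto_neg_atTop_atBot.comp (h1.comp tendsto_neg_atBot_atTop)
    simpa [Function.comp_def] using this
  · obtain ⟨s, hs, hi⟩ := h2 β hβ
    refine ⟨Neg.neg ⁻¹' s, tendsto_neg_atBot_atTop hs, ?_⟩
    have := ((Measure.measurePreserving_neg (volume : Measure ℝ)).integrableOn_comp_preimage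
      (Homeomorph.neg ℝ).measurableEmbedding (s := s)).2 hi
    simpa [Function.comp_def, deriv_conj_comp_neg] using this

theorem IsContour.isClosed_range (hγ : IsContour S γ) : IsClosed (range γ) := by
  have : IsProperMap γ := isProperMap_iff_tendsto_cocompact.2 ⟨hγ.lipschitz.continuous, by
    rw [cocompact_eq_atBot_atTop]
    exact hγ.bot_infinity.sup hγ.top_infinity⟩
  exact this.isClosedMap.isClosed_range

theorem IsContour.decayPath (hγ : IsContour S γ) {β : ℝ} (hβ : 0 < β) (hβ1 : β ≤ 1) :
    DecayPath (deriv γ) γ volume β where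
  measurable := measurable_deriv γ
  continuous := hγ.lipschitz.continuous
  closed := hγ.isClosed_range
  le_one := hβ1
  integrable := by
    refine integrable_iff_integrableAtFilter_atBot_atTop.2
      ⟨⟨hγ.bot_im.2 β hβ, hγ.top_im.2 β hβ⟩, fun x => ?_⟩
    -- Away from the ends, a local Lipschitz constant bounds the speed, and the weight is at most 1.
    obtain ⟨K, t, ht, hK⟩ := hγ.lipschitz x
    obtain ⟨u, hut, hu, hxu⟩ := mem_nhds_iff.1 ht
    obtain ⟨ε, hε, hεu⟩ := Metric.isOpen_iff.1 hu x hxu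
    refine ⟨Metric.ball x ε, Metric.ball_mem_nhds x hε, ?_⟩
    refine Measure.integrableOn_of_bounded (M := K) (by simp [Real.volume_ball, ENNReal.mul_eq_top]) ?_ ?_
    · refine (measurable_deriv γ).norm.aestronglyMeasurable.mul (Continuous.aestronglyMeasurable ?_)
      exact (continuous_const.add hγ.lipschitz.continuous.norm).rpow_const
        fun x => Or.inl (show (1 : ℝ) + ‖γ x‖ ≠ 0 by positivity)
    · refine (ae_restrict_iff' measurableSet_ball).2 (ae_of_all _ fun y hy => ?_)
      have h1 := norm_deriv_le_of_lipschitzOn (hu.mem_nhds (hεu hy)) (hK.mono hut)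
      rw [Real.norm_of_nonneg (by positivity)]
      refine (mul_le_of_le_one_right (norm_nonneg _) ?_).trans h1
      exact Real.rpow_le_one_of_one_le_of_nonpos (by linarith [norm_nonneg (γ y)]) (by linarith)

/-- The fundamental theorem of calculus along a contour. -/
theorem IsContour.integral_eq_sub {E : Type*} [NormedAddCommGroup E] [NormedSpace ℂ E]
    [CompleteSpace E] (hγ : IsContour S γ) {H G : ℂ → E}
    (hH : ∀ x, HasDerivAt H (G (γ x)) (γ x))
    (hi : Integrable (fun x => deriv γ x • G (γ x))) {lt lb : E}
    (ht : Tendsto (fun x => H (γ x)) atTop (𝓝 lt)) (hb : Tendsto (fun x => H (γ x)) atBot (𝓝 lb)) :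
    ∫ x, deriv γ x • G (γ x) = lt - lb := by
  obtain ⟨F, hF, hd⟩ := hγ.differentiableAt
  have h1 : ∀ n : ℝ, ∫ x in (-n)..n, deriv γ x • G (γ x) = H (γ n) - H (γ (-n)) := fun n =>
    integral_eq_of_hasDerivAt_off_countable (fun x => H (γ x)) _ hF.countable
      (fun x _ => ((hH x).continuousAt.comp hγ.lipschitz.continuous.continuousAt).continuousWithinAt)
      (fun x hx => (hH x).scomp x (hd x hx.2).hasDerivAt) hi.intervalIntegrable
  have h2 := intervalIntegral_tendsto_integral hi tendsto_neg_atTop_atBot tendsto_id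
  have h3 := ht.sub (hb.comp tendsto_neg_atTop_atBot)
  refine tendsto_nhds_unique h2 (h3.congr fun n => ?_)
  exact (h1 n).symm

end Contour

/-! ### Scalar integrals along the contour and the side of a pole -/

section Winding

variable {S : Set ℂ} {γ : ℝ → ℂ}

theorem tendsto_inv_sub_of_tendsto_cocompact {l : Filter ℝ} (h : Tendsto γ l (cocompact ℂ)) (a : ℂ) :
    Tendsto (fun x => (γ x - a)⁻¹) l (𝓝 0) := by
  refine tendsto_inv₀_cobounded.comp ?_
  rw [← tendsto_norm_atTop_iff_cobounded]
  have h1 : Tendsto (fun x => ‖γ x‖ - ‖a‖) l atTop :=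
    tendsto_atTop_add_const_right _ _ ((tendsto_norm_cocompact_atTop (E := ℂ)).comp h)
  exact tendsto_atTop_mono (fun x => norm_sub_norm_le _ _) h1

theorem hasDecay_inv_sub_inv {K : Set ℂ} (hK : IsClosed K) {a b : ℂ} (ha : a ∉ K) (hb : b ∉ K) :
    HasDecay K 2 (fun z => (z - a)⁻¹ - (z - b)⁻¹) := by
  have := (hasDecay_const K (a - b)).mul ((hasDecay_inv_sub hK ha).mul (hasDecay_inv_sub hK hb))
  norm_num at this
  refine this.congr fun z hz => ?_
  have hza : z - a ≠ 0 := sub_ne_zero.2 (ne_of_mem_of_not_mem hz ha)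
  have hzb : z - b ≠ 0 := sub_ne_zero.2 (ne_of_mem_of_not_mem hz hb)
  field_simp
  ring

theorem IsContour.integrable_inv_sub_inv (hγ : IsContour S γ) {a b : ℂ} (ha : a ∉ range γ)
    (hb : b ∉ range γ) : Integrable (fun x => deriv γ x • ((γ x - a)⁻¹ - (γ x - b)⁻¹)) :=
  (hγ.decayPath one_pos le_rfl).integrable_smul
    (hasDecay_inv_sub_inv hγ.isClosed_range ha hb) (by norm_num)

theorem IsContour.integral_inv_pow (hγ : IsContour S γ) {a : ℂ} (ha : a ∉ range γ) (n : ℕ) :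
    ∫ x, deriv γ x • ((γ x - a)⁻¹) ^ (n + 2) = 0 := by
  have hi : Integrable (fun x => deriv γ x • ((γ x - a)⁻¹) ^ (n + 2)) := by
    have := hasDecay_prod_inv hγ.isClosed_range (Multiset.replicate (n + 2) a) fun b hb => by
      rwa [Multiset.eq_of_mem_replicate hb]
    have h2 := (hγ.decayPath one_pos le_rfl).integrable_smul this (by
      simp only [Multiset.card_replicate, Nat.cast_add, Nat.cast_ofNat]
      have : (0 : ℝ) ≤ n := n.cast_nonneg
      linarith)
    simpa only [Multiset.map_replicate, Multiset.prod_replicate] using h2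
  have hlim : ∀ l : Filter ℝ, Tendsto γ l (cocompact ℂ) →
      Tendsto (fun x => -(((γ x - a)⁻¹) ^ (n + 1) / (n + 1))) l (𝓝 0) := fun l hl => by
    have := (((tendsto_inv_sub_of_tendsto_cocompact hl a).pow (n + 1)).div_const ((n : ℂ) + 1)).neg
    simpa using this
  have := hγ.integral_eq_sub (H := fun z => -(((z - a)⁻¹) ^ (n + 1) / (n + 1)))
    (G := fun z => ((z - a)⁻¹) ^ (n + 2)) (fun x => by
      have hxa : γ x - a ≠ 0 := sub_ne_zero.2 fun h => ha ⟨x, h⟩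
      have hn : (n : ℂ) + 1 ≠ 0 := Nat.cast_add_one_ne_zero n
      have := ((((hasDerivAt_id (γ x)).sub_const a).inv hxa).pow (n + 1)).div_const ((n : ℂ) + 1)
      refine this.neg.congr_deriv ?_
      simp only [Pi.inv_apply, id_eq, Nat.cast_add, Nat.cast_one, add_tsub_cancel_right]
      rw [pow_add _ n 2, inv_pow _ 2]
      field_simp)
    hi (hlim _ hγ.top_infinity) (hlim _ hγ.bot_infinity)
  simpa using this

/-- The map z ↦ (z−p)/(z−q) takes values in (−∞, 0] only on the segment from p to q. Hence the
principal logarithm of this quotient is a primitive along the contour, and it tends to log 1 = 0 at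
both ends. -/
theorem IsContour.integral_inv_sub_inv_of_segment (hγ : IsContour S γ) {p q : ℂ}
    (hpq : segment ℝ p q ⊆ (range γ)ᶜ) :
    ∫ x, deriv γ x • ((γ x - p)⁻¹ - (γ x - q)⁻¹) = 0 := by
  have hp : p ∉ range γ := hpq (left_mem_segment ℝ p q)
  have hq : q ∉ range γ := hpq (right_mem_segment ℝ p q)
  have hxp : ∀ x, γ x - p ≠ 0 := fun x => sub_ne_zero.2 fun h => hp ⟨x, h⟩
  have hxq : ∀ x, γ x - q ≠ 0 := fun x => sub_ne_zero.2 fun h => hq ⟨x, h⟩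
  have hslit : ∀ x, (γ x - p) / (γ x - q) ∈ Complex.slitPlane := by
    intro x
    by_contra hcon
    rw [Complex.mem_slitPlane_iff_not_le_zero, not_not, Complex.le_def] at hcon
    set w := (γ x - p) / (γ x - q) with hw
    have hwr : w = (w.re : ℂ) := Complex.ext rfl (by simpa using hcon.2)
    have hre : w.re ≤ 0 := by simpa using hcon.1
    have h1 : γ x - p = w * (γ x - q) := by rw [hw, div_mul_cancel₀ _ (hxq x)]
    refine hpq (a := γ x) ?_ (mem_range_self x)
    have hpos : (0 : ℝ) < 1 - w.re := by linarith
    -- Solving γ x − p = w (γ x − q) for γ x, with w ≤ 0 real, gives a convex combination of p and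
    -- q.
    refine ⟨1 / (1 - w.re), -w.re / (1 - w.re), by positivity,
      div_nonneg (by linarith) hpos.le, by field_simp; ring, ?_⟩
    have hne : (1 : ℂ) - (w.re : ℂ) ≠ 0 := by exact_mod_cast hpos.ne'
    rw [hwr] at h1
    simp only [Complex.real_smul]
    push_cast
    field_simp
    linear_combination -h1
  have hlim : ∀ l : Filter ℝ, Tendsto γ l (cocompact ℂ) →
      Tendsto (fun x => Complex.log ((γ x - p) / (γ x - q))) l (𝓝 0) := fun l hl => by
    have h1 : Tendsto (fun x => (γ x - p) / (γ x - q)) l (𝓝 1) := by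
      have h2 := ((tendsto_inv_sub_of_tendsto_cocompact hl q).const_mul (q - p)).const_add 1
      rw [mul_zero, add_zero] at h2
      refine h2.congr fun x => ?_
      have := hxq x
      field_simp
      ring
    have := h1.clog (by simp)
    simpa using this
  have := hγ.integral_eq_sub (H := fun z => Complex.log ((z - p) / (z - q)))
    (G := fun z => (z - p)⁻¹ - (z - q)⁻¹) (fun x => by
      have h1 := (((hasDerivAt_id (γ x)).sub_const p).div ((hasDerivAt_id (γ x)).sub_const q)
        (hxq x)).clog (hslit x)
      refine h1.congr_deriv ?_
      have := hxp x
      have := hxq x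
      simp only [id_eq, Pi.div_apply]
      field_simp)
    (hγ.integrable_inv_sub_inv hp hq) (hlim _ hγ.top_infinity) (hlim _ hγ.bot_infinity)
  simpa using this

/-- Passing from R − z to z − R shifts the argument by π, with opposite signs in the two
half-planes. The two shifts add up to the 2πi in `integral_inv_sub_inv_of_large`. -/
theorem log_sub_log_of_im_pos {z : ℂ} {R : ℝ} (hz : 0 < z.im) :
    Complex.log (R - z) - Complex.log z = Complex.log ((z - R) / z) - Real.pi * Complex.I := by
  have hz0 : z ≠ 0 := fun h => by simp [h] at hz
  have hzR : 0 < (z - R).im := by simpa using hz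
  have hzR0 : z - R ≠ 0 := fun h => by simp [h] at hzR
  have h1 : Complex.log (R - z) = Complex.log (z - R) - Real.pi * Complex.I := by
    rw [← neg_sub z (R : ℂ), Complex.log, Complex.log, norm_neg,
      Complex.arg_neg_eq_arg_sub_pi_of_im_pos hzR]
    push_cast; ring
  have a1 := Complex.arg_mem_Ioc z
  have a2 := Complex.arg_mem_Ioc (z - R)
  have a3 := Complex.arg_nonneg_iff.2 hz.le
  have a4 := Complex.arg_nonneg_iff.2 hzR.le
  have a5 : z.arg ≠ Real.pi := fun h => by
    have := (Complex.arg_eq_pi_iff.1 h).2; linarith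
  have h2 : Complex.log ((z - R) / z) = Complex.log (z - R) - Complex.log z := by
    rw [← Complex.log_exp (x := Complex.log (z - R) - Complex.log z), Complex.exp_sub,
      Complex.exp_log hzR0, Complex.exp_log hz0]
    · simp only [Complex.sub_im, Complex.log_im]
      have := lt_of_le_of_ne a1.2 a5
      linarith
    · simp only [Complex.sub_im, Complex.log_im]
      linarith [a2.2]
  rw [h1, h2]; ring

theorem log_sub_log_of_im_neg {z : ℂ} {R : ℝ} (hz : z.im < 0) :
    Complex.log (R - z) - Complex.log z = Complex.log ((z - R) / z) + Real.pi * Complex.I := by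
  have hz0 : z ≠ 0 := fun h => by simp [h] at hz
  have hzR : (z - R).im < 0 := by simpa using hz
  have hzR0 : z - R ≠ 0 := fun h => by simp [h] at hzR
  have h1 : Complex.log (R - z) = Complex.log (z - R) + Real.pi * Complex.I := by
    rw [← neg_sub z (R : ℂ), Complex.log, Complex.log, norm_neg,
      Complex.arg_neg_eq_arg_add_pi_of_im_neg hzR]
    push_cast; ring
  have a1 := Complex.arg_mem_Ioc z
  have a2 := Complex.arg_mem_Ioc (z - R)
  have a3 := Complex.arg_neg_iff.2 hz
  have a4 := Complex.arg_neg_iff.2 hzR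
  have h2 : Complex.log ((z - R) / z) = Complex.log (z - R) - Complex.log z := by
    rw [← Complex.log_exp (x := Complex.log (z - R) - Complex.log z), Complex.exp_sub,
      Complex.exp_log hzR0, Complex.exp_log hz0]
    · simp only [Complex.sub_im, Complex.log_im]
      linarith [a2.1]
    · simp only [Complex.sub_im, Complex.log_im]
      linarith [a1.1]
  rw [h1, h2]; ring

/-- Near both ends the contour is off the real axis; the remaining compact piece has bounded real
part. -/
theorem IsContour.exists_forall_sub_mem_slitPlane (hγ : IsContour S γ) :
    ∃ R₀ : ℝ, ∀ R : ℝ, R₀ ≤ R → ∀ x, (R : ℂ) - γ x ∈ Complex.slitPlane := by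
  obtain ⟨a, ha⟩ := eventually_atTop.1 (hγ.top_im.1.eventually_gt_atTop 0)
  obtain ⟨b, hb⟩ := eventually_atBot.1 (hγ.bot_im.1.eventually_lt_atBot 0)
  obtain ⟨B, hB⟩ := (isCompact_Icc (a := b) (b := a)).exists_bound_of_continuousOn
    hγ.lipschitz.continuous.continuousOn
  refine ⟨B + 1, fun R hR x => ?_⟩
  rw [Complex.mem_slitPlane_iff]
  rcases le_total a x with hx | hx
  · right; have := ha x hx; simp; exact this.ne'
  rcases le_total x b with hx' | hx'
  · right; have := hb x hx'; simp; exact this.ne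
  · left
    have := (Complex.re_le_norm (γ x)).trans (hB x ⟨hx', hx⟩)
    simp
    linarith

/-- The primitive log(R − z) − log z needs both R − z and z off the cut. At the ends it differs from
log((z−R)/z), which tends to 0, by −πi above and +πi below. -/
theorem IsContour.integral_inv_sub_inv_of_large (hγ : IsContour S γ) (hS : S ⊆ Complex.slitPlane)
    {R : ℝ} (hR : ∀ x, (R : ℂ) - γ x ∈ Complex.slitPlane) :
    ∫ x, deriv γ x • ((γ x - R)⁻¹ - (γ x - 0)⁻¹) = -(2 * Real.pi * Complex.I) := by
  have h0 : ∀ x, γ x ∈ Complex.slitPlane := fun x => hS (hγ.mem x)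
  have hne : ∀ x, γ x ≠ 0 := fun x => Complex.slitPlane_ne_zero (h0 x)
  have hneR : ∀ x, γ x - R ≠ 0 := fun x => by
    have := Complex.slitPlane_ne_zero (hR x)
    rwa [← neg_sub, neg_ne_zero] at this
  have hlim : ∀ l : Filter ℝ, Tendsto γ l (cocompact ℂ) →
      Tendsto (fun x => Complex.log ((γ x - R) / γ x)) l (𝓝 0) := fun l hl => by
    have h1 : Tendsto (fun x => (γ x - R) / γ x) l (𝓝 1) := by
      have h2 := ((tendsto_inv_sub_of_tendsto_cocompact hl 0).const_mul (-(R : ℂ))).const_add 1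
      rw [mul_zero, add_zero] at h2
      refine h2.congr fun x => ?_
      have := hne x
      rw [sub_zero]
      field_simp
      ring
    have := h1.clog (by simp)
    simpa using this
  have ht : Tendsto (fun x => Complex.log (R - γ x) - Complex.log (γ x)) atTop
      (𝓝 (0 - Real.pi * Complex.I)) := by
    refine ((hlim _ hγ.top_infinity).sub_const _).congr' ?_
    filter_upwards [hγ.top_im.1.eventually_gt_atTop 0] with x hx
    exact (log_sub_log_of_im_pos hx).symm
  have hb : Tendsto (fun x => Complex.log (R - γ x) - Complex.log (γ x)) atBot
      (𝓝 (0 + Real.pi * Complex.I)) := by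
    refine ((hlim _ hγ.bot_infinity).add_const _).congr' ?_
    filter_upwards [hγ.bot_im.1.eventually_lt_atBot 0] with x hx
    exact (log_sub_log_of_im_neg hx).symm
  have := hγ.integral_eq_sub (H := fun z => Complex.log (R - z) - Complex.log z)
    (G := fun z => (z - R)⁻¹ - (z - 0)⁻¹) (fun x => by
      have h1 := (((hasDerivAt_id (γ x)).const_sub (R : ℂ)).clog (hR x)).sub
        ((hasDerivAt_id (γ x)).clog (h0 x))
      refine h1.congr_deriv ?_
      have := hneR x
      have := hne x
      simp only [id_eq, sub_zero]
      rw [← neg_sub (γ x) (R : ℂ), neg_div_neg_eq, one_div, one_div])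
    (hγ.integrable_inv_sub_inv (fun ⟨x, hx⟩ => hneR x (by rw [hx, sub_self]))
      fun ⟨x, hx⟩ => hne x hx) ht hb
  rw [this]; ring

theorem RightOf.notMem_range {p : ℂ} (hp : RightOf γ p) : p ∉ range γ := by
  obtain ⟨R, hR⟩ := hp
  exact (hR R le_rfl).mem.1

/-- Openness keeps the eigenvalues of M − ζE to the right of the contour for small ζ. -/
theorem isOpen_rightOf (hγ : IsClosed (range γ)) : IsOpen {p | RightOf γ p} := by
  rw [Metric.isOpen_iff]
  intro p hp
  obtain ⟨ε, hε, h⟩ := Metric.isOpen_iff.1 hγ.isOpen_compl p (RightOf.notMem_range hp)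
  refine ⟨ε, hε, fun q hq => ?_⟩
  obtain ⟨R, hR⟩ := hp
  exact ⟨R, fun x hx => (JoinedIn.of_segment_subset
    (((convex_ball p ε).segment_subset hq (Metric.mem_ball_self hε)).trans h)).trans (hR x hx)⟩

/-- As the second pole moves along a path in the complement, the integral is locally constant by the
segment case inside a small ball, hence constant. -/
theorem IsContour.integral_inv_sub_inv_of_joinedIn (hγ : IsContour S γ) {p q : ℂ}
    (hpq : JoinedIn (range γ)ᶜ p q) :
    ∫ x, deriv γ x • ((γ x - p)⁻¹ - (γ x - q)⁻¹) = 0 := by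
  obtain ⟨c, hc⟩ := hpq
  have hloc : IsLocallyConstant fun t => ∫ x, deriv γ x • ((γ x - p)⁻¹ - (γ x - c t)⁻¹) := by
    rw [IsLocallyConstant.iff_eventually_eq]
    intro t
    obtain ⟨ε, hε, h⟩ := Metric.isOpen_iff.1 hγ.isClosed_range.isOpen_compl _ (hc t)
    filter_upwards [c.continuous.continuousAt.eventually (Metric.ball_mem_nhds _ hε)] with u hu
    have h1 := hγ.integral_inv_sub_inv_of_segment
      (((convex_ball (c t) ε).segment_subset (Metric.mem_ball_self hε) hu).trans h)
    have hp : p ∉ range γ := by simpa using hc 0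
    rw [← sub_eq_zero, ← integral_sub (hγ.integrable_inv_sub_inv hp (hc u))
      (hγ.integrable_inv_sub_inv hp (hc t)), ← h1]
    congr 1
    ext x
    simp only [smul_eq_mul]
    ring
  have h1 := hloc.apply_eq_of_preconnectedSpace 1 0
  simpa using h1

theorem IsContour.integral_inv_sub_inv_of_rightOf (hγ : IsContour S γ) {p q : ℂ}
    (hp : RightOf γ p) (hq : RightOf γ q) :
    ∫ x, deriv γ x • ((γ x - p)⁻¹ - (γ x - q)⁻¹) = 0 := by
  obtain ⟨R, hR⟩ := hp
  obtain ⟨R', hR'⟩ := hq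
  exact hγ.integral_inv_sub_inv_of_joinedIn
    ((hR _ (le_max_left R R')).trans (hR' _ (le_max_right R R')).symm)

theorem IsContour.integral_inv_sub_inv_zero (hγ : IsContour S γ) (hS : S ⊆ Complex.slitPlane)
    {p : ℂ} (hp : RightOf γ p) :
    ∫ x, deriv γ x • ((γ x - p)⁻¹ - (γ x)⁻¹) = -(2 * Real.pi * Complex.I) := by
  obtain ⟨R, hR⟩ := hp
  obtain ⟨R', hR'⟩ := hγ.exists_forall_sub_mem_slitPlane
  have h1 := hγ.integral_inv_sub_inv_of_joinedIn (hR _ (le_max_left R R'))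
  have h2 := hγ.integral_inv_sub_inv_of_large hS (hR' _ (le_max_right R R'))
  have h0 : (0 : ℂ) ∉ range γ := fun ⟨x, hx⟩ => Complex.slitPlane_ne_zero (hS (hγ.mem x)) hx
  have hm := (hR _ (le_max_left R R')).mem
  have h3 := integral_add (hγ.integrable_inv_sub_inv hm.1 hm.2) (hγ.integrable_inv_sub_inv hm.2 h0)
  rw [h1, h2, zero_add] at h3
  rw [← h3]
  congr 1
  ext x
  simp only [smul_eq_mul, sub_zero]
  ring

end Winding

/-! ### Cauchy's theorem on a cone by integration along rays -/

section Rays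

variable {E : Type*} [NormedAddCommGroup E] [NormedSpace ℂ E]

/-- Uniform domination on a compact set: continuity handles 1 ≤ t ≤ T, and for t ≥ T the point tz
has norm at least R, where the decay hypothesis applies. -/
theorem exists_ray_bound {S : Set ℂ} (h0 : (0 : ℂ) ∉ S)
    (hcone : ∀ z ∈ S, ∀ t : ℝ, 1 ≤ t → (t : ℂ) * z ∈ S) {G : ℂ → E} (hG : ContinuousOn G S)
    {C R β : ℝ} (hβ : 0 < β)
    (hb : ∀ z ∈ S, R ≤ ‖z‖ → ‖G z‖ ≤ C * ‖z‖ ^ (-(1 + β))) {K : Set ℂ} (hK : IsCompact K)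
    (hKS : K ⊆ S) :
    ∃ M : ℝ, 0 ≤ M ∧ ∀ z ∈ K, ∀ t : ℝ, 1 ≤ t → ‖z • G (t * z)‖ ≤ M * t ^ (-(1 + β)) := by
  rcases K.eq_empty_or_nonempty with rfl | hne
  · exact ⟨0, le_rfl, by simp⟩
  obtain ⟨w, hw, hwmin⟩ := hK.exists_isMinOn hne continuous_norm.continuousOn
  have hδ : 0 < ‖w‖ := norm_pos_iff.2 fun h => h0 (h ▸ hKS hw)
  obtain ⟨B, hB⟩ := hK.exists_bound_of_continuousOn continuousOn_id
  set T := max 1 (R / ‖w‖) with hT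
  have hT1 : 1 ≤ T := le_max_left _ _
  have hc : ContinuousOn (fun p : ℝ × ℂ => p.2 • G (p.1 * p.2)) (Icc 1 T ×ˢ K) := by
    refine continuousOn_snd.smul (hG.comp ?_ fun p hp => hcone _ (hKS hp.2) _ hp.1.1)
    exact ((Complex.continuous_ofReal.comp continuous_fst).mul continuous_snd).continuousOn
  obtain ⟨M, hM⟩ := (isCompact_Icc.prod hK).exists_bound_of_continuousOn hc
  refine ⟨max (|B| * |C| * ‖w‖ ^ (-(1 + β))) (|M| * T ^ (1 + β)), by positivity, fun z hz t ht => ?_⟩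
  have ht0 : 0 < t := by linarith
  rcases le_total t T with htT | htT
  · have h1 := (hM (t, z) ⟨⟨ht, htT⟩, hz⟩).trans (le_abs_self M)
    refine h1.trans ?_
    calc |M| ≤ |M| * T ^ (1 + β) * t ^ (-(1 + β)) := by
          rw [mul_assoc, Real.rpow_neg ht0.le, ← div_eq_mul_inv]
          refine le_mul_of_one_le_right (abs_nonneg _) ?_
          rw [one_le_div (by positivity)]
          gcongr
      _ ≤ _ := by gcongr; exact le_max_right _ _
  · have hwz : ‖w‖ ≤ ‖z‖ := hwmin hz
    have hnorm : ‖(t : ℂ) * z‖ = t * ‖z‖ := by rw [norm_mul, Complex.norm_of_nonneg ht0.le]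
    have h2 : R ≤ ‖(t : ℂ) * z‖ := by
      rw [hnorm]
      calc R = R / ‖w‖ * ‖w‖ := by field_simp
        _ ≤ T * ‖w‖ := by gcongr; exact le_max_right _ _
        _ ≤ t * ‖z‖ := by gcongr
    have h3 := hb _ (hcone z (hKS hz) t ht) h2
    have hz' : ‖z‖ ≤ |B| := (hB z hz).trans (le_abs_self B)
    calc ‖z • G (t * z)‖ = ‖z‖ * ‖G (t * z)‖ := norm_smul _ _
      _ ≤ |B| * (|C| * (t * ‖w‖) ^ (-(1 + β))) := by
          gcongr
          refine h3.trans ?_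
          rw [hnorm]
          refine mul_le_mul (le_abs_self C) ?_ (by positivity) (abs_nonneg _)
          exact Real.rpow_le_rpow_of_nonpos (by positivity) (by gcongr) (by linarith)
      _ = |B| * |C| * ‖w‖ ^ (-(1 + β)) * t ^ (-(1 + β)) := by
          rw [Real.mul_rpow ht0.le hδ.le]; ring
      _ ≤ _ := by gcongr; exact le_max_left _ _

theorem norm_ray_integral_le {S : Set ℂ} (h0 : (0 : ℂ) ∉ S)
    (hcone : ∀ z ∈ S, ∀ t : ℝ, 1 ≤ t → (t : ℂ) * z ∈ S) {G : ℂ → E}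
    {C R β : ℝ} (hβ : 0 < β)
    (hb : ∀ z ∈ S, R ≤ ‖z‖ → ‖G z‖ ≤ C * ‖z‖ ^ (-(1 + β))) {z : ℂ} (hz : z ∈ S) (hR : R ≤ ‖z‖) :
    ‖-∫ t : ℝ in Ioi 1, z • G (t * z)‖ ≤ C / β * ‖z‖ ^ (-β) := by
  have hz0 : 0 < ‖z‖ := norm_pos_iff.2 fun h => h0 (h ▸ hz)
  have h_int : IntegrableOn (fun t : ℝ => C * ‖z‖ ^ (-β) * t ^ (-(1 + β))) (Ioi 1) :=
    (integrableOn_Ioi_rpow_of_lt (by linarith) one_pos).const_mul _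
  rw [norm_neg]
  refine (norm_integral_le_of_norm_le h_int ((ae_restrict_iff' measurableSet_Ioi).2
    (ae_of_all _ fun t ht => ?_))).trans_eq ?_
  · have ht1 : (1 : ℝ) < t := ht
    have ht0 : 0 < t := by linarith
    have hnorm : ‖(t : ℂ) * z‖ = t * ‖z‖ := by rw [norm_mul, Complex.norm_of_nonneg ht0.le]
    have h1 := hb _ (hcone z hz t ht1.le) (by rw [hnorm]; nlinarith)
    rw [hnorm, Real.mul_rpow ht0.le hz0.le] at h1
    rw [norm_smul]
    calc ‖z‖ * ‖G (t * z)‖ ≤ ‖z‖ * (C * (t ^ (-(1 + β)) * ‖z‖ ^ (-(1 + β)))) := by gcongr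
      _ = C * (‖z‖ ^ (1 : ℝ) * ‖z‖ ^ (-(1 + β))) * t ^ (-(1 + β)) := by rw [Real.rpow_one]; ring
      _ = _ := by rw [← Real.rpow_add hz0]; congr 3; ring
  · rw [integral_const_mul, integral_Ioi_rpow_of_lt (by linarith) one_pos, Real.one_rpow]
    have : -(1 + β) + 1 = -β := by ring
    rw [this]
    field_simp

variable [CompleteSpace E]

/-- The primitive of a decaying holomorphic function on a cone, obtained by integration along rays
to infinity. -/
theorem hasDerivAt_ray_integral {S : Set ℂ} (hS : IsOpen S) (h0 : (0 : ℂ) ∉ S)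
    (hcone : ∀ z ∈ S, ∀ t : ℝ, 1 ≤ t → (t : ℂ) * z ∈ S) {G : ℂ → E} (hG : DifferentiableOn ℂ G S)
    {C R β : ℝ} (hβ : 0 < β)
    (hb : ∀ z ∈ S, R ≤ ‖z‖ → ‖G z‖ ≤ C * ‖z‖ ^ (-(1 + β))) {z₀ : ℂ} (hz₀ : z₀ ∈ S) :
    HasDerivAt (fun z : ℂ => -∫ t : ℝ in Ioi 1, z • G (t * z)) (G z₀) z₀ := by
  obtain ⟨ε', hε', hball⟩ := Metric.isOpen_iff.1 hS z₀ hz₀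
  set ε := ε' / 3 with hε
  have hε0 : 0 < ε := by positivity
  have hKS : Metric.closedBall z₀ (2 * ε) ⊆ S :=
    (Metric.closedBall_subset_ball (by rw [hε]; linarith)).trans hball
  obtain ⟨M, hM0, hM⟩ := exists_ray_bound h0 hcone hG.continuousOn hβ hb
    (isCompact_closedBall z₀ (2 * ε)) hKS
  have hGd : ∀ z ∈ S, HasDerivAt G (deriv G z) z := fun z hz =>
    (hG.differentiableAt (hS.mem_nhds hz)).hasDerivAt
  have hGc : ContinuousOn (deriv G) S := (hG.deriv hS).continuousOn
  have hcont : ∀ z ∈ S, ContinuousOn (fun t : ℝ => G (t * z)) (Ioi 1) := fun z hz =>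
    hG.continuousOn.comp (by fun_prop) fun t ht => hcone z hz t (le_of_lt ht)
  have hFd : ∀ t : ℝ, 1 ≤ t → ∀ z ∈ S, HasDerivAt (fun z : ℂ => z • G (t * z))
      (z • ((t : ℂ) • deriv G (t * z)) + (1 : ℂ) • G (t * z)) z := fun t ht z hz => by
    have h1 := (hGd _ (hcone z hz t ht)).scomp z ((hasDerivAt_id z).const_mul (t : ℂ))
    have h2 := (hasDerivAt_id z).smul h1
    refine h2.congr_deriv ?_
    simp
  have hbint : IntegrableOn (fun t : ℝ => M / ε * t ^ (-(1 + β))) (Ioi 1) :=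
    (integrableOn_Ioi_rpow_of_lt (by linarith) one_pos).const_mul _
  have hmain := hasDerivAt_integral_of_dominated_loc_of_deriv_le
    (μ := volume.restrict (Ioi (1 : ℝ))) (F := fun (z : ℂ) (t : ℝ) => z • G (t * z))
    (F' := fun (z : ℂ) (t : ℝ) => z • ((t : ℂ) • deriv G (t * z)) + (1 : ℂ) • G (t * z))
    (x₀ := z₀) (s := Metric.ball z₀ ε) (bound := fun t => M / ε * t ^ (-(1 + β)))
    (Metric.ball_mem_nhds z₀ hε0) ?_ ?_ ?_ ?_ hbint ?_
  -- The z-derivative of z G(tz) is also the t-derivative of t G(tz), so its integral telescopes to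
  -- −G(z₀).
  · have hval : ∫ t : ℝ in Ioi 1, (z₀ • ((t : ℂ) • deriv G (t * z₀)) + (1 : ℂ) • G (t * z₀)) =
        0 - G z₀ := by
      have h1 : ∀ t ∈ Ici (1 : ℝ), HasDerivAt (fun t : ℝ => (t : ℂ) • G (t * z₀))
          (z₀ • ((t : ℂ) • deriv G (t * z₀)) + (1 : ℂ) • G (t * z₀)) t := fun t ht => by
        have e1 : HasDerivAt (fun t : ℝ => (t : ℂ)) 1 t := Complex.ofRealCLM.hasDerivAt
        have e2 := (hGd _ (hcone z₀ hz₀ t ht)).scomp t (e1.mul_const z₀)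
        have e3 := e1.smul e2
        refine e3.congr_deriv ?_
        simp only [one_mul, one_smul, Function.comp_apply, smul_smul]
        rw [mul_comm]
      have h2 := integral_Ioi_of_hasDerivAt_of_tendsto' h1 hmain.1 (m := 0) ?_
      · simpa using h2
      · have hz0 : 0 < ‖z₀‖ := norm_pos_iff.2 fun h => h0 (h ▸ hz₀)
        refine squeeze_zero_norm' (a := fun t : ℝ => M / ‖z₀‖ * t ^ (-β)) ?_ ?_
        · filter_upwards [eventually_ge_atTop 1] with t ht
          have ht0 : 0 < t := by linarith
          have h3 := hM z₀ (Metric.mem_closedBall_self (by positivity)) t ht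
          rw [norm_smul, mul_comm, ← le_div_iff₀ hz0] at h3
          rw [norm_smul, Complex.norm_of_nonneg ht0.le]
          calc t * ‖G (t * z₀)‖ ≤ t * (M * t ^ (-(1 + β)) / ‖z₀‖) := by gcongr
            _ = M / ‖z₀‖ * (t ^ (1 : ℝ) * t ^ (-(1 + β))) := by rw [Real.rpow_one]; ring
            _ = _ := by rw [← Real.rpow_add ht0]; congr 2; ring
        · simpa using (tendsto_rpow_neg_atTop hβ).const_mul (M / ‖z₀‖)
    refine hmain.2.neg.congr_deriv ?_
    rw [hval]; simp
  · filter_upwards [hS.mem_nhds hz₀] with z hz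
    exact ((hcont z hz).const_smul z).aestronglyMeasurable measurableSet_Ioi
  · refine ((integrableOn_Ioi_rpow_of_lt (a := -(1 + β)) (by linarith) one_pos).const_mul M).mono'
      (((hcont z₀ hz₀).const_smul z₀).aestronglyMeasurable measurableSet_Ioi)
      ((ae_restrict_iff' measurableSet_Ioi).2 (ae_of_all _ fun t ht =>
        hM z₀ (Metric.mem_closedBall_self (by positivity)) t (le_of_lt ht)))
  · refine ContinuousOn.aestronglyMeasurable ?_ measurableSet_Ioi
    refine ContinuousOn.add ?_ ((hcont z₀ hz₀).const_smul _)
    refine ContinuousOn.const_smul (ContinuousOn.smul (by fun_prop) ?_) _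
    exact hGc.comp (by fun_prop) fun t ht => hcone z₀ hz₀ t (le_of_lt ht)
  -- Cauchy's estimate on a disc of radius ε bounds the derivative by M/ε times the weight; such
  -- discs centred in the ε-ball stay inside the closed 2ε-ball, where `hM` holds.
  · refine (ae_restrict_iff' measurableSet_Ioi).2 (ae_of_all _ fun t ht z hz => ?_)
    have hsub : Metric.closedBall z ε ⊆ Metric.closedBall z₀ (2 * ε) :=
      Metric.closedBall_subset_closedBall' (by linarith [Metric.mem_ball.1 hz])
    have hd := hFd t (le_of_lt ht)
    rw [← (hd z (hKS (hsub (Metric.mem_closedBall_self hε0.le)))).deriv]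
    refine (Complex.norm_deriv_le_of_forall_mem_sphere_norm_le (C := M * t ^ (-(1 + β))) hε0 ?_
      fun w hw => ?_).trans_eq (by ring)
    · refine DifferentiableOn.diffContOnCl fun w hw => ?_
      rw [closure_ball _ hε0.ne'] at hw
      exact (hd w (hKS (hsub hw))).differentiableAt.differentiableWithinAt
    · exact hM w (hsub (Metric.sphere_subset_closedBall hw)) t (le_of_lt ht)
  · refine (ae_restrict_iff' measurableSet_Ioi).2 (ae_of_all _ fun t ht z hz => ?_)
    exact hFd t (le_of_lt ht) z (hKS (Metric.ball_subset_closedBall.trans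
      (Metric.closedBall_subset_closedBall (by linarith)) hz))

/-- Cauchy's theorem for a contour in an open cone. -/
theorem IsContour.integral_eq_zero {S : Set ℂ} {γ : ℝ → ℂ} (hγ : IsContour S γ) (hS : IsOpen S)
    (h0 : (0 : ℂ) ∉ S)
    (hcone : ∀ z ∈ S, ∀ t : ℝ, 1 ≤ t → (t : ℂ) * z ∈ S) {G : ℂ → E} (hG : DifferentiableOn ℂ G S)
    {C R β : ℝ} (hβ : 0 < β)
    (hb : ∀ z ∈ S, R ≤ ‖z‖ → ‖G z‖ ≤ C * ‖z‖ ^ (-(1 + β)))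
    (hi : Integrable (fun x => deriv γ x • G (γ x))) :
    ∫ x, deriv γ x • G (γ x) = 0 := by
  -- The ray primitive is O(|z|^(-β)), so it vanishes at both ends of the contour.
  have hlim : ∀ l : Filter ℝ, Tendsto γ l (cocompact ℂ) →
      Tendsto (fun x => -∫ t : ℝ in Ioi 1, γ x • G (t * γ x)) l (𝓝 0) := fun l hl => by
    have hn : Tendsto (fun x => ‖γ x‖) l atTop := (tendsto_norm_cocompact_atTop (E := ℂ)).comp hl
    refine squeeze_zero_norm' (a := fun x => C / β * ‖γ x‖ ^ (-β)) ?_ ?_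
    · filter_upwards [hn.eventually_ge_atTop R] with x hx
      exact norm_ray_integral_le h0 hcone hβ hb (hγ.mem x) hx
    · simpa using ((tendsto_rpow_neg_atTop hβ).comp hn).const_mul (C / β)
  simpa using hγ.integral_eq_sub (fun x => hasDerivAt_ray_integral hS h0 hcone hG hβ hb (hγ.mem x))
    hi (hlim _ hγ.top_infinity) (hlim _ hγ.bot_infinity)

end Rays

/-! ### Sectors and the power map -/

section Sector

theorem sector_subset_slitPlane {θ : ℝ} (hθ : θ ≤ Real.pi / 2) : sector θ ⊆ Complex.slitPlane := by
  intro z hz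
  rw [Complex.mem_slitPlane_iff_arg]
  refine ⟨fun h => ?_, hz.1⟩
  have := hz.2
  rw [h, abs_of_pos Real.pi_pos] at this
  linarith

theorem isOpen_sector {θ : ℝ} (hθ : θ ≤ Real.pi / 2) : IsOpen (sector θ) := by
  have h1 : ContinuousOn (fun z : ℂ => |z.arg|) Complex.slitPlane := fun z hz =>
    (Complex.continuousAt_arg hz).abs.continuousWithinAt
  have h2 := h1.isOpen_inter_preimage Complex.isOpen_slitPlane
    (isOpen_Iio (a := Real.pi / 2 + θ))
  convert h2 using 1
  ext z
  exact ⟨fun h => ⟨sector_subset_slitPlane hθ h, h.2⟩, fun h =>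
    ⟨Complex.slitPlane_ne_zero h.1, h.2⟩⟩

theorem zero_notMem_sector {θ : ℝ} : (0 : ℂ) ∉ sector θ := fun h => h.1 rfl

theorem mul_mem_sector {θ : ℝ} {z : ℂ} (hz : z ∈ sector θ) {t : ℝ} (ht : 0 < t) :
    (t : ℂ) * z ∈ sector θ := by
  refine ⟨mul_ne_zero (by exact_mod_cast ht.ne') hz.1, ?_⟩
  rw [Complex.arg_real_mul _ ht]
  exact hz.2

theorem mem_sector_of_re_pos {θ : ℝ} (hθ : 0 ≤ θ) {z : ℂ} (hz : 0 < z.re) : z ∈ sector θ := by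
  refine ⟨fun h => by simp [h] at hz, ?_⟩
  have := Complex.abs_arg_lt_pi_div_two_iff.2 (Or.inl hz)
  linarith

theorem theta1_le {α θ₀ : ℝ} : theta1 α θ₀ ≤ Real.pi / 2 := min_le_right _ _

theorem theta1_nonneg {α θ₀ : ℝ} (h0 : 0 < α) (h1 : α < 1) (hθ : 0 < θ₀) : 0 ≤ theta1 α θ₀ := by
  have := Real.pi_pos
  refine le_min ?_ (by positivity)
  have : 0 ≤ 1 - α := by linarith
  positivity

/-- For 0 < α < 1 the argument is simply multiplied by α, without wrapping around, and the first
term of the minimum θ₁ is the one with α(π/2 + θ₁) = π/2 + θ₀. -/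
theorem cpow_mem_sector {α θ₀ : ℝ} (h0 : 0 < α) (h1 : α < 1) {z : ℂ}
    (hz : z ∈ sector (theta1 α θ₀)) : z ^ (α : ℂ) ∈ sector θ₀ := by
  have harg : (z ^ (α : ℂ)).arg = α * z.arg := by
    rw [Complex.cpow_def_of_ne_zero hz.1, Complex.arg_exp]
    have him : (Complex.log z * (α : ℂ)).im = α * z.arg := by
      simp [Complex.log_im, mul_comm]
    rw [him, toIocMod_eq_self]
    have a1 := Complex.neg_pi_lt_arg z
    have a2 := Complex.arg_le_pi z
    have := Real.pi_pos
    constructor <;> nlinarith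
  refine ⟨by simp [Complex.cpow_eq_zero_iff, hz.1], ?_⟩
  rw [harg, abs_mul, abs_of_pos h0]
  have h2 : |z.arg| < Real.pi / 2 + (Real.pi * (1 - α) + 2 * θ₀) / (2 * α) :=
    hz.2.trans_le (by gcongr; exact min_le_left _ _)
  calc α * |z.arg| < α * (Real.pi / 2 + (Real.pi * (1 - α) + 2 * θ₀) / (2 * α)) := by gcongr
    _ = Real.pi / 2 + θ₀ := by field_simp; ring

end Sector

/-! ### Division of holomorphic functions by z − m -/

section Division

variable {𝔅 : Type*} [NormedRing 𝔅] [NormedAlgebra ℂ 𝔅]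

/-- Induction through zp(z) − p(m)m = (z − m)p(z) + (p(z) − p(m))m. -/
theorem exists_polynomial_quotient (m : 𝔅) (D : Polynomial ℂ) :
    ∃ K : ℂ → 𝔅, Differentiable ℂ K ∧ ∀ z, algebraMap ℂ 𝔅 (D.eval z) - Polynomial.aeval m D =
      (algebraMap ℂ 𝔅 z - m) * K z := by
  induction D using Polynomial.induction_on with
  | C a => exact ⟨0, differentiable_const 0, fun z => by simp⟩
  | add p q hp hq =>
    obtain ⟨K, hK, h⟩ := hp
    obtain ⟨K', hK', h'⟩ := hq
    refine ⟨fun z => K z + K' z, hK.add hK', fun z => ?_⟩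
    rw [mul_add, ← h, ← h', Polynomial.eval_add, map_add, map_add]; abel
  | monomial n a hn =>
    obtain ⟨K, hK, h⟩ := hn
    refine ⟨fun z => algebraMap ℂ 𝔅 ((Polynomial.C a * Polynomial.X ^ n).eval z) + K z * m,
      ?_, fun z => ?_⟩
    · simp_rw [Algebra.algebraMap_eq_smul_one]
      exact ((Polynomial.differentiable _).smul_const _).add (hK.mul_const m)
    · rw [mul_add, ← mul_assoc, ← h, pow_succ, ← mul_assoc, Polynomial.eval_mul_X, map_mul, map_mul,
        Polynomial.aeval_X, sub_mul, sub_mul, ← Algebra.commutes z, Algebra.commutes _ m]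
      abel

theorem resolvent_mul_of_quotient {m Φ : 𝔅} {F Ψ : ℂ → 𝔅} {z : ℂ} (hz : z ∈ resolventSet ℂ m)
    (h : F z = Φ + (algebraMap ℂ 𝔅 z - m) * Ψ z) :
    resolvent m z * F z = resolvent m z * Φ + Ψ z := by
  have h1 : resolvent m z * (algebraMap ℂ 𝔅 z - m) = 1 := Ring.inverse_mul_cancel _ hz
  rw [h, mul_add, ← mul_assoc, h1, one_mul]

variable [CompleteSpace 𝔅]

/-- Division of a holomorphic algebra-valued function by `z - m`, for an algebraic element `m`. -/
theorem exists_resolvent_quotient (m : 𝔅) {U : Set ℂ} (hU : IsOpen U) (l : List ℂ) :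
    (∀ a ∈ l, a ∈ U) → ∀ (N : 𝔅) (F : ℂ → 𝔅), DifferentiableOn ℂ F U →
      l.foldl (fun N a => (m - algebraMap ℂ 𝔅 a) * N) N = 0 →
      ∃ (Φ : 𝔅) (Ψ : ℂ → 𝔅), DifferentiableOn ℂ Ψ U ∧
        ∀ z ∈ U, N * F z = Φ + (algebraMap ℂ 𝔅 z - m) * Ψ z := by
  induction l with
  | nil =>
    intro _ N F _ hN
    simp only [List.foldl_nil] at hN
    exact ⟨0, 0, differentiableOn_const 0, fun z _ => by simp [hN]⟩
  | cons a l ih =>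
    intro hl N F hF hN
    have ha : U ∈ 𝓝 a := hU.mem_nhds (hl a (by simp))
    -- The divided difference at a is again holomorphic. Writing z − a = (z − m) + (m − a) puts one
    -- part of N(z − a)·`dslope` into the quotient and moves the factor m − a onto N, where the
    -- roots accumulate until they annihilate.
    have hd : DifferentiableOn ℂ (dslope F a) U := (Complex.differentiableOn_dslope ha).2 hF
    obtain ⟨Φ, Ψ, hΨ, h⟩ := ih (fun b hb => hl b (by simp [hb])) ((m - algebraMap ℂ 𝔅 a) * N)
      (dslope F a) hd hN
    refine ⟨N * F a + Φ, fun z => N * dslope F a z + Ψ z, (hd.const_mul N).add hΨ, fun z hz => ?_⟩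
    have h1 : F z = F a + (z - a) • dslope F a z := by rw [sub_smul_dslope]; abel
    have h2 : (z - a) • (N * dslope F a z) = (algebraMap ℂ 𝔅 z - m) * (N * dslope F a z) +
        (m - algebraMap ℂ 𝔅 a) * N * dslope F a z := by
      rw [mul_assoc, ← add_mul, Algebra.smul_def, map_sub]; simp
    nth_rewrite 1 [h1]
    rw [mul_add, mul_smul_comm, h2, h z hz, mul_add]
    abel

/-- Newton interpolation with holomorphic remainder, by iterated divided differences; repeated nodes
in `l` give contact of higher order. -/
theorem exists_hermite_interpolation {U : Set ℂ} (hU : IsOpen U) (l : List ℂ) :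
    (∀ a ∈ l, a ∈ U) → ∀ g : ℂ → ℂ, DifferentiableOn ℂ g U →
      ∃ (p : Polynomial ℂ) (u : ℂ → ℂ), DifferentiableOn ℂ u U ∧
        ∀ z ∈ U, g z = p.eval z + (l.map fun a => z - a).prod * u z := by
  induction l with
  | nil => exact fun _ g hg => ⟨0, g, hg, by simp⟩
  | cons a l ih =>
    intro hl g hg
    have ha : U ∈ 𝓝 a := hU.mem_nhds (hl a (by simp))
    have hd : DifferentiableOn ℂ (dslope g a) U := (Complex.differentiableOn_dslope ha).2 hg
    obtain ⟨p, u, hu, h⟩ := ih (fun b hb => hl b (by simp [hb])) _ hd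
    refine ⟨Polynomial.C (g a) + (Polynomial.X - Polynomial.C a) * p, u, hu, fun z hz => ?_⟩
    have h1 : g z = g a + (z - a) • dslope g a z := by rw [sub_smul_dslope]; abel
    rw [h1, h z hz]
    simp
    ring

end Division

/-! ### The Cauchy integral over a circle around the spectrum -/

section Circle

variable {𝔅 : Type*} [NormedRing 𝔅] [NormedAlgebra ℂ 𝔅] [CompleteSpace 𝔅]

theorem circleIntegral_eq_integral_restrict {E : Type*} [NormedAddCommGroup E] [NormedSpace ℂ E]
    (f : ℂ → E) (c : ℂ) (R : ℝ) :
    (∮ z in C(c, R), f z) = ∫ x, deriv (circleMap c R) x • f (circleMap c R x)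
      ∂(volume.restrict (Ioc 0 (2 * Real.pi))) := by
  rw [circleIntegral, intervalIntegral.integral_of_le Real.two_pi_pos.le]

theorem decayPath_circleMap (c : ℂ) (R : ℝ) {β : ℝ} (hβ : β ≤ 1) :
    DecayPath (deriv (circleMap c R)) (circleMap c R)
      (volume.restrict (Ioc 0 (2 * Real.pi))) β where
  measurable := measurable_deriv _
  continuous := continuous_circleMap c R
  closed := by
    rw [range_circleMap]; exact Metric.isClosed_sphere
  le_one := hβ
  integrable := by
    refine (Continuous.integrableOn_Icc ?_).mono_set Ioc_subset_Icc_self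
    refine Continuous.mul ?_ ?_
    · have : deriv (circleMap c R) = fun x => circleMap 0 R x * Complex.I := by
        ext x; simp
      rw [this]; fun_prop
    · exact (continuous_const.add (continuous_circleMap c R).norm).rpow_const
        fun x => Or.inl (show (1 : ℝ) + ‖circleMap c R x‖ ≠ 0 by positivity)

/-- On the circle (z−m)⁻¹F = (z−m)⁻¹Φ + Ψ. The holomorphic Ψ contributes nothing, and the resolvent
integrates like (z−a)⁻¹ for any one root a inside, by the partial fraction lemmas. -/
theorem circleIntegral_resolvent_mul (m : 𝔅) {c : ℂ} {R : ℝ} (hR : 0 < R)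
    (hm : Metric.sphere c R ⊆ resolventSet ℂ m) (a : ℂ) (l : List ℂ) (ha : a ∈ Metric.ball c R)
    (hl : ∀ b ∈ l, b ∈ Metric.ball c R)
    (hml : (a :: l).foldl (fun N b => (m - algebraMap ℂ 𝔅 b) * N) 1 = 0)
    {U : Set ℂ} (hU : IsOpen U) (hUR : Metric.closedBall c R ⊆ U) {F Ψ : ℂ → 𝔅} {Φ : 𝔅}
    (hΨ : DifferentiableOn ℂ Ψ U) (hF : ∀ z ∈ U, F z = Φ + (algebraMap ℂ 𝔅 z - m) * Ψ z) :
    (∮ z in C(c, R), resolvent m z * F z) = (2 * Real.pi * Complex.I : ℂ) • Φ := by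
  have hp := decayPath_circleMap c R (le_refl (1 : ℝ))
  have hrange : range (circleMap c R) = Metric.sphere c R := by
    rw [range_circleMap, abs_of_pos hR]
  have hV : ∀ b ∈ Metric.ball c R, b ∉ range (circleMap c R) := fun b hb h => by
    rw [hrange] at h
    exact (Metric.mem_ball.1 hb).ne (Metric.mem_sphere.1 h)
  have hci : ∀ b ∈ Metric.ball c R, CircleIntegrable (fun z => (z - b)⁻¹) c R := fun b hb =>
    ((hasDecay_inv_sub Metric.isClosed_sphere (K := Metric.sphere c R)
      (hrange ▸ hV b hb)).1).circleIntegrable hR.le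
  have key := integral_resolvent_sub_eq_zero hp hV (fun b hb b' hb' => by
      have h := circleIntegral_eq_integral_restrict (fun z => (z - b)⁻¹ - (z - b')⁻¹) c R
      rw [← h, circleIntegral.integral_sub (hci b hb) (hci b' hb'),
        circleIntegral.integral_sub_inv_of_mem_ball hb,
        circleIntegral.integral_sub_inv_of_mem_ball hb', sub_self]) (fun b hb n => by
      have h := circleIntegral_eq_integral_restrict (fun z => ((z - b)⁻¹) ^ (n + 2)) c R
      rw [← h]
      have h2 := circleIntegral.integral_sub_zpow_of_ne (n := -((n : ℤ) + 2)) (by omega) c b R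
      rw [← h2]
      congr 1
      ext z
      rw [zpow_neg, inv_pow]
      norm_cast) m (hrange ▸ hm) a l ha hl hml
  rw [← circleIntegral_eq_integral_restrict (fun z => resolvent m z - (z - a)⁻¹ • (1 : 𝔅))] at key
  have hrc : ContinuousOn (resolvent m) (Metric.sphere c R) :=
    (hasDecay_resolvent m Metric.isClosed_sphere hm).1
  have hac : ContinuousOn (fun z => (z - a)⁻¹ • (1 : 𝔅)) (Metric.sphere c R) :=
    ((hasDecay_inv_sub Metric.isClosed_sphere (K := Metric.sphere c R)
      (hrange ▸ hV a ha)).1).smul continuousOn_const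
  rw [circleIntegral.integral_sub (hrc.circleIntegrable hR.le) (hac.circleIntegrable hR.le),
    sub_eq_zero, circleIntegral.integral_smul_const,
    circleIntegral.integral_sub_inv_of_mem_ball ha] at key
  have hΨc : ContinuousOn Ψ (Metric.sphere c R) :=
    hΨ.continuousOn.mono (Metric.sphere_subset_closedBall.trans hUR)
  have hΨ0 : (∮ z in C(c, R), Ψ z) = 0 :=
    Complex.circleIntegral_eq_zero_of_differentiable_on_off_countable hR.le countable_empty
      (hΨ.continuousOn.mono hUR) fun z hz => hΨ.differentiableAt
        (hU.mem_nhds (hUR (Metric.ball_subset_closedBall hz.1)))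
  have hcongr : (∮ z in C(c, R), resolvent m z * F z) =
      ∮ z in C(c, R), (resolvent m z * Φ + Ψ z) :=
    circleIntegral.integral_congr hR.le fun z hz =>
      resolvent_mul_of_quotient (hm hz) (hF z (hUR (Metric.sphere_subset_closedBall hz)))
  have hmul : (∮ z in C(c, R), resolvent m z * Φ) = (∮ z in C(c, R), resolvent m z) * Φ := by
    rw [circleIntegral_eq_integral_restrict, circleIntegral_eq_integral_restrict]
    have hi : Integrable (fun x => deriv (circleMap c R) x • resolvent m (circleMap c R x))
        (volume.restrict (Ioc 0 (2 * Real.pi))) :=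
      (hrc.circleIntegrable hR.le).out.1
    simp_rw [← smul_mul_assoc]
    exact integral_mul_const_of_integrable hi
  have hrΦ : ContinuousOn (fun z => resolvent m z * Φ) (Metric.sphere c R) :=
    hrc.mul continuousOn_const
  rw [hcongr, circleIntegral.integral_add (hrΦ.circleIntegrable hR.le) (hΨc.circleIntegrable hR.le), hΨ0,
    add_zero, hmul, key, smul_mul_assoc, one_mul]

end Circle

/-! ### The Cauchy integral over the unbounded contour -/

section ContourResolvent

variable {𝔅 : Type*} [NormedRing 𝔅] [NormedAlgebra ℂ 𝔅]

theorem hasDecay_of_rpow_bound {E : Type*} [NormedAddCommGroup E] {K : Set ℂ} {F : ℂ → E}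
    (hF : ContinuousOn F K) {C α δ : ℝ} (hα : 0 ≤ α) (hC : 0 ≤ C) (hδ : 0 < δ)
    (hK : ∀ z ∈ K, δ ≤ ‖z‖)
    (hb : ∀ z ∈ K, ‖F z‖ ≤ C * ‖z‖ ^ (-α)) : HasDecay K α F := by
  refine ⟨hF, C * (1 + δ⁻¹) ^ α, by positivity, fun z hz => (hb z hz).trans ?_⟩
  have hz0 : 0 < ‖z‖ := hδ.trans_le (hK z hz)
  rw [mul_assoc]
  gcongr
  rw [Real.rpow_neg hz0.le, Real.rpow_neg (by positivity), inv_le_comm₀ (by positivity) (by positivity),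
    mul_inv, inv_inv, ← Real.inv_rpow (by positivity), ← Real.mul_rpow (by positivity) (by positivity)]
  refine Real.rpow_le_rpow (by positivity) ?_ hα
  rw [inv_mul_le_iff₀ (by positivity), add_mul, one_mul, add_comm]
  gcongr
  rw [inv_mul_eq_div, one_le_div hδ]
  exact hK z hz

theorem resolvent_sub_inv_smul {m : 𝔅} {z : ℂ} (hz : z ∈ resolventSet ℂ m) (hz0 : z ≠ 0) :
    resolvent m z - z⁻¹ • (1 : 𝔅) = z⁻¹ • (resolvent m z * m) := by
  have := resolvent_mul_eq (m := m) (N := 1) (a := 0) hz (by simpa using hz0)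
  simp only [mul_one, sub_zero, map_zero] at this
  nth_rewrite 1 [this]
  abel

variable [CompleteSpace 𝔅]

theorem hasDecay_resolvent_sub_inv (m : 𝔅) {K : Set ℂ} (hK : IsClosed K)
    (hKm : K ⊆ resolventSet ℂ m) (h0 : (0 : ℂ) ∉ K) :
    HasDecay K 2 (fun z => resolvent m z - z⁻¹ • (1 : 𝔅)) := by
  have h1 := (hasDecay_inv_sub hK h0).smul ((hasDecay_resolvent m hK hKm).mul (hasDecay_const K m))
  norm_num at h1
  exact h1.congr fun z hz => resolvent_sub_inv_smul (hKm hz) (ne_of_mem_of_not_mem hz h0)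

/-- The integral of `(z - m)⁻¹ F(z)` along a contour with the spectrum of `m` on its right. -/
theorem IsContour.integral_resolvent_mul {S : Set ℂ} {γ : ℝ → ℂ} (hγ : IsContour S γ)
    (hS : IsOpen S) (hslit : S ⊆ Complex.slitPlane)
    (hcone : ∀ z ∈ S, ∀ t : ℝ, 1 ≤ t → (t : ℂ) * z ∈ S)
    (m : 𝔅) (hm : range γ ⊆ resolventSet ℂ m) (a : ℂ) (l : List ℂ) (ha : RightOf γ a)
    (hl : ∀ b ∈ l, RightOf γ b)
    (hml : (a :: l).foldl (fun N b => (m - algebraMap ℂ 𝔅 b) * N) 1 = 0)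
    {F Ψ : ℂ → 𝔅} {Φ : 𝔅} (hFd : DifferentiableOn ℂ F S)
    {α C : ℝ} (hα : 0 < α) (hα1 : α ≤ 1) (hC : 0 ≤ C) (hFb : ∀ z ∈ S, ‖F z‖ ≤ C * ‖z‖ ^ (-α))
    (hΨ : DifferentiableOn ℂ Ψ S) (hF : ∀ z ∈ S, F z = Φ + (algebraMap ℂ 𝔅 z - m) * Ψ z) :
    ∫ x, deriv γ x • (resolvent m (γ x) * F (γ x)) = -((2 * Real.pi * Complex.I : ℂ) • Φ) := by
  have h0S : (0 : ℂ) ∉ S := fun h => Complex.slitPlane_ne_zero (hslit h) rfl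
  have hγS : range γ ⊆ S := range_subset_iff.2 hγ.mem
  have h0 : (0 : ℂ) ∉ range γ := fun h => h0S (hγS h)
  have hp := hγ.decayPath hα hα1
  -- Neither (z−m)⁻¹Φ nor Ψ need decay faster than 1/|z|. Moving z⁻¹Φ from one to the other makes
  -- both integrable and keeps G holomorphic, since 0 is not in S.
  set G : ℂ → 𝔅 := fun z => Ψ z + z⁻¹ • Φ with hG
  have hsplit : ∀ z ∈ S, z ∈ resolventSet ℂ m →
      resolvent m z * F z = (resolvent m z - z⁻¹ • (1 : 𝔅)) * Φ + G z := fun z hz hzm => by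
    rw [resolvent_mul_of_quotient hzm (hF z hz), sub_mul, smul_mul_assoc, one_mul]
    simp only [hG]
    abel
  have hdecG : ∀ K : Set ℂ, IsClosed K → K ⊆ resolventSet ℂ m → (0 : ℂ) ∉ K →
      HasDecay (K ∩ S) (1 + α) (fun z => resolvent m z * F z) ∧
      HasDecay K 2 (fun z => (resolvent m z - z⁻¹ • (1 : 𝔅)) * Φ) ∧
      HasDecay (K ∩ S) (1 + α) G := fun K hK hKm h0K => by
    obtain ⟨δ, hδ, hδK⟩ := Metric.isOpen_iff.1 hK.isOpen_compl 0 h0K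
    have e1 : HasDecay (K ∩ S) α F := hasDecay_of_rpow_bound (hFd.continuousOn.mono inter_subset_right)
      hα.le hC hδ (fun z hz => not_lt.1 fun hlt => hδK (by simpa using hlt) hz.1)
      fun z hz => hFb z hz.2
    have e2 := ((hasDecay_resolvent m hK hKm).mono_set inter_subset_left).mul e1
    have e3 := (hasDecay_resolvent_sub_inv m hK hKm h0K).mul (hasDecay_const K Φ)
    rw [add_zero] at e3
    refine ⟨e2, e3, ?_⟩
    refine (e2.sub ((e3.mono_set inter_subset_left).mono (show 1 + α ≤ 2 by linarith))).congr
      fun z hz => ?_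
    rw [hsplit z hz.2 (hKm hz.1)]
    abel
  obtain ⟨d1, d2, d3⟩ := hdecG _ hγ.isClosed_range hm h0
  rw [inter_eq_self_of_subset_left hγS] at d1 d3
  have i2 := hp.integrable_smul d2 (by linarith)
  have i3 := hp.integrable_smul d3 le_rfl
  have hI : ∫ x, deriv γ x • (resolvent m (γ x) * F (γ x)) =
      (∫ x, deriv γ x • ((resolvent m (γ x) - (γ x)⁻¹ • (1 : 𝔅)) * Φ)) +
        ∫ x, deriv γ x • G (γ x) := by
    rw [← integral_add i2 i3]
    congr 1
    ext1 x
    rw [hsplit _ (hγ.mem x) (hm (mem_range_self x)), smul_add]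
  have hG0 : ∫ x, deriv γ x • G (γ x) = 0 := by
    -- The spectrum of m may meet S, so the decay of G on S is read off from (z−m)⁻¹F only outside a
    -- disc containing the spectrum; the ray argument needs it only for large |z|.
    set K : Set ℂ := {z | ‖m‖ * ‖(1 : 𝔅)‖ + 1 ≤ ‖z‖} with hKdef
    have hK : IsClosed K := isClosed_le continuous_const continuous_norm
    obtain ⟨-, -, -, B, hB, hb⟩ := hdecG K hK
      (fun z hz => spectrum.mem_resolventSet_of_norm_lt_mul (by
        have : ‖m‖ * ‖(1 : 𝔅)‖ + 1 ≤ ‖z‖ := hz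
        linarith))
      (fun h => by
        have : ‖m‖ * ‖(1 : 𝔅)‖ + 1 ≤ ‖(0 : ℂ)‖ := h
        rw [norm_zero] at this
        have : 0 ≤ ‖m‖ * ‖(1 : 𝔅)‖ := by positivity
        linarith)
    refine hγ.integral_eq_zero hS h0S hcone (hΨ.add ?_) hα (C := B)
      (R := ‖m‖ * ‖(1 : 𝔅)‖ + 1) (fun z hz hR => (hb z ⟨hR, hz⟩).trans ?_) i3
    · exact (differentiableOn_inv.mono fun z hz => ne_of_mem_of_not_mem hz h0S).smul_const Φ
    · have hz0 : 0 < ‖z‖ := norm_pos_iff.2 (ne_of_mem_of_not_mem hz h0S)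
      gcongr B * ?_
      exact Real.rpow_le_rpow_of_nonpos hz0 (by linarith) (by linarith)
  have hVr : ∀ b ∈ {p | RightOf γ p}, b ∉ range γ := fun b hb => RightOf.notMem_range hb
  have j1 := integral_resolvent_sub_eq_zero hp hVr
    (fun b hb b' hb' => hγ.integral_inv_sub_inv_of_rightOf hb hb')
    (fun b hb n => hγ.integral_inv_pow (hVr b hb) n) m hm a l ha hl hml
  have j2 := hγ.integral_inv_sub_inv_zero hslit ha
  have d4 : HasDecay (range γ) 2 (fun z => (z - a)⁻¹ - (z - 0)⁻¹) :=
    hasDecay_inv_sub_inv hγ.isClosed_range (hVr a ha) h0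
  have d5 := hasDecay_resolvent_sub_inv m hγ.isClosed_range hm h0
  have d6 := d4.smul (hasDecay_const (range γ) (1 : 𝔅))
  rw [add_zero] at d6
  have i6 := hp.integrable_smul d6 (by linarith)
  have i7 := hp.integrable_smul (d5.sub d6) (by linarith)
  have i5 := hp.integrable_smul d5 (by linarith)
  have j3 : ∫ x, deriv γ x • (resolvent m (γ x) - (γ x)⁻¹ • (1 : 𝔅)) =
      -((2 * Real.pi * Complex.I : ℂ) • (1 : 𝔅)) := by
    -- The root a is an intermediary: (z−m)⁻¹ − (z−a)⁻¹ integrates to 0, and (z−a)⁻¹ − z⁻¹ to −2πi.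
    have : ∀ x, deriv γ x • (resolvent m (γ x) - (γ x)⁻¹ • (1 : 𝔅)) =
        deriv γ x • (resolvent m (γ x) - (γ x)⁻¹ • (1 : 𝔅) -
          ((γ x - a)⁻¹ - (γ x - 0)⁻¹) • (1 : 𝔅)) +
        deriv γ x • (((γ x - a)⁻¹ - (γ x - 0)⁻¹) • (1 : 𝔅)) := fun x => by
      rw [← smul_add]; congr 1; abel
    simp_rw [this]
    rw [integral_add i7 i6]
    have k1 : ∀ x, deriv γ x • (resolvent m (γ x) - (γ x)⁻¹ • (1 : 𝔅) -
          ((γ x - a)⁻¹ - (γ x - 0)⁻¹) • (1 : 𝔅)) =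
        deriv γ x • (resolvent m (γ x) - (γ x - a)⁻¹ • (1 : 𝔅)) := fun x => by
      rw [sub_smul, sub_zero]; congr 1; abel
    have k2 : ∀ x, deriv γ x • (((γ x - a)⁻¹ - (γ x - 0)⁻¹) • (1 : 𝔅)) =
        (deriv γ x • ((γ x - a)⁻¹ - (γ x)⁻¹)) • (1 : 𝔅) := fun x => by
      rw [sub_zero, smul_assoc]
    simp_rw [k1, k2]
    rw [j1, zero_add, integral_smul_const, j2, neg_smul]
  rw [hI, hG0, add_zero]
  simp_rw [← smul_mul_assoc]
  rw [integral_mul_const_of_integrable i5, j3, neg_mul, smul_mul_assoc, one_mul]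

end ContourResolvent

/-! ### Neumann series of the perturbed resolvent -/

section Neumann

/-- Multiplying by c before estimating avoids ‖b⁰‖ = ‖1‖, which is not assumed to be at most 1. -/
theorem norm_mul_pow_mul_le {𝔅 : Type*} [NormedRing 𝔅] (a b c : 𝔅) (n : ℕ) : ‖a * b ^ n * c‖ ≤ ‖a‖ * ‖b‖ ^ n * ‖c‖ := by
  have h : ‖b ^ n * c‖ ≤ ‖b‖ ^ n * ‖c‖ := by
    induction n with
    | zero => simp
    | succ n ih =>
      rw [pow_succ', pow_succ', mul_assoc, mul_assoc]
      exact (norm_mul_le _ _).trans (by gcongr)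
  rw [mul_assoc, mul_assoc]
  exact (norm_mul_le _ _).trans (by gcongr)

variable {𝔅 : Type*} [NormedRing 𝔅] [NormedAlgebra ℂ 𝔅] [CompleteSpace 𝔅]

/-- The coefficient of `ζⁿ` in `(z - (m - ζ e))⁻¹`. -/
noncomputable def neumannTerm (m e : 𝔅) (n : ℕ) (z : ℂ) : 𝔅 := resolvent m z * (-(e * resolvent m z)) ^ n

/-- With x = −ζe(z−m)⁻¹ one has z − (m − ζe) = (1 − x)(z − m), and 1 − x is inverted by the
geometric series. -/
theorem isUnit_and_hasSum_neumannTerm {m e : 𝔅} {z ζ : ℂ} (hz : z ∈ resolventSet ℂ m)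
    (hζ : ‖ζ‖ * (‖e‖ * ‖resolvent m z‖) < 1) :
    z ∈ resolventSet ℂ (m - ζ • e) ∧
      HasSum (fun n => ζ ^ n • neumannTerm m e n z) (resolvent (m - ζ • e) z) := by
  set x : 𝔅 := ζ • -(e * resolvent m z) with hx
  have hx1 : ‖x‖ < 1 := by
    rw [hx, norm_smul, norm_neg]
    refine lt_of_le_of_lt ?_ hζ
    gcongr
    exact norm_mul_le _ _
  have h1 : resolvent m z * (algebraMap ℂ 𝔅 z - m) = 1 := Ring.inverse_mul_cancel _ hz
  have hfac : algebraMap ℂ 𝔅 z - (m - ζ • e) = (1 - x) * (algebraMap ℂ 𝔅 z - m) := by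
    rw [sub_mul, one_mul, hx, smul_mul_assoc, neg_mul, mul_assoc, h1, mul_one, smul_neg]
    abel
  have hu := isUnit_one_sub_of_norm_lt_one hx1
  refine ⟨?_, ?_⟩
  · show IsUnit _
    rw [hfac]
    exact hu.mul hz
  · have hm' : z ∈ resolventSet ℂ (m - ζ • e) := by
      show IsUnit _
      rw [hfac]
      exact hu.mul hz
    have h1' : (algebraMap ℂ 𝔅 z - m) * resolvent m z = 1 := Ring.mul_inverse_cancel _ hz
    have h3 : resolvent (m - ζ • e) z * (algebraMap ℂ 𝔅 z - (m - ζ • e)) = 1 :=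
      Ring.inverse_mul_cancel _ hm'
    have h2 : resolvent (m - ζ • e) z = resolvent m z * ∑' n : ℕ, x ^ n := by
      calc resolvent (m - ζ • e) z = resolvent (m - ζ • e) z *
            ((1 - x) * ((algebraMap ℂ 𝔅 z - m) * resolvent m z) * ∑' n : ℕ, x ^ n) := by
            rw [h1', mul_one, mul_neg_geom_series x hx1, mul_one]
        _ = resolvent (m - ζ • e) z * (algebraMap ℂ 𝔅 z - (m - ζ • e)) *
            (resolvent m z * ∑' n : ℕ, x ^ n) := by rw [hfac]; noncomm_ring
        _ = _ := by rw [h3, one_mul]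
    rw [h2]
    refine ((summable_geometric_of_norm_lt_one hx1).hasSum.mul_left _).congr_fun fun n => ?_
    rw [neumannTerm, hx, smul_pow, mul_smul_comm]

theorem hasDecay_neumannTerm (m e : 𝔅) {K : Set ℂ} (hK : IsClosed K)
    (hm : K ⊆ resolventSet ℂ m) (n : ℕ) : HasDecay K 1 (neumannTerm m e n) := by
  have h1 := hasDecay_resolvent m hK hm
  induction n with
  | zero => exact h1.congr fun z _ => by simp [neumannTerm]
  | succ n ih =>
    have h2 := ih.mul (((hasDecay_const K e).mul h1).neg)
    refine (h2.mono (show (1 : ℝ) ≤ 1 + (0 + 1) by norm_num)).congr fun z _ => ?_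
    rw [neumannTerm, neumannTerm, pow_succ, mul_assoc]

theorem DecayPath.hasSum_integral_neumannTerm {d γ : ℝ → ℂ} {μ : Measure ℝ} {β : ℝ}
    (hp : DecayPath d γ μ β) (m e : 𝔅) (hm : range γ ⊆ resolventSet ℂ m) {F : ℂ → 𝔅}
    (hF : HasDecay (range γ) β F) : ∃ ρ : ℝ, 0 < ρ ∧ ∀ ζ : ℂ, ‖ζ‖ < ρ →
      range γ ⊆ resolventSet ℂ (m - ζ • e) ∧
      HasSum (fun n : ℕ => ζ ^ n • ∫ x, d x • (neumannTerm m e n (γ x) * F (γ x)) ∂μ)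
        (∫ x, d x • (resolvent (m - ζ • e) (γ x) * F (γ x)) ∂μ) := by
  obtain ⟨hc, B, hB, hb⟩ := hasDecay_resolvent m hp.closed hm
  obtain ⟨hcF, B', hB', hb'⟩ := hF
  have hbB : ∀ z ∈ range γ, ‖resolvent m z‖ ≤ B := fun z hz =>
    (hb z hz).trans (mul_le_of_le_one_right hB
      (Real.rpow_le_one_of_one_le_of_nonpos (by linarith [norm_nonneg z]) (by norm_num)))
  -- This radius makes the ratio of the series at most 1/2 uniformly along the path, so sum and
  -- integral can be exchanged; the summand 1 guards against ‖e‖B = 0.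
  refine ⟨(2 * (‖e‖ * B + 1))⁻¹, by positivity, fun ζ hζ => ?_⟩
  have hq : ‖ζ‖ * (‖e‖ * B) ≤ 1 / 2 := by
    calc ‖ζ‖ * (‖e‖ * B) ≤ (2 * (‖e‖ * B + 1))⁻¹ * (‖e‖ * B + 1) := by
          gcongr; linarith
      _ = 1 / 2 := by field_simp
  have hlt : ∀ z ∈ range γ, ‖ζ‖ * (‖e‖ * ‖resolvent m z‖) ≤ 1 / 2 := fun z hz =>
    le_trans (by gcongr; exact hbB z hz) hq
  have hpt := fun z (hz : z ∈ range γ) =>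
    isUnit_and_hasSum_neumannTerm (e := e) (hm hz) ((hlt z hz).trans_lt (by norm_num))
  refine ⟨fun z hz => (hpt z hz).1, ?_⟩
  have hi : ∀ n, Integrable (fun x => d x • (neumannTerm m e n (γ x) * F (γ x))) μ := fun n =>
    hp.integrable_smul ((hasDecay_neumannTerm m e hp.closed hm n).mul ⟨hcF, B', hB', hb'⟩) le_rfl
  have hnb : ∀ n x, ‖ζ ^ n • (d x • (neumannTerm m e n (γ x) * F (γ x)))‖ ≤
      (1 / 2) ^ n * (B * B' * (‖d x‖ * (1 + ‖γ x‖) ^ (-(1 + β)))) := fun n x => by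
    have hx := mem_range_self (f := γ) x
    rw [norm_smul, norm_smul, norm_pow, neumannTerm]
    calc ‖ζ‖ ^ n * (‖d x‖ * ‖resolvent m (γ x) * (-(e * resolvent m (γ x))) ^ n * F (γ x)‖)
        ≤ ‖ζ‖ ^ n * (‖d x‖ * (‖resolvent m (γ x)‖ * (‖e‖ * ‖resolvent m (γ x)‖) ^ n *
          ‖F (γ x)‖)) := by
          gcongr
          refine (norm_mul_pow_mul_le _ _ _ n).trans ?_
          rw [norm_neg]
          gcongr
          exact norm_mul_le _ _
      _ = (‖ζ‖ * (‖e‖ * ‖resolvent m (γ x)‖)) ^ n * (‖d x‖ * (‖resolvent m (γ x)‖ * ‖F (γ x)‖)) := by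
          rw [mul_pow ‖ζ‖]; ring
      _ ≤ (1 / 2) ^ n * (‖d x‖ * (B * B' * (1 + ‖γ x‖) ^ (-(1 + β)))) := by
          gcongr ?_ ^ n * (‖d x‖ * ?_)
          · exact hlt _ hx
          · exact decay_mul_bound hB (hb _ hx) (hb' _ hx) (norm_nonneg _)
      _ = _ := by ring
  have hsum := hasSum_integral_of_summable_integral_norm (μ := μ)
    (F := fun n x => ζ ^ n • (d x • (neumannTerm m e n (γ x) * F (γ x))))
    (fun n => (hi n).smul (ζ ^ n)) (by
      refine Summable.of_nonneg_of_le (fun n => integral_nonneg fun x => norm_nonneg _)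
        (fun n => integral_mono ((hi n).smul (ζ ^ n)).norm
          ((hp.integrable.const_mul (B * B')).const_mul ((1 / 2 : ℝ) ^ n)) (hnb n)) ?_
      simp_rw [integral_const_mul]
      exact (summable_geometric_of_lt_one (by norm_num) (by norm_num)).mul_right _)
  have heq : ∀ x, ∑' n, ζ ^ n • (d x • (neumannTerm m e n (γ x) * F (γ x))) =
      d x • (resolvent (m - ζ • e) (γ x) * F (γ x)) := fun x => by
    have h1 := (((hpt _ (mem_range_self x)).2.mul_right (F (γ x))).const_smul (d x)).tsum_eq
    rw [← h1]
    refine tsum_congr fun n => ?_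
    rw [smul_mul_assoc, smul_comm]
  simp_rw [heq, integral_smul] at hsum
  exact hsum

end Neumann

/-! ### Resolvents of the sectorial operator -/

section Resolvents

variable {X : Type*} [NormedAddCommGroup X] [NormedSpace ℂ X]

theorem IsBoundedInverse.unique {E : Type*} [NormedAddCommGroup E] [NormedSpace ℂ E]
    {T : E →ₗ.[ℂ] E} {R R' : E →L[ℂ] E} (h : IsBoundedInverse T R) (h' : IsBoundedInverse T R') :
    R = R' := by
  ext y
  obtain ⟨x, hx, hxy⟩ := h.1 y
  rw [← hx, ← h'.2 x, hxy]

theorem IsBoundedInverse.resolvent_identity {A : X →ₗ.[ℂ] X} {z w : ℂ} {R R' : X →L[ℂ] X}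
    (h : IsBoundedInverse (shiftOp z A) R) (h' : IsBoundedInverse (shiftOp w A) R') :
    R - R' = (w - z) • (R * R') := by
  ext y
  obtain ⟨x, hx, hxy⟩ := h'.1 y
  have h1 : shiftOp z A x = (z - w) • (x : X) + y := by
    rw [← hxy]
    change z • (x : X) - A.toFun x = (z - w) • (x : X) + (w • (x : X) - A.toFun x)
    rw [sub_smul]; abel
  have h2 := h.2 x
  rw [h1, map_add, map_smul, hx] at h2
  simp only [sub_apply, smul_apply,
    mul_apply_eq_comp]
  rw [← neg_sub z w, neg_smul, eq_neg_iff_add_eq_zero, add_comm, ← add_sub_assoc, h2, sub_self]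

theorem isBoundedInverse_resolventOp {A : X →ₗ.[ℂ] X} {z : ℂ}
    (h : ∃ R, IsBoundedInverse (shiftOp z A) R) :
    IsBoundedInverse (shiftOp z A) (resolventOp A z) := by
  rw [resolventOp, dif_pos h]
  exact h.choose_spec

variable {A : X →ₗ.[ℂ] X} {θ₀ α : ℝ}

theorem IsSectorialOp.isBoundedInverse (hA : IsSectorialOp A θ₀) {z : ℂ} (hz : z ∈ sector θ₀) :
    IsBoundedInverse (shiftOp z A) (resolventOp A z) :=
  isBoundedInverse_resolventOp (hA.resolvent_exists z hz)

theorem IsSectorialOp.resolventOp_sub (hA : IsSectorialOp A θ₀) {z w : ℂ} (hz : z ∈ sector θ₀)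
    (hw : w ∈ sector θ₀) :
    resolventOp A z - resolventOp A w = (w - z) • (resolventOp A z * resolventOp A w) :=
  (hA.isBoundedInverse hz).resolvent_identity (hA.isBoundedInverse hw)

/-- The resolvent identity with the sectorial bound gives continuity; the same identity then shows
that the difference quotient at w is −(z−A)⁻¹(w−A)⁻¹, which converges. -/
theorem IsSectorialOp.differentiableOn_resolventOp (hA : IsSectorialOp A θ₀) :
    DifferentiableOn ℂ (resolventOp A) (sector θ₀) := by
  obtain ⟨C, hC, hb⟩ := hA.resolvent_bound
  have hopen := isOpen_sector hA.angle_le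
  intro w hw
  have hw0 : ‖w‖ ≠ 0 := norm_ne_zero_iff.2 hw.1
  have hnear : ∀ᶠ z in 𝓝 w, z ∈ sector θ₀ := hopen.mem_nhds hw
  have hcont : ContinuousAt (resolventOp A) w := by
    have h1 : Tendsto (fun z : ℂ => ‖w - z‖ * (C / ‖z‖ * ‖resolventOp A w‖)) (𝓝 w) (𝓝 0) := by
      have h2 : ContinuousAt (fun z : ℂ => ‖w - z‖ * (C / ‖z‖ * ‖resolventOp A w‖)) w := by
        refine ContinuousAt.mul (by fun_prop) (ContinuousAt.mul ?_ continuousAt_const)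
        exact continuousAt_const.div (by fun_prop) hw0
      have h3 := h2.tendsto
      simpa using h3
    rw [ContinuousAt, tendsto_iff_norm_sub_tendsto_zero]
    refine squeeze_zero' (Eventually.of_forall fun _ => norm_nonneg _) ?_ h1
    filter_upwards [hnear] with z hz
    rw [hA.resolventOp_sub hz hw, norm_smul]
    gcongr
    exact (norm_mul_le _ _).trans (by gcongr; exact hb z hz)
  refine DifferentiableAt.differentiableWithinAt
    (HasDerivAt.differentiableAt (f' := -(resolventOp A w * resolventOp A w)) ?_)
  rw [hasDerivAt_iff_tendsto_slope]
  have h4 : Tendsto (fun z => -(resolventOp A z * resolventOp A w)) (𝓝[≠] w)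
      (𝓝 (-(resolventOp A w * resolventOp A w))) :=
    ((hcont.mul continuousAt_const).neg.tendsto).mono_left nhdsWithin_le_nhds
  refine h4.congr' ?_
  filter_upwards [self_mem_nhdsWithin, hnear.filter_mono nhdsWithin_le_nhds] with z hz hzS
  have hz' : z - w ≠ 0 := sub_ne_zero.2 hz
  rw [slope_def_module, hA.resolventOp_sub hzS hw, smul_smul, ← neg_sub z w, mul_neg,
    inv_mul_cancel₀ hz', neg_smul, one_smul]

theorem differentiableOn_cpow_const (α : ℂ) :
    DifferentiableOn ℂ (fun z : ℂ => z ^ α) Complex.slitPlane := fun _ hz =>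
  (differentiableAt_id.cpow (differentiableAt_const α) hz).differentiableWithinAt

theorem IsSectorialOp.differentiableOn_resolventOp_cpow (hA : IsSectorialOp A θ₀) (hα₀ : 0 < α)
    (hα₁ : α < 1) :
    DifferentiableOn ℂ (fun z => resolventOp A (z ^ (α : ℂ))) (sector (theta1 α θ₀)) :=
  hA.differentiableOn_resolventOp.comp
    ((differentiableOn_cpow_const α).mono (sector_subset_slitPlane theta1_le))
    fun _ hz => cpow_mem_sector hα₀ hα₁ hz

theorem IsSectorialOp.exists_norm_resolventOp_cpow_le (hA : IsSectorialOp A θ₀) (hα₀ : 0 < α)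
    (hα₁ : α < 1) : ∃ C : ℝ, 0 ≤ C ∧
      ∀ z ∈ sector (theta1 α θ₀), ‖resolventOp A (z ^ (α : ℂ))‖ ≤ C * ‖z‖ ^ (-α) := by
  obtain ⟨C, hC, hb⟩ := hA.resolvent_bound
  refine ⟨C, hC.le, fun z hz => (hb _ (cpow_mem_sector hα₀ hα₁ hz)).trans_eq ?_⟩
  rw [Complex.norm_cpow_of_ne_zero hz.1, Real.rpow_neg (norm_nonneg _)]
  simp [div_eq_mul_inv]

end Resolvents

/-! ### Operators M ⊗ Id and Id ⊗ T on X^s -/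

section BlockOperators

variable {X : Type*} [NormedAddCommGroup X] [NormedSpace ℂ X] {s : ℕ}

/-- The operator `M ⊗ Id` on `X^s`. -/
noncomputable def matOp (X : Type*) [NormedAddCommGroup X] [NormedSpace ℂ X] {s : ℕ} :
    Matrix (Fin s) (Fin s) ℂ →ₐ[ℂ] ((Fin s → X) →L[ℂ] (Fin s → X)) :=
  AlgHom.ofLinearMap
    { toFun := fun M => ContinuousLinearMap.pi fun i =>
        ∑ j, M i j • (ContinuousLinearMap.proj j : (Fin s → X) →L[ℂ] X)
      map_add' := fun M N => by
        ext x i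
        simp [add_smul, Finset.sum_add_distrib]
      map_smul' := fun c M => by
        ext x i
        simp [Finset.smul_sum, mul_smul] }
    (by
      ext x i
      simp [Matrix.one_apply])
    (fun M N => by
      ext x i
      simp only [LinearMap.coe_mk, AddHom.coe_mk, Matrix.mul_apply, ContinuousLinearMap.coe_pi',
        mul_apply_eq_comp, sum_apply,
        smul_apply, ContinuousLinearMap.proj_apply, Finset.sum_smul,
        Finset.smul_sum, smul_smul]
      exact Finset.sum_comm)

theorem matOp_apply (M : Matrix (Fin s) (Fin s) ℂ) (x : Fin s → X) (i : Fin s) :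
    matOp X M x i = ∑ j, M i j • x j := by
  simp [matOp]

/-- The operator `Id_s ⊗ T` on `X^s`. -/
noncomputable def diagOp (X : Type*) [NormedAddCommGroup X] [NormedSpace ℂ X] (s : ℕ) :
    (X →L[ℂ] X) →L[ℂ] ((Fin s → X) →L[ℂ] (Fin s → X)) :=
  LinearMap.mkContinuous
    { toFun := fun T => ContinuousLinearMap.pi fun i => T.comp (ContinuousLinearMap.proj i)
      map_add' := fun _ _ => rfl
      map_smul' := fun _ _ => rfl } 1 fun T => by
    rw [one_mul]
    refine ContinuousLinearMap.opNorm_le_bound _ (norm_nonneg _) fun x => ?_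
    refine (pi_norm_le_iff_of_nonneg (by positivity)).2 fun i => ?_
    exact (T.le_opNorm _).trans (by gcongr; exact norm_le_pi_norm x i)

theorem diagOp_apply (T : X →L[ℂ] X) (x : Fin s → X) (i : Fin s) : diagOp X s T x i = T (x i) := rfl

theorem norm_diagOp_le (T : X →L[ℂ] X) : ‖diagOp X s T‖ ≤ ‖T‖ :=
  ((diagOp X s).le_opNorm T).trans
    (mul_le_of_le_one_left (norm_nonneg _) (LinearMap.mkContinuous_norm_le _ zero_le_one _))

theorem diagOp_mul (T T' : X →L[ℂ] X) : diagOp X s (T * T') = diagOp X s T * diagOp X s T' := rfl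

theorem commute_matOp_diagOp (M : Matrix (Fin s) (Fin s) ℂ) (T : X →L[ℂ] X) :
    Commute (matOp X M) (diagOp X s T) := by
  ext x i
  simp [mul_apply_eq_comp, matOp_apply, diagOp_apply]

theorem blockShift_apply (P : Matrix (Fin s) (Fin s) ℂ) (A : X →ₗ.[ℂ] X)
    (x : (blockShift P A).domain) (i : Fin s) :
    blockShift P A x i = matOp X P (x : Fin s → X) i -
      A ⟨(x : Fin s → X) i, x.2 i (mem_univ i)⟩ := by
  rw [matOp_apply]
  change (∑ j, P i j • LinearMap.proj j : (Fin s → X) →ₗ[ℂ] X) (x : Fin s → X) - _ = _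
  rw [LinearMap.sum_apply]
  rfl

/-- A criterion for `Φ` to invert `P ⊗ Id - Id ⊗ A`, in terms of bounded operators only. -/
theorem isBoundedInverse_blockShift {A : X →ₗ.[ℂ] X} {R : X →L[ℂ] X}
    (hR : IsBoundedInverse (shiftOp 1 A) R) {P : Matrix (Fin s) (Fin s) ℂ}
    {Φ : (Fin s → X) →L[ℂ] (Fin s → X)}
    (h1 : (1 + (matOp X P - 1) * diagOp X s R) * Φ = diagOp X s R)
    (h2 : Φ * (1 + (matOp X P - 1) * diagOp X s R) = diagOp X s R) :
    IsBoundedInverse (blockShift P A) Φ := by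
  constructor
  · intro y
    -- With R = (1 − A)⁻¹, the hypothesis `h1` says Φy = Rv componentwise. So Φy lies in D(A)^s and
    -- (1 − A)Φy = v, which rearranges to (P − A)Φy = y.
    set v : Fin s → X := y - (matOp X P - 1) (Φ y) with hv
    have hΦ : ∀ i, Φ y i = R (v i) := fun i => by
      have hc : (matOp X P - 1) * diagOp X s R = diagOp X s R * (matOp X P - 1) := by
        rw [sub_mul, mul_sub, (commute_matOp_diagOp P R).eq]; simp
      have h3 := congrArg (fun T => T y i) h1
      simp only [hc, add_mul, one_mul, add_apply, mul_assoc,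
        mul_apply_eq_comp, Pi.add_apply, diagOp_apply] at h3
      rw [hv, Pi.sub_apply, map_sub, ← h3]
      abel
    have hdom : Φ y ∈ (blockShift P A).domain := fun i _ => by
      obtain ⟨x, hx, -⟩ := hR.1 (v i)
      change Φ y i ∈ A.domain
      rw [hΦ, ← hx]
      exact x.2
    refine ⟨⟨Φ y, hdom⟩, rfl, ?_⟩
    ext i
    rw [blockShift_apply]
    obtain ⟨x, hx, hxv⟩ := hR.1 (v i)
    have hx' : (⟨Φ y i, hdom i (mem_univ i)⟩ : A.domain) = x := by
      ext; rw [hx]; exact hΦ i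
    rw [hx']
    have h4 : (1 : ℂ) • (x : X) - A.toFun x = v i := hxv
    rw [one_smul, hx, ← hΦ] at h4
    change matOp X P (Φ y) i - A.toFun x = y i
    have h5 : v i = y i - (matOp X P (Φ y) i - Φ y i) := rfl
    rw [h5] at h4
    rw [← sub_eq_zero] at h4 ⊢
    rw [← h4]; abel
  · intro x
    -- Every x in the domain is Ry with y = (1 − A)x, and then (P − A)x = (1 + (P − 1)R)y, to which
    -- `h2` applies.
    set y : Fin s → X := fun i => shiftOp 1 A ⟨(x : Fin s → X) i, x.2 i (mem_univ i)⟩ with hy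
    have hx : diagOp X s R y = x := by
      ext i
      rw [diagOp_apply, hy]
      exact hR.2 _
    have hb : blockShift P A x = (1 + (matOp X P - 1) * diagOp X s R) y := by
      ext i
      rw [blockShift_apply, add_apply, mul_apply_eq_comp, hx]
      change _ = y i + (matOp X P (x : Fin s → X) i - (x : Fin s → X) i)
      have : y i = (1 : ℂ) • (x : Fin s → X) i - A ⟨(x : Fin s → X) i, x.2 i (mem_univ i)⟩ := rfl
      rw [this, one_smul]; abel
    rw [hb, ← mul_apply_eq_comp, h2, hx]

end BlockOperators

/-! ### Principal powers of matrices -/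

section PrincipalPower

variable {s : ℕ}

theorem iteratedDeriv_polynomial_eval (p : Polynomial ℂ) (k : ℕ) (z : ℂ) :
    iteratedDeriv k (fun z => p.eval z) z = (Polynomial.derivative^[k] p).eval z := by
  induction k generalizing p z with
  | zero => simp
  | succ k ih =>
    rw [iteratedDeriv_succ', Function.iterate_succ_apply, ← ih]
    congr 1
    ext w
    exact p.deriv

theorem iteratedDeriv_eq_zero_of_eventually_eq {f v : ℂ → ℂ} {μ : ℂ} (hv : AnalyticAt ℂ v μ)
    (hf : ∀ᶠ z in 𝓝 μ, f z = (z - μ) ^ s * v z) {k : ℕ} (hk : k < s) : iteratedDeriv k f μ = 0 := by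
  have hfa : AnalyticAt ℂ f μ :=
    AnalyticAt.congr (by fun_prop : AnalyticAt ℂ (fun z => (z - μ) ^ s * v z) μ)
      (hf.mono fun z hz => hz.symm)
  have h1 : (s : ℕ∞) ≤ analyticOrderAt f μ := by
    rw [natCast_le_analyticOrderAt hfa]
    exact ⟨v, hv, by simpa using hf⟩
  exact (natCast_le_analyticOrderAt_iff_iteratedDeriv_eq_zero hfa).1 h1 k hk

/-- Two interpolating polynomials agree to order s, hence to at least the multiplicity of each
eigenvalue, so the characteristic polynomial divides their difference and Cayley–Hamilton applies.
-/
theorem IsPrincipalPower.unique {M P P' : Matrix (Fin s) (Fin s) ℂ} {α : ℝ}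
    (h : IsPrincipalPower M α P) (h' : IsPrincipalPower M α P') : P = P' := by
  obtain ⟨-, p, rfl, hp⟩ := h
  obtain ⟨-, p', rfl, hp'⟩ := h'
  rw [← sub_eq_zero, ← map_sub]
  by_cases h0 : p - p' = 0
  · rw [h0, map_zero]
  have hdvd : M.charpoly ∣ p - p' := by
    refine (IsAlgClosed.splits M.charpoly).dvd_of_roots_le_roots M.charpoly_monic.ne_zero ?_
    rw [Multiset.le_iff_count]
    intro μ
    by_cases hμ : μ ∈ M.charpoly.roots
    · have hμs : μ ∈ spectrum ℂ M := Matrix.mem_spectrum_iff_isRoot_charpoly.2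
        (Polynomial.isRoot_of_mem_roots hμ)
      have hs : Multiset.count μ M.charpoly.roots ≤ s := by
        refine (Multiset.count_le_card _ _).trans ((Polynomial.card_roots' _).trans ?_)
        simp [Matrix.charpoly_natDegree_eq_dim]
      refine hs.trans ?_
      rw [Polynomial.count_roots]
      rcases Nat.eq_zero_or_pos s with rfl | hs0
      · exact Nat.zero_le _
      obtain ⟨t, rfl⟩ := Nat.exists_eq_succ_of_ne_zero hs0.ne'
      refine (Polynomial.lt_rootMultiplicity_iff_isRoot_iterate_derivative h0).2 fun k hk => ?_
      rw [Polynomial.iterate_derivative_sub, Polynomial.IsRoot, Polynomial.eval_sub,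
        hp μ hμs k (by omega), hp' μ hμs k (by omega), sub_self]
    · rw [Multiset.count_eq_zero_of_notMem hμ]
      exact Nat.zero_le _
  obtain ⟨w, hw⟩ := hdvd
  rw [hw, map_mul, Matrix.aeval_self_charpoly, zero_mul]

theorem prod_roots_toList (M : Matrix (Fin s) (Fin s) ℂ) :
    (M.charpoly.roots.toList.map fun a => Polynomial.X - Polynomial.C a).prod = M.charpoly := by
  have h := (IsAlgClosed.splits M.charpoly).eq_prod_roots_of_monic M.charpoly_monic
  conv_rhs => rw [h]
  conv_rhs => rw [← Multiset.coe_toList M.charpoly.roots]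
  rw [Multiset.map_coe, Multiset.prod_coe]

theorem mem_spectrum_of_mem_roots {M : Matrix (Fin s) (Fin s) ℂ} {a : ℂ}
    (ha : a ∈ M.charpoly.roots.toList) : a ∈ spectrum ℂ M :=
  Matrix.mem_spectrum_iff_isRoot_charpoly.2
    (Polynomial.isRoot_of_mem_roots (Multiset.mem_toList.1 ha))

/-- This connects the annihilation hypotheses of the division and integral lemmas with
Cayley–Hamilton. -/
theorem foldl_eq_aeval {𝔅 : Type*} [Ring 𝔅] [Algebra ℂ 𝔅] (m : 𝔅) (l : List ℂ) (N : 𝔅) :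
    l.foldl (fun N b => (m - algebraMap ℂ 𝔅 b) * N) N =
      Polynomial.aeval m (l.map fun a => Polynomial.X - Polynomial.C a).prod * N := by
  induction l generalizing N with
  | nil => simp
  | cons a l ih =>
    rw [List.foldl_cons, ih, List.map_cons, List.prod_cons, mul_comm, map_mul, ← mul_assoc]
    simp

variable (X : Type*) [NormedAddCommGroup X] [NormedSpace ℂ X]

theorem aeval_matOp (M : Matrix (Fin s) (Fin s) ℂ) (p : Polynomial ℂ) :
    Polynomial.aeval (matOp X M) p = matOp X (Polynomial.aeval M p) :=
  Polynomial.aeval_algHom_apply _ _ _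

theorem aeval_matOp_charpoly (M : Matrix (Fin s) (Fin s) ℂ) :
    Polynomial.aeval (matOp X M) M.charpoly = 0 := by
  rw [aeval_matOp, Matrix.aeval_self_charpoly, map_zero]

theorem foldl_roots_eq_zero (M : Matrix (Fin s) (Fin s) ℂ) :
    M.charpoly.roots.toList.foldl (fun N b => (matOp X M - algebraMap ℂ _ b) * N) 1 = 0 := by
  rw [foldl_eq_aeval, prod_roots_toList, aeval_matOp_charpoly, zero_mul]

theorem mem_resolventSet_matOp {M : Matrix (Fin s) (Fin s) ℂ} {z : ℂ} (hz : z ∉ spectrum ℂ M) :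
    z ∈ resolventSet ℂ (matOp X M) := by
  by_contra hcon
  exact hz (AlgHom.spectrum_apply_subset (matOp X) M hcon)

theorem exists_roots_eq_cons [NeZero s] (M : Matrix (Fin s) (Fin s) ℂ) :
    ∃ a l, M.charpoly.roots.toList = a :: l := by
  refine List.exists_cons_of_ne_nil fun h => ?_
  have h1 := congrArg List.length h
  rw [Multiset.length_toList, ← (IsAlgClosed.splits M.charpoly).natDegree_eq_card_roots,
    Matrix.charpoly_natDegree_eq_dim] at h1
  simp at h1
  exact NeZero.ne s h1

variable {X} in
/-- Existence of the principal power, together with the quotient `(z^α - M^α)/(z - M)`. -/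
theorem exists_isPrincipalPower [NeZero s] [CompleteSpace X] {M : Matrix (Fin s) (Fin s) ℂ} (α : ℝ)
    (hM : ∀ μ ∈ spectrum ℂ M, μ ∈ Complex.slitPlane) :
    ∃ P, IsPrincipalPower M α P ∧ ∃ ψ : ℂ → ((Fin s → X) →L[ℂ] (Fin s → X)),
      DifferentiableOn ℂ ψ Complex.slitPlane ∧ ∀ z ∈ Complex.slitPlane,
        (z ^ (α : ℂ)) • (1 : (Fin s → X) →L[ℂ] (Fin s → X)) =
          matOp X P + (algebraMap ℂ _ z - matOp X M) * ψ z := by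
  -- Repeating each characteristic root s times makes the remainder divisible by the s-th power of
  -- the characteristic polynomial. This ensures contact of order s at every eigenvalue, and the
  -- remainder still vanishes at M.
  obtain ⟨p, u, hu, hpu⟩ := exists_hermite_interpolation Complex.isOpen_slitPlane
    (List.replicate s M.charpoly.roots.toList).flatten (fun a ha => by
      simp only [List.mem_flatten, List.mem_replicate] at ha
      obtain ⟨l, ⟨-, rfl⟩, ha⟩ := ha
      exact hM a (mem_spectrum_of_mem_roots ha)) _ (differentiableOn_cpow_const α)
  have hprod : ∀ z : ℂ, ((List.replicate s M.charpoly.roots.toList).flatten.map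
      fun a => z - a).prod = M.charpoly.eval z ^ s := fun z => by
    have h1 := congrArg (Polynomial.eval z) (prod_roots_toList M)
    rw [Polynomial.eval_list_prod, List.map_map] at h1
    rw [List.map_flatten, List.prod_flatten, List.map_map, List.map_replicate, List.prod_replicate,
      ← h1]
    simp [Function.comp_def]
  simp_rw [hprod] at hpu
  refine ⟨Polynomial.aeval M p, ⟨hM, p, rfl, fun μ hμ k hk => ?_⟩, ?_⟩
  · obtain ⟨w, hw⟩ := Polynomial.dvd_iff_isRoot.2 (Matrix.mem_spectrum_iff_isRoot_charpoly.1 hμ)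
    have hnhds : Complex.slitPlane ∈ 𝓝 μ := Complex.isOpen_slitPlane.mem_nhds (hM μ hμ)
    have hua : AnalyticAt ℂ u μ := hu.analyticAt hnhds
    have hga : AnalyticAt ℂ (fun z : ℂ => z ^ (α : ℂ)) μ :=
      (differentiableOn_cpow_const α).analyticAt hnhds
    have hpa : AnalyticAt ℂ (fun z => p.eval z) μ := p.differentiable.analyticAt μ
    have hwa : AnalyticAt ℂ (fun z => w.eval z) μ := w.differentiable.analyticAt μ
    have h0 := iteratedDeriv_eq_zero_of_eventually_eq (s := s) (μ := μ)
      (f := fun z => z ^ (α : ℂ) - p.eval z) (v := fun z => w.eval z ^ s * u z)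
      ((hwa.pow s).mul hua) (by
        filter_upwards [hnhds] with z hz
        rw [hpu z hz, hw, Polynomial.eval_mul, mul_pow]
        simp
        ring) hk
    rw [iteratedDeriv_fun_sub hga.contDiffAt hpa.contDiffAt, sub_eq_zero,
      iteratedDeriv_polynomial_eval] at h0
    exact h0.symm
  · obtain ⟨K, hK, hKp⟩ := exists_polynomial_quotient (matOp X M) p
    obtain ⟨K', hK', hKp'⟩ := exists_polynomial_quotient (matOp X M) (M.charpoly ^ s)
    refine ⟨fun z => K z + u z • K' z, hK.differentiableOn.add (hu.smul hK'.differentiableOn),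
      fun z hz => ?_⟩
    have h2 := hKp' z
    rw [map_pow, aeval_matOp_charpoly, zero_pow (NeZero.ne s), sub_zero, Polynomial.eval_pow] at h2
    rw [mul_add, mul_smul_comm, ← hKp, ← h2, aeval_matOp, hpu z hz,
      Algebra.algebraMap_eq_smul_one, Algebra.algebraMap_eq_smul_one, smul_smul, add_smul,
      mul_comm (u z)]
    abel

end PrincipalPower

/-! ### Functional calculus: Φ inverts the block operator -/

section Calculus

section Algebra

variable {𝔅 : Type*} [Ring 𝔅] [Algebra ℂ 𝔅]

theorem commute_aeval (m : 𝔅) (p : Polynomial ℂ) : Commute m (Polynomial.aeval m p) := by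
  have h1 : Polynomial.aeval m (Polynomial.X * p) = m * Polynomial.aeval m p := by simp
  have h2 : Polynomial.aeval m (p * Polynomial.X) = Polynomial.aeval m p * m := by simp
  rw [Commute, SemiconjBy, ← h1, ← h2, mul_comm]

theorem commute_resolvent {m Q : 𝔅} (h : Commute m Q) (z : ℂ) : Commute (resolvent m z) Q := by
  have h1 : Commute (algebraMap ℂ 𝔅 z - m) Q := Commute.sub_left (Algebra.commute_algebraMap_left z Q) h
  rw [resolvent]
  by_cases hu : IsUnit (algebraMap ℂ 𝔅 z - m)
  · obtain ⟨u, hu⟩ := hu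
    rw [← hu] at h1 ⊢
    rw [Ring.inverse_unit]
    exact h1.units_inv_left
  · rw [Ring.inverse_non_unit _ hu]
    exact Commute.zero_left _

theorem commute_and_eq_of_sub_eq {F D : 𝔅} {g : ℂ} (h1 : F - D = (1 - g) • (F * D))
    (h2 : D - F = (g - 1) • (D * F)) (h3 : g = 1 → F = D) :
    F * D = D * F ∧ F + (g - 1) • (D * F) = D := by
  refine ⟨?_, by rw [← h2]; abel⟩
  by_cases h : g = 1
  · rw [h3 h]
  · have h4 : (g - 1) • (F * D) = (g - 1) • (D * F) := by
      rw [← h2, ← neg_sub F D, h1, ← neg_smul, neg_sub]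
    have h5 := congrArg (fun x => (g - 1)⁻¹ • x) h4
    simpa [smul_smul, inv_mul_cancel₀ (sub_ne_zero.2 h)] using h5

/-- Replacing the scalar g by its value p at m changes the identity only by a multiple of w = z − m,
so (1 + (p − 1)D)F(z) takes the value D at m. -/
theorem one_add_mul_eq {F D p w ψ : 𝔅} {g : ℂ} (h1 : F + (g - 1) • (D * F) = D)
    (h2 : g • (1 : 𝔅) = p + w * ψ) :
    (1 + (p - 1) * D) * F = D + w * (-(ψ * (D * F))) := by
  have hp : p = g • (1 : 𝔅) - w * ψ := by rw [h2]; abel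
  have h3 : (p - 1) * (D * F) = (g - 1) • (D * F) - w * (ψ * (D * F)) := by
    rw [hp, sub_mul, sub_mul, one_mul, smul_mul_assoc, one_mul, sub_smul, one_smul, mul_assoc]
    abel
  rw [add_mul, one_mul, mul_assoc, h3, mul_neg, ← add_sub_assoc, h1, sub_eq_add_neg]

end Algebra

/-- An identity `(1 + (g(z) - 1) D) F(z) = D` is inherited by the values `Φ` of `F` and `p` of `g` at
an algebraic element `m`. -/
theorem mul_eq_and_mul_eq_of_quotients {𝔅 : Type*} [NormedRing 𝔅] [NormedAlgebra ℂ 𝔅]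
    [CompleteSpace 𝔅] {m p D Φ : 𝔅} {F Ψ ψ : ℂ → 𝔅} {g : ℂ → ℂ} {S : Set ℂ} (hS : IsOpen S)
    {c : ℂ} {R : ℝ} (hR : 0 < R) (hcR : Metric.closedBall c R ⊆ S)
    (hm : Metric.sphere c R ⊆ resolventSet ℂ m) (a : ℂ) (l : List ℂ) (ha : a ∈ Metric.ball c R)
    (hl : ∀ b ∈ l, b ∈ Metric.ball c R)
    (hml : (a :: l).foldl (fun N b => (m - algebraMap ℂ 𝔅 b) * N) 1 = 0)
    (hFd : DifferentiableOn ℂ F S) (hψ : DifferentiableOn ℂ ψ S)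
    (hΨ : DifferentiableOn ℂ Ψ S) (hF : ∀ z ∈ S, F z = Φ + (algebraMap ℂ 𝔅 z - m) * Ψ z)
    (hg : ∀ z ∈ S, g z • (1 : 𝔅) = p + (algebraMap ℂ 𝔅 z - m) * ψ z)
    (hFD : ∀ z ∈ S, F z * D = D * F z ∧ F z + (g z - 1) • (D * F z) = D)
    (hmp : Commute m p) (hmD : Commute m D) (hpF : ∀ z ∈ S, Commute (F z) p) :
    (1 + (p - 1) * D) * Φ = D ∧ Φ * (1 + (p - 1) * D) = D := by
  set Q := 1 + (p - 1) * D with hQ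
  have hΦ := circleIntegral_resolvent_mul m hR hm a l ha hl hml hS hcR hΨ hF
  have hDQ := circleIntegral_resolvent_mul m hR hm a l ha hl hml hS hcR
    (F := fun z => Q * F z) (Ψ := fun z => -(ψ z * (D * F z))) (Φ := D)
    (hψ.mul (hFd.const_mul D)).neg fun z hz => one_add_mul_eq (hFD z hz).2 (hg z hz)
  have h2π : (2 * Real.pi * Complex.I : ℂ) ≠ 0 := Complex.two_pi_I_ne_zero
  have hcont : ContinuousOn (fun z => resolvent m z * F z) (Metric.sphere c R) :=
    (hasDecay_resolvent m Metric.isClosed_sphere hm).1.mul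
      (hFd.continuousOn.mono (Metric.sphere_subset_closedBall.trans hcR))
  have h_int := (hcont.circleIntegrable hR.le).out.1
  have hcancel : ∀ x : 𝔅, (2 * Real.pi * Complex.I : ℂ) • x = (2 * Real.pi * Complex.I : ℂ) • D →
      x = D := fun x hx => by
    have := congrArg (fun y => (2 * Real.pi * Complex.I : ℂ)⁻¹ • y) hx
    simpa only [smul_smul, inv_mul_cancel₀ h2π, one_smul] using this
  have hresQ : ∀ z, Commute (resolvent m z) Q := fun z =>
    commute_resolvent ((Commute.one_right m).add_right
      ((hmp.sub_right (Commute.one_right m)).mul_right hmD)) z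
  refine ⟨hcancel _ ?_, hcancel _ ?_⟩
  -- The constant Q leaves the integral on the left because it commutes with the resolvent of m; in
  -- the second case it leaves on the right because it also commutes with F(z).
  · rw [← hDQ, ← mul_smul_comm, ← hΦ, circleIntegral_eq_integral_restrict,
      circleIntegral_eq_integral_restrict, ← integral_const_mul_of_integrable h_int]
    congr 1
    ext1 x
    rw [mul_smul_comm, ← mul_assoc, ← mul_assoc, (hresQ _).eq]
  · rw [← hDQ, ← smul_mul_assoc, ← hΦ, circleIntegral_eq_integral_restrict,
      circleIntegral_eq_integral_restrict, ← integral_mul_const_of_integrable h_int]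
    congr 1
    ext1 x
    have hx : circleMap c R x ∈ S := hcR (circleMap_mem_closedBall c hR.le x)
    have hc : Commute (F (circleMap c R x)) Q := (Commute.one_right _).add_right
      (((hpF _ hx).sub_right (Commute.one_right _)).mul_right (hFD _ hx).1)
    rw [smul_mul_assoc, mul_assoc, hc.eq]

variable {X : Type*} [NormedAddCommGroup X] [NormedSpace ℂ X] [CompleteSpace X] {s : ℕ} [NeZero s]
  {A : X →ₗ.[ℂ] X} {θ₀ α : ℝ}

/-- The holomorphic functional calculus for `z ↦ (z^α - A)⁻¹` and a matrix with spectrum in a disc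
contained in the right half-plane. -/
theorem IsSectorialOp.exists_blockInverse (hA : IsSectorialOp A θ₀) (hα₀ : 0 < α) (hα₁ : α < 1)
    {M : Matrix (Fin s) (Fin s) ℂ} {c : ℂ} {R : ℝ} (hR : 0 < R)
    (hcR : Metric.closedBall c R ⊆ sector (theta1 α θ₀))
    (hM : spectrum ℂ M ⊆ Metric.ball c R) :
    ∃ (P : Matrix (Fin s) (Fin s) ℂ) (Φ : (Fin s → X) →L[ℂ] (Fin s → X))
      (Ψ : ℂ → ((Fin s → X) →L[ℂ] (Fin s → X))),
      IsPrincipalPower M α P ∧ IsBoundedInverse (blockShift P A) Φ ∧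
      DifferentiableOn ℂ Ψ (sector (theta1 α θ₀)) ∧
      (∀ z ∈ sector (theta1 α θ₀), diagOp X s (resolventOp A (z ^ (α : ℂ))) =
        Φ + (algebraMap ℂ _ z - matOp X M) * Ψ z) ∧
      (∮ z in C(c, R), resolvent (matOp X M) z * diagOp X s (resolventOp A (z ^ (α : ℂ)))) =
        (2 * Real.pi * Complex.I : ℂ) • Φ := by
  set S := sector (theta1 α θ₀) with hSdef
  set F : ℂ → ((Fin s → X) →L[ℂ] (Fin s → X)) :=
    fun z => diagOp X s (resolventOp A (z ^ (α : ℂ))) with hF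
  set m := matOp X M with hm
  have hS : IsOpen S := isOpen_sector theta1_le
  have hslit : S ⊆ Complex.slitPlane := sector_subset_slitPlane theta1_le
  have hFd : DifferentiableOn ℂ F S :=
    (diagOp X s).differentiable.comp_differentiableOn
      (hA.differentiableOn_resolventOp_cpow hα₀ hα₁)
  obtain ⟨a, l, hal⟩ := exists_roots_eq_cons M
  have hroots : ∀ b ∈ a :: l, b ∈ Metric.ball c R := fun b hb =>
    hM (mem_spectrum_of_mem_roots (hal ▸ hb))
  have hfold : (a :: l).foldl (fun N b => (m - algebraMap ℂ _ b) * N) 1 = 0 := by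
    rw [← hal]; exact foldl_roots_eq_zero X M
  have hsphere : Metric.sphere c R ⊆ resolventSet ℂ m := fun z hz =>
    mem_resolventSet_matOp X fun h => (Metric.mem_ball.1 (hM h)).ne (Metric.mem_sphere.1 hz)
  obtain ⟨Φ, Ψ, hΨ, hΦΨ⟩ := exists_resolvent_quotient m hS (a :: l)
    (fun b hb => hcR (Metric.ball_subset_closedBall (hroots b hb))) 1 F hFd hfold
  simp_rw [one_mul] at hΦΨ
  obtain ⟨P, hP, ψ, hψ, hPψ⟩ := exists_isPrincipalPower (X := X) α
    (fun μ hμ => hslit (hcR (Metric.ball_subset_closedBall (hM hμ))))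
  have h1S : (1 : ℂ) ∈ sector θ₀ := mem_sector_of_re_pos hA.angle_pos.le (by simp)
  have hFD : ∀ z ∈ S, F z * diagOp X s (resolventOp A 1) = diagOp X s (resolventOp A 1) * F z ∧
      F z + (z ^ (α : ℂ) - 1) • (diagOp X s (resolventOp A 1) * F z) =
        diagOp X s (resolventOp A 1) := by
    intro z hz
    have hzα := cpow_mem_sector hα₀ hα₁ hz
    have e1 := congrArg (diagOp X s) (hA.resolventOp_sub hzα h1S)
    have e2 := congrArg (diagOp X s) (hA.resolventOp_sub h1S hzα)
    rw [map_sub, map_smul, diagOp_mul] at e1 e2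
    exact commute_and_eq_of_sub_eq e1 e2 fun h => by rw [hF]; simp only [h]
  have hmP : Commute m (matOp X P) := by
    obtain ⟨-, p, rfl, -⟩ := hP
    rw [← aeval_matOp]
    exact commute_aeval m p
  have ha := hroots a (by simp)
  have hl : ∀ b ∈ l, b ∈ Metric.ball c R := fun b hb => hroots b (by simp [hb])
  obtain ⟨h1, h2⟩ := mul_eq_and_mul_eq_of_quotients hS hR hcR hsphere a l ha hl hfold hFd
    (hψ.mono hslit) hΨ hΦΨ (fun z hz => hPψ z (hslit hz)) hFD hmP (commute_matOp_diagOp M _)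
    (fun z _ => (commute_matOp_diagOp P _).symm)
  exact ⟨P, Φ, Ψ, hP, isBoundedInverse_blockShift (hA.isBoundedInverse h1S) h1 h2, hΨ, hΦΨ,
    circleIntegral_resolvent_mul m hR hsphere a l ha hl hfold hS hcR hΨ hΦΨ⟩

end Calculus

/-! ### Row tensors -/

section RowTensor

variable {X : Type*} [NormedAddCommGroup X] [NormedSpace ℂ X] {s : ℕ}

theorem rowTensor_apply (v : Fin s → ℂ) (T : X →L[ℂ] X) (x : Fin s → X) :
    rowTensor v T x = ∑ j, v j • T (x j) := by
  simp [rowTensor]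

theorem rowTensor_vecMul (v : Fin s → ℂ) (M : Matrix (Fin s) (Fin s) ℂ) (T : X →L[ℂ] X) :
    rowTensor (Matrix.vecMul v M) T = (rowTensor v T).comp (matOp X M) := by
  ext x
  simp only [rowTensor_apply, ContinuousLinearMap.comp_apply, matOp_apply, map_sum, map_smul,
    Finset.smul_sum, smul_smul, Matrix.vecMul, dotProduct, Finset.sum_smul]
  exact Finset.sum_comm

theorem rowTensor_smul (c : ℂ) (v : Fin s → ℂ) (T : X →L[ℂ] X) :
    rowTensor (c • v) T = c • rowTensor v T := by
  ext x
  simp [rowTensor_apply, Finset.smul_sum, smul_smul]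

theorem rowTensor_one_comp_diagOp (v : Fin s → ℂ) (T : X →L[ℂ] X) :
    (rowTensor v 1).comp (diagOp X s T) = rowTensor v T := by
  ext x
  simp [rowTensor_apply, diagOp_apply]

theorem rowTensor_eq_apply (v : Fin s → ℂ) (T : X →L[ℂ] X) (x : Fin s → X) :
    rowTensor v T x = T (rowTensor v 1 x) := by
  simp [rowTensor_apply]

theorem rowTensor_single [NeZero s] :
    rowTensor (X := X) (Pi.single (lastStage s) 1) 1 = ContinuousLinearMap.proj (lastStage s) := by
  ext x
  simp [rowTensor_apply, Pi.single_apply]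

end RowTensor

/-! ### Algebra of the Runge–Kutta method -/

namespace RungeKutta

variable {s : ℕ} [NeZero s] {rk : RungeKutta s}

/-- The rank one matrix `𝒜⁻¹ 𝟙 e_sᵀ`. -/
noncomputable def perturb (rk : RungeKutta s) : Matrix (Fin s) (Fin s) ℂ :=
  rk.mat⁻¹ * Matrix.vecMulVec (fun _ => 1) (Pi.single (lastStage s) 1)

theorem Admissible.isUnit_det (hrk : rk.Admissible) : IsUnit rk.mat.det := by
  have h1 := (Matrix.isUnit_iff_isUnit_det _).1 hrk.invertible
  have h2 : rk.mat.det = ((rk.a.det : ℝ) : ℂ) := (Complex.ofRealHom.map_det rk.a).symm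
  rw [h2]
  exact isUnit_iff_ne_zero.2 (by exact_mod_cast h1.ne_zero)

theorem Admissible.single_vecMul (hrk : rk.Admissible) :
    Matrix.vecMul (Pi.single (lastStage s) 1) rk.mat = rk.wt := by
  ext j
  simp [RungeKutta.mat, RungeKutta.wt, hrk.last_row j]

theorem Admissible.wt_vecMul_inv (hrk : rk.Admissible) :
    Matrix.vecMul rk.wt rk.mat⁻¹ = Pi.single (lastStage s) 1 := by
  rw [← hrk.single_vecMul, Matrix.vecMul_vecMul, Matrix.mul_nonsing_inv _ hrk.isUnit_det,
    Matrix.vecMul_one]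

/-- A rank one inversion: 𝟙bᵀ𝒜⁻¹ = 𝟙eₛᵀ is idempotent, and with τ = ζ/(1−ζ) the coefficient τ − ζ −
ζτ of the error vanishes. -/
theorem Admissible.delta_eq (hrk : rk.Admissible) {ζ : ℂ} (hζ : ζ ≠ 1) :
    rk.delta ζ = rk.mat⁻¹ - ζ • rk.perturb := by
  have hζ' : 1 - ζ ≠ 0 := sub_ne_zero.2 hζ.symm
  refine Matrix.inv_eq_right_inv ?_
  set e : Fin s → ℂ := Pi.single (lastStage s) 1 with he
  set V := Matrix.vecMulVec (fun _ : Fin s => (1 : ℂ)) e with hV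
  have h1 : rk.mat * rk.mat⁻¹ = 1 := Matrix.mul_nonsing_inv _ hrk.isUnit_det
  have h2 : Matrix.vecMulVec (fun _ : Fin s => (1 : ℂ)) rk.wt * rk.mat⁻¹ = V := by
    rw [Matrix.vecMulVec_mul, hrk.wt_vecMul_inv]
  have h3 : V * V = V := by
    rw [hV, Matrix.vecMulVec_mul_vecMulVec]
    ext i j
    simp [he, Matrix.vecMulVec_apply]
  rw [perturb, ← hV, add_mul, mul_sub, mul_sub, h1, mul_smul_comm, ← mul_assoc, h1, one_mul,
    smul_mul_assoc, h2, mul_smul_comm, smul_mul_assoc, ← mul_assoc, h2, h3, smul_smul]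
  have h4 : ζ / (1 - ζ) - ζ - ζ * (ζ / (1 - ζ)) = 0 := by field_simp; ring
  have h5 : (1 : Matrix (Fin s) (Fin s) ℂ) - ζ • V + ((ζ / (1 - ζ)) • V - (ζ * (ζ / (1 - ζ))) • V) =
      1 + (ζ / (1 - ζ) - ζ - ζ * (ζ / (1 - ζ))) • V := by
    rw [sub_smul, sub_smul]; abel
  rw [h5, h4, zero_smul, add_zero]

theorem Admissible.isUnit_one_sub (hrk : rk.Admissible) {w : ℂ} (hw : w ∉ spectrum ℂ rk.mat⁻¹) :
    IsUnit (1 - w • rk.mat).det := by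
  have h1 : IsUnit (algebraMap ℂ (Matrix (Fin s) (Fin s) ℂ) w - rk.mat⁻¹) := by
    simpa [spectrum.mem_iff] using hw
  have h2 : 1 - w • rk.mat = -((algebraMap ℂ (Matrix (Fin s) (Fin s) ℂ) w - rk.mat⁻¹) * rk.mat) := by
    rw [sub_mul, Matrix.nonsing_inv_mul _ hrk.isUnit_det, Algebra.algebraMap_eq_smul_one,
      smul_mul_assoc, one_mul, neg_sub]
  rw [← Matrix.isUnit_iff_isUnit_det, h2]
  exact (h1.mul ((Matrix.isUnit_iff_isUnit_det _).2 hrk.isUnit_det)).neg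

theorem Admissible.q_vecMul (hrk : rk.Admissible) {w : ℂ} (hw : w ∉ spectrum ℂ rk.mat⁻¹) :
    Matrix.vecMul (rk.q w) (1 - w • rk.mat) = rk.wt := by
  rw [RungeKutta.q, Matrix.vecMul_vecMul, Matrix.nonsing_inv_mul _ (hrk.isUnit_one_sub hw),
    Matrix.vecMul_one]

theorem Admissible.q_vecMul_inv (hrk : rk.Admissible) {w : ℂ} (hw : w ∉ spectrum ℂ rk.mat⁻¹) :
    Matrix.vecMul (rk.q w) rk.mat⁻¹ = Pi.single (lastStage s) 1 + w • rk.q w := by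
  have h : Matrix.vecMul (Matrix.vecMul (rk.q w) (1 - w • rk.mat)) rk.mat⁻¹ =
      Pi.single (lastStage s) 1 := by
    rw [hrk.q_vecMul hw, hrk.wt_vecMul_inv]
  rw [Matrix.vecMul_vecMul, sub_mul, one_mul, smul_mul_assoc,
    Matrix.mul_nonsing_inv _ hrk.isUnit_det, Matrix.vecMul_sub, Matrix.vecMul_smul,
    Matrix.vecMul_one] at h
  rw [← h, sub_add_cancel]

/-- Since q(w)𝒜⁻¹ = eₛᵀ + w q(w), pairing with 𝟙 gives 1 + w q(w)𝟙 = r(w). This is the source of the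
powers of r in the weights. -/
theorem Admissible.q_vecMul_perturb (hrk : rk.Admissible) {w : ℂ}
    (hw : w ∉ spectrum ℂ rk.mat⁻¹) :
    Matrix.vecMul (rk.q w) rk.perturb = rk.r w • Pi.single (lastStage s) 1 := by
  rw [perturb, ← Matrix.vecMul_vecMul, hrk.q_vecMul_inv hw, Matrix.vecMul_vecMulVec]
  congr 1
  simp [RungeKutta.r, dotProduct, Finset.sum_add_distrib, Finset.mul_sum, Pi.single_apply]

section Operators

variable {X : Type*} [NormedAddCommGroup X] [NormedSpace ℂ X]

theorem Admissible.proj_comp_resolvent (hrk : rk.Admissible) {h : ℝ} (hh : 0 < h) {z : ℂ}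
    (hz : (h : ℂ) * z ∉ spectrum ℂ rk.mat⁻¹)
    (hzm : z ∈ resolventSet ℂ (matOp X ((h : ℂ)⁻¹ • rk.mat⁻¹))) :
    (ContinuousLinearMap.proj (lastStage s) : (Fin s → X) →L[ℂ] X).comp
      (resolvent (matOp X ((h : ℂ)⁻¹ • rk.mat⁻¹)) z) = -(h : ℂ) • rowTensor (rk.q (h * z)) 1 := by
  have hh' : (h : ℂ) ≠ 0 := by exact_mod_cast hh.ne'
  have h1 : (algebraMap ℂ _ z - matOp X ((h : ℂ)⁻¹ • rk.mat⁻¹)) =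
      matOp X (z • (1 : Matrix (Fin s) (Fin s) ℂ) - (h : ℂ)⁻¹ • rk.mat⁻¹) := by
    rw [map_sub, ← Algebra.algebraMap_eq_smul_one, AlgHom.commutes]
  have h2 : (algebraMap ℂ _ z - matOp X ((h : ℂ)⁻¹ • rk.mat⁻¹)) *
      resolvent (matOp X ((h : ℂ)⁻¹ • rk.mat⁻¹)) z = 1 := Ring.mul_inverse_cancel _ hzm
  have h3 : (ContinuousLinearMap.proj (lastStage s) : (Fin s → X) →L[ℂ] X) =
      -(h : ℂ) • (rowTensor (rk.q (h * z)) 1).comp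
        (matOp X (z • (1 : Matrix (Fin s) (Fin s) ℂ) - (h : ℂ)⁻¹ • rk.mat⁻¹)) := by
    rw [← rowTensor_vecMul, ← rowTensor_smul, ← rowTensor_single]
    congr 1
    rw [Matrix.vecMul_sub, Matrix.vecMul_smul, Matrix.vecMul_smul, Matrix.vecMul_one,
      hrk.q_vecMul_inv hz]
    ext j
    simp
    field_simp
    ring
  rw [h3, ← h1, ContinuousLinearMap.smul_comp, ContinuousLinearMap.comp_assoc]
  congr 1
  exact (congrArg (rowTensor (rk.q (h * z)) 1).comp h2).trans (ContinuousLinearMap.comp_id _)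

/-- The last row of (z−M)⁻¹ is −h q(hz), and q(hz) is a left eigenvector of −E(z−M)⁻¹ with
eigenvalue r(hz). -/
theorem Admissible.lastRow_neumannTerm_mul (hrk : rk.Admissible) {h : ℝ} (hh : 0 < h) {z : ℂ}
    (hz : (h : ℂ) * z ∉ spectrum ℂ rk.mat⁻¹)
    (hzm : z ∈ resolventSet ℂ (matOp X ((h : ℂ)⁻¹ • rk.mat⁻¹))) (A : X →ₗ.[ℂ] X) (α : ℝ) (n : ℕ) :
    lastRow (neumannTerm (matOp X ((h : ℂ)⁻¹ • rk.mat⁻¹)) (matOp X ((h : ℂ)⁻¹ • rk.perturb)) n z *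
      diagOp X s (resolventOp A (z ^ (α : ℂ)))) = -(h : ℂ) • weightKernel rk A α h n z := by
  have hh' : (h : ℂ) ≠ 0 := by exact_mod_cast hh.ne'
  set m := matOp X ((h : ℂ)⁻¹ • rk.mat⁻¹) with hm
  set e := matOp X ((h : ℂ)⁻¹ • rk.perturb) with he
  have h1 := hrk.proj_comp_resolvent (X := X) hh hz hzm
  have h2 : (rowTensor (rk.q (h * z)) 1).comp (-(e * resolvent m z)) =
      rk.r (h * z) • rowTensor (X := X) (rk.q (h * z)) 1 := by
    rw [ContinuousLinearMap.comp_neg]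
    change -((rowTensor (rk.q (h * z)) 1).comp (e.comp (resolvent m z))) = _
    rw [← ContinuousLinearMap.comp_assoc, he, ← rowTensor_vecMul, Matrix.vecMul_smul,
      hrk.q_vecMul_perturb hz, rowTensor_smul, rowTensor_smul, rowTensor_single,
      ContinuousLinearMap.smul_comp, ContinuousLinearMap.smul_comp, h1, smul_smul, smul_smul]
    have h3 : (h : ℂ)⁻¹ * rk.r (h * z) * -(h : ℂ) = -rk.r (h * z) := by field_simp
    ext x
    simp [h3]
  have h3 : (rowTensor (rk.q (h * z)) 1).comp ((-(e * resolvent m z)) ^ n) =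
      rk.r (h * z) ^ n • rowTensor (X := X) (rk.q (h * z)) 1 := by
    induction n with
    | zero => simp; rfl
    | succ n ih =>
      rw [pow_succ]
      change (rowTensor (rk.q (h * z)) 1).comp (((-(e * resolvent m z)) ^ n).comp _) = _
      rw [← ContinuousLinearMap.comp_assoc, ih, ContinuousLinearMap.smul_comp, h2, smul_smul,
        pow_succ]
  rw [lastRow, neumannTerm, weightKernel]
  change (ContinuousLinearMap.proj (lastStage s) : (Fin s → X) →L[ℂ] X).comp
    (((resolvent m z).comp ((-(e * resolvent m z)) ^ n)).comp _) = _
  rw [← ContinuousLinearMap.comp_assoc, ← ContinuousLinearMap.comp_assoc, h1,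
    ContinuousLinearMap.smul_comp, ContinuousLinearMap.smul_comp, h3,
    ContinuousLinearMap.smul_comp, rowTensor_one_comp_diagOp]

end Operators

/-! ### The recursion for the scalar test equation -/

section Trajectories

variable {X : Type*} [NormedAddCommGroup X] [NormedSpace ℂ X]

/-- The vector of stage slopes zY + G satisfies (1 − hz𝒜)(zY + G) = z𝟙y + G, and bᵀ = q(hz)(1 −
hz𝒜). -/
theorem Admissible.step_eq (hrk : rk.Admissible) {h : ℝ} {z : ℂ}
    (hz : (h : ℂ) * z ∉ spectrum ℂ rk.mat⁻¹) {y : X} {Y G : Fin s → X}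
    (hY : ∀ i, Y i = y + (h : ℂ) • ∑ j, (rk.a i j : ℂ) • (z • Y j + G j)) :
    y + (h : ℂ) • ∑ j, (rk.b j : ℂ) • (z • Y j + G j) =
      rk.r (h * z) • y + (h : ℂ) • rowTensor (rk.q (h * z)) 1 G := by
  have hY' : Y = (fun _ => y) + (h : ℂ) • matOp X rk.mat (z • Y + G) := by
    ext i
    rw [Pi.add_apply, Pi.smul_apply, matOp_apply]
    exact hY i
  have h1 : ∑ j, (rk.b j : ℂ) • (z • Y j + G j) = rowTensor rk.wt 1 (z • Y + G) := by
    rw [rowTensor_apply]; rfl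
  have h2 : matOp X (1 - ((h : ℂ) * z) • rk.mat) (z • Y + G) = z • (fun _ => y) + G := by
    have h3 : matOp X (1 - ((h : ℂ) * z) • rk.mat) (z • Y + G) =
        z • Y + G - ((h : ℂ) * z) • matOp X rk.mat (z • Y + G) := by
      rw [map_sub, map_one, map_smul]; rfl
    rw [h3]
    nth_rewrite 1 [hY']
    rw [smul_add, smul_smul, mul_comm z]
    abel
  have h4 : rowTensor (rk.q (h * z)) 1 (fun _ : Fin s => y) = (∑ j, rk.q (h * z) j) • y := by
    rw [rowTensor_apply, Finset.sum_smul]; rfl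
  rw [h1, ← hrk.q_vecMul hz, rowTensor_vecMul, ContinuousLinearMap.comp_apply, h2, map_add,
    map_smul, h4, RungeKutta.r, add_smul, one_smul, smul_add, smul_smul, smul_smul]
  abel

theorem Admissible.exists_stages (hrk : rk.Admissible) {h : ℝ} {z : ℂ}
    (hz : (h : ℂ) * z ∉ spectrum ℂ rk.mat⁻¹) (y : X) (G : Fin s → X) :
    ∃ Y : Fin s → X, ∀ i, Y i = y + (h : ℂ) • ∑ j, (rk.a i j : ℂ) • (z • Y j + G j) := by
  set N := 1 - ((h : ℂ) * z) • rk.mat with hN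
  set v : Fin s → X := (fun _ => y) + (h : ℂ) • matOp X rk.mat G with hv
  refine ⟨matOp X N⁻¹ v, fun i => ?_⟩
  set Y := matOp X N⁻¹ v with hY
  have h1 : matOp X N Y = v := by
    have : matOp X N Y = (matOp X N * matOp X N⁻¹) v := rfl
    rw [this, ← map_mul, Matrix.mul_nonsing_inv _ (hrk.isUnit_one_sub hz), map_one]; rfl
  have h2 : matOp X N Y = Y - ((h : ℂ) * z) • matOp X rk.mat Y := by
    rw [hN, map_sub, map_one, map_smul]; rfl
  have h3 : Y = (fun _ => y) + (h : ℂ) • matOp X rk.mat (z • Y + G) := by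
    rw [h2, sub_eq_iff_eq_add] at h1
    rw [map_add, map_smul, smul_add, smul_smul]
    nth_rewrite 1 [h1]
    rw [hv]; abel
  have h4 := congrFun h3 i
  rw [Pi.add_apply, Pi.smul_apply, matOp_apply] at h4
  exact h4

theorem Admissible.isTrajectory_iff (hrk : rk.Admissible) {h : ℝ} {z : ℂ}
    (hz : (h : ℂ) * z ∉ spectrum ℂ rk.mat⁻¹) (g : ℝ → X) (y₀ : X) (y : ℕ → X) :
    rk.IsTrajectory (linearField g z) y₀ h y ↔
      y 0 = y₀ ∧ ∀ n, y (n + 1) =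
        rk.r (h * z) • y n + (h : ℂ) • rowTensor (rk.q (h * z)) 1 (rk.G g h n) := by
  refine and_congr_right fun _ => forall_congr' fun n => ⟨?_, fun hn => ?_⟩
  · rintro ⟨Y, hY, hn⟩
    rw [hn]
    exact hrk.step_eq hz (G := rk.G g h n) hY
  · obtain ⟨Y, hY⟩ := hrk.exists_stages hz (y n) (rk.G g h n)
    refine ⟨Y, hY, ?_⟩
    rw [hn]
    exact (hrk.step_eq hz hY).symm

theorem Admissible.existsUnique_trajectory (hrk : rk.Admissible) {h : ℝ} {z : ℂ}
    (hz : (h : ℂ) * z ∉ spectrum ℂ rk.mat⁻¹) (g : ℝ → X) :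
    ∃! y : ℕ → X, rk.IsTrajectory (linearField g z) 0 h y := by
  simp_rw [hrk.isTrajectory_iff hz]
  refine ⟨fun n => Nat.rec 0 (fun n y =>
    rk.r (h * z) • y + (h : ℂ) • rowTensor (rk.q (h * z)) 1 (rk.G g h n)) n,
    ⟨rfl, fun n => rfl⟩, fun y hy => ?_⟩
  ext n
  induction n with
  | zero => exact hy.1
  | succ n ih => rw [hy.2, ih]

theorem Admissible.approx_eq (hrk : rk.Admissible) {h : ℝ} {z : ℂ}
    (hz : (h : ℂ) * z ∉ spectrum ℂ rk.mat⁻¹) (g : ℝ → X) (N : ℕ) :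
    rk.approx g h z N = (h : ℂ) • ∑ n ∈ Finset.range N,
      rk.r (h * z) ^ n • rowTensor (rk.q (h * z)) 1 (rk.G g h (N - 1 - n)) := by
  have hex := (hrk.existsUnique_trajectory hz g).exists
  have htraj : rk.IsTrajectory (linearField g z) 0 h (rk.approx g h z) := by
    rw [approx, dif_pos hex]
    exact hex.choose_spec
  rw [hrk.isTrajectory_iff hz] at htraj
  induction N with
  | zero => simpa using htraj.1
  | succ N ih =>
    -- The newest forcing vector enters with r⁰, so the term n = 0 is split off; all earlier terms
    -- gain one factor r.
    rw [htraj.2, ih, Finset.sum_range_succ', smul_comm, ← smul_add, Finset.smul_sum]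
    congr 2
    · refine Finset.sum_congr rfl fun n _ => ?_
      rw [smul_smul, ← pow_succ', show N + 1 - 1 - (n + 1) = N - 1 - n by omega]
    · simp

theorem Admissible.cqKernel_eq (hrk : rk.Admissible) {h : ℝ} {z : ℂ}
    (hz : (h : ℂ) * z ∉ spectrum ℂ rk.mat⁻¹) (A : X →ₗ.[ℂ] X) (α : ℝ) (g : ℝ → X) (N : ℕ) :
    cqKernel rk A α h g N z = (h : ℂ) • ∑ n ∈ Finset.range N,
      weightKernel rk A α h n z (rk.G g h (N - 1 - n)) := by
  rw [cqKernel, hrk.approx_eq hz, map_smul, map_sum]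
  congr 1
  refine Finset.sum_congr rfl fun n _ => ?_
  rw [map_smul, ← rowTensor_eq_apply, weightKernel]
  rfl

end Trajectories

end RungeKutta

/-! ### Power series coefficients, perturbed spectra, discs in the half-plane -/

section Preliminaries

theorem eq_of_hasSum_pow_smul {𝕜 E : Type*} [NontriviallyNormedField 𝕜] [NormedAddCommGroup E]
    [NormedSpace 𝕜 E] {a b : ℕ → E} {f : 𝕜 → E}
    (ha : ∀ᶠ z in 𝓝 (0 : 𝕜), HasSum (fun n => z ^ n • a n) (f z))
    (hb : ∀ᶠ z in 𝓝 (0 : 𝕜), HasSum (fun n => z ^ n • b n) (f z)) : a = b := by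
  let p : (ℕ → E) → FormalMultilinearSeries 𝕜 𝕜 E := fun c n =>
    ContinuousMultilinearMap.mkPiRing 𝕜 (Fin n) (c n)
  have key : ∀ c : ℕ → E, (∀ᶠ z in 𝓝 (0 : 𝕜), HasSum (fun n => z ^ n • c n) (f z)) →
      HasFPowerSeriesAt f (p c) 0 := by
    intro c hc
    refine hasFPowerSeriesAt_iff.2 ?_
    filter_upwards [hc] with z hz
    simpa [FormalMultilinearSeries.coeff, p] using hz
  have h := (key a ha).eq_formalMultilinearSeries (key b hb)
  ext n
  simpa [p] using congrArg (fun p => p fun _ => (1 : 𝕜)) (congrFun h n)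

theorem eventually_spectrum_sub_smul_subset {𝔅 : Type*} [NormedRing 𝔅] [NormedAlgebra ℂ 𝔅]
    [CompleteSpace 𝔅] (m e : 𝔅) {V : Set ℂ} (hV : IsOpen V) (hm : spectrum ℂ m ⊆ V) :
    ∀ᶠ ζ in 𝓝 (0 : ℂ), spectrum ℂ (m - ζ • e) ⊆ V := by
  have h0 : Tendsto (fun ζ : ℂ => m - ζ • e) (𝓝 0) (𝓝 m) := by
    have : ContinuousAt (fun ζ : ℂ => m - ζ • e) 0 := by fun_prop
    simpa [ContinuousAt] using this
  exact h0.eventually ((upperHemicontinuous_iff.1 (upperHemicontinuous_spectrum ℂ 𝔅)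
    m).forall_isOpen V hV hm)

section MatrixNorm

attribute [local instance] Matrix.linftyOpNormedRing Matrix.linftyOpNormedAlgebra

theorem eventually_matrix_spectrum_subset {s : ℕ} (M E : Matrix (Fin s) (Fin s) ℂ) {V : Set ℂ}
    (hV : IsOpen V) (hM : spectrum ℂ M ⊆ V) : ∀ᶠ ζ in 𝓝 (0 : ℂ), spectrum ℂ (M - ζ • E) ⊆ V :=
  eventually_spectrum_sub_smul_subset M E hV hM

end MatrixNorm

/-- The discs with centre t and radius t − 1/t exhaust the right half-plane as t → ∞, while their
closures stay in Re z ≥ 1/t. -/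
theorem exists_closedBall_re_pos {K : Set ℂ} (hK : K.Finite) (hre : ∀ z ∈ K, 0 < z.re) :
    ∃ (c : ℂ) (R : ℝ), 0 < R ∧ (∀ z ∈ Metric.closedBall c R, 0 < z.re) ∧
      K ⊆ Metric.ball c R := by
  have h1 : ∀ᶠ t : ℝ in atTop, ∀ z ∈ K, z ∈ Metric.ball (t : ℂ) (t - t⁻¹) := by
    rw [hK.eventually_all]
    intro z hz
    have hz0 := hre z hz
    filter_upwards [eventually_gt_atTop 1, eventually_gt_atTop ((z.re ^ 2 + z.im ^ 2 + 2) / z.re)]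
      with t ht1 ht
    have ht0 : 0 < t⁻¹ := by positivity
    have htt : t * t⁻¹ = 1 := mul_inv_cancel₀ (by linarith)
    have ht2 : t⁻¹ < 1 := inv_lt_one_of_one_lt₀ ht1
    rw [div_lt_iff₀ hz0] at ht
    rw [Metric.mem_ball, Complex.dist_eq, Complex.norm_eq_sqrt_sq_add_sq,
      Real.sqrt_lt' (by linarith)]
    simp only [Complex.sub_re, Complex.ofReal_re, Complex.sub_im, Complex.ofReal_im, sub_zero]
    nlinarith [sq_nonneg t⁻¹]
  obtain ⟨t, ht, ht1⟩ := (h1.and (eventually_gt_atTop (1 : ℝ))).exists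
  have ht0 : 0 < t⁻¹ := by positivity
  have ht2 : t⁻¹ < 1 := inv_lt_one_of_one_lt₀ ht1
  refine ⟨t, t - t⁻¹, by linarith, fun z hz => ?_, ht⟩
  rw [Metric.mem_closedBall, Complex.dist_eq] at hz
  have := (Complex.abs_re_le_norm (z - t)).trans hz
  rw [Complex.sub_re, Complex.ofReal_re, abs_le] at this
  linarith

end Preliminaries

/-! ### Power series of the generating function: circle and contour -/

section GeneratingFunction

variable {X : Type*} [NormedAddCommGroup X] [NormedSpace ℂ X] {A : X →ₗ.[ℂ] X} {θ₀ α : ℝ} {s : ℕ}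

theorem IsSectorialOp.hasDecay_diagOp (hA : IsSectorialOp A θ₀) (hα₀ : 0 < α) (hα₁ : α < 1)
    {K : Set ℂ} (hK : IsClosed K) (hKS : K ⊆ sector (theta1 α θ₀)) :
    HasDecay K α (fun z => diagOp X s (resolventOp A (z ^ (α : ℂ)))) := by
  obtain ⟨C, hC, hb⟩ := hA.exists_norm_resolventOp_cpow_le hα₀ hα₁
  obtain ⟨δ, hδ, hball⟩ := Metric.isOpen_iff.1 hK.isOpen_compl 0
    (fun h => zero_notMem_sector (hKS h))
  refine HasDecay.clm (diagOp X s) (hasDecay_of_rpow_bound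
    ((hA.differentiableOn_resolventOp_cpow hα₀ hα₁).continuousOn.mono hKS) hα₀.le hC hδ
    (fun z hz => ?_) fun z hz => hb z (hKS hz))
  by_contra! hlt
  exact hball (by simpa using hlt) hz

variable [CompleteSpace X] [NeZero s]

theorem IsSectorialOp.eventually_hasSum_circle (hA : IsSectorialOp A θ₀) (hα₀ : 0 < α)
    (hα₁ : α < 1) {M : Matrix (Fin s) (Fin s) ℂ} (E : Matrix (Fin s) (Fin s) ℂ) {c : ℂ} {R : ℝ}
    (hR : 0 < R) (hcR : Metric.closedBall c R ⊆ sector (theta1 α θ₀))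
    (hM : spectrum ℂ M ⊆ Metric.ball c R) :
    ∀ᶠ ζ in 𝓝 (0 : ℂ), ∃ (P : Matrix (Fin s) (Fin s) ℂ) (Φ : (Fin s → X) →L[ℂ] (Fin s → X)),
      IsPrincipalPower (M - ζ • E) α P ∧ IsBoundedInverse (blockShift P A) Φ ∧
      HasSum (fun n : ℕ => ζ ^ n • (2 * Real.pi * Complex.I : ℂ)⁻¹ •
        ∮ z in C(c, R), neumannTerm (matOp X M) (matOp X E) n z *
          diagOp X s (resolventOp A (z ^ (α : ℂ)))) Φ := by
  have hp := decayPath_circleMap c R hα₁.le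
  have hrange : range (circleMap c R) = Metric.sphere c R := by
    rw [range_circleMap, abs_of_pos hR]
  have hm : range (circleMap c R) ⊆ resolventSet ℂ (matOp X M) := fun z hz =>
    mem_resolventSet_matOp X fun h => (Metric.mem_ball.1 (hM h)).ne
      (Metric.mem_sphere.1 (hrange ▸ hz))
  have hF := hA.hasDecay_diagOp (s := s) hα₀ hα₁ hp.closed
    ((hrange.subset.trans Metric.sphere_subset_closedBall).trans hcR)
  obtain ⟨ρ, hρ, hsum⟩ := hp.hasSum_integral_neumannTerm (matOp X M) (matOp X E) hm hF
  filter_upwards [eventually_matrix_spectrum_subset M E Metric.isOpen_ball hM,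
    Metric.ball_mem_nhds (0 : ℂ) hρ] with ζ hζ hζρ
  obtain ⟨P, Φ, -, hP, hΦ, -, -, h_int⟩ := hA.exists_blockInverse hα₀ hα₁ hR hcR hζ
  refine ⟨P, Φ, hP, hΦ, ?_⟩
  have h1 := ((hsum ζ (by simpa using hζρ)).2).const_smul ((2 * Real.pi * Complex.I : ℂ)⁻¹)
  rw [map_sub, map_smul, circleIntegral_eq_integral_restrict] at h_int
  rw [h_int, inv_smul_smul₀ Complex.two_pi_I_ne_zero] at h1
  refine h1.congr_fun fun n => ?_
  rw [smul_comm, circleIntegral_eq_integral_restrict]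

theorem IsSectorialOp.eventually_hasSum_contour (hA : IsSectorialOp A θ₀) (hα₀ : 0 < α)
    (hα₁ : α < 1) {M : Matrix (Fin s) (Fin s) ℂ} (E : Matrix (Fin s) (Fin s) ℂ) {γ : ℝ → ℂ}
    (hγ : IsContour (sector (theta1 α θ₀)) γ) (hre : ∀ μ ∈ spectrum ℂ M, 0 < μ.re)
    (hM : ∀ μ ∈ spectrum ℂ M, RightOf γ μ) :
    ∀ᶠ ζ in 𝓝 (0 : ℂ), ∃ (P : Matrix (Fin s) (Fin s) ℂ) (Φ : (Fin s → X) →L[ℂ] (Fin s → X)),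
      IsPrincipalPower (M - ζ • E) α P ∧ IsBoundedInverse (blockShift P A) Φ ∧
      HasSum (fun n : ℕ => ζ ^ n • (-(2 * Real.pi * Complex.I : ℂ)⁻¹) •
        ∫ x, deriv γ x • (neumannTerm (matOp X M) (matOp X E) n (γ x) *
          diagOp X s (resolventOp A ((γ x) ^ (α : ℂ))))) Φ := by
  have hp := hγ.decayPath hα₀ hα₁.le
  have hm : range γ ⊆ resolventSet ℂ (matOp X M) := fun z hz =>
    mem_resolventSet_matOp X fun h => (hM z h).notMem_range hz
  have hF := hA.hasDecay_diagOp (s := s) hα₀ hα₁ hp.closed (range_subset_iff.2 hγ.mem)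
  obtain ⟨C, hC, hb⟩ := hA.exists_norm_resolventOp_cpow_le hα₀ hα₁
  -- The disc only provides Φ, Ψ and the inversion property; the series itself is integrated along
  -- the contour.
  obtain ⟨c, R, hR, hcR, hMR⟩ := exists_closedBall_re_pos M.finite_spectrum hre
  obtain ⟨ρ, hρ, hsum⟩ := hp.hasSum_integral_neumannTerm (matOp X M) (matOp X E) hm hF
  filter_upwards [eventually_matrix_spectrum_subset M E Metric.isOpen_ball hMR,
    eventually_matrix_spectrum_subset M E (isOpen_rightOf hp.closed) hM,
    Metric.ball_mem_nhds (0 : ℂ) hρ] with ζ hζ hζr hζρ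
  obtain ⟨P, Φ, Ψ, hP, hΦ, hΨ, hΦΨ, -⟩ := hA.exists_blockInverse hα₀ hα₁ hR
    (fun z hz => mem_sector_of_re_pos (theta1_nonneg hα₀ hα₁ hA.angle_pos) (hcR z hz)) hζ
  refine ⟨P, Φ, hP, hΦ, ?_⟩
  obtain ⟨a, l, hal⟩ := exists_roots_eq_cons (M - ζ • E)
  have hroots : ∀ b ∈ a :: l, RightOf γ b := fun b hb =>
    hζr (mem_spectrum_of_mem_roots (hal ▸ hb))
  have hres := hsum ζ (by simpa using hζρ)
  have hmat : matOp X (M - ζ • E) = matOp X M - ζ • matOp X E := by rw [map_sub, map_smul]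
  have h_int := hγ.integral_resolvent_mul (isOpen_sector theta1_le)
    (sector_subset_slitPlane theta1_le) (fun z hz t ht => mul_mem_sector hz (by linarith))
    (matOp X (M - ζ • E)) (hmat ▸ hres.1) a l (hroots a (by simp))
    (fun b hb => hroots b (by simp [hb])) (hal ▸ foldl_roots_eq_zero X (M - ζ • E))
    ((diagOp X s).differentiable.comp_differentiableOn
      (hA.differentiableOn_resolventOp_cpow hα₀ hα₁)) hα₀ hα₁.le hC
    (fun z hz => (norm_diagOp_le _).trans (hb z hz)) hΨ hΦΨ
  have h1 := hres.2.const_smul (-(2 * Real.pi * Complex.I : ℂ)⁻¹)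
  rw [← hmat] at h1
  have h2 : -(2 * Real.pi * Complex.I : ℂ)⁻¹ • -((2 * Real.pi * Complex.I : ℂ) • Φ) = Φ := by
    rw [smul_neg, neg_smul, neg_neg, inv_smul_smul₀ Complex.two_pi_I_ne_zero]
  rw [← h2, ← h_int]
  refine h1.congr_fun fun n => ?_
  rw [smul_comm]

end GeneratingFunction

theorem DecayPath.integrable_neumannTerm_mul {𝔅 : Type*} [NormedRing 𝔅] [NormedAlgebra ℂ 𝔅]
    [CompleteSpace 𝔅] {d γ : ℝ → ℂ} {μ : Measure ℝ} {β : ℝ} (hp : DecayPath d γ μ β) (m e : 𝔅)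
    (hm : range γ ⊆ resolventSet ℂ m) {F : ℂ → 𝔅} (hF : HasDecay (range γ) β F) (n : ℕ) :
    Integrable (fun x => d x • (neumannTerm m e n (γ x) * F (γ x))) μ :=
  hp.integrable_smul ((hasDecay_neumannTerm m e hp.closed hm n).mul hF) le_rfl

/-! ### The weights: uniqueness, existence and comparison -/

section Weights

variable {X : Type*} [NormedAddCommGroup X] [NormedSpace ℂ X] {A : X →ₗ.[ℂ] X} {θ₀ α h : ℝ}
  {s : ℕ} {rk : RungeKutta s}

/-- The principal power and the bounded inverse are unique for each ζ, so both sequences expand the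
same function near 0. -/
theorem IsCQWeights.unique (hh : h ≠ 0) {W W' : ℕ → (Fin s → X) →L[ℂ] (Fin s → X)}
    (hW : IsCQWeights rk A α h W) (hW' : IsCQWeights rk A α h W') : W = W' := by
  obtain ⟨ρ, hρ, H⟩ := hW
  obtain ⟨ρ', hρ', H'⟩ := hW'
  have key : (fun n => (h : ℂ) • W n) = fun n => (h : ℂ) • W' n := by
    refine eq_of_hasSum_pow_smul (𝕜 := ℂ) (f := fun ζ => ∑' n, ζ ^ n • (h : ℂ) • W n) ?_ ?_
    · filter_upwards [Metric.ball_mem_nhds (0 : ℂ) hρ] with ζ hζ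
      obtain ⟨P, R, -, -, hs⟩ := H ζ (by simpa using hζ)
      exact hs.summable.hasSum
    · filter_upwards [Metric.ball_mem_nhds (0 : ℂ) hρ, Metric.ball_mem_nhds (0 : ℂ) hρ']
        with ζ hζ hζ'
      obtain ⟨P, R, hP, hR, hs⟩ := H ζ (by simpa using hζ)
      obtain ⟨P', R', hP', hR', hs'⟩ := H' ζ (by simpa using hζ')
      obtain rfl := hP.unique hP'
      rw [hs.tsum_eq, hR.unique hR']
      exact hs'
  ext1 n
  exact smul_right_injective _ (by exact_mod_cast hh : (h : ℂ) ≠ 0) (congrFun key n)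

theorem mem_spectrum_inv_smul {c : ℂ} (hc : c ≠ 0) {N : Matrix (Fin s) (Fin s) ℂ} {z : ℂ} :
    z ∈ spectrum ℂ (c⁻¹ • N) ↔ c * z ∈ spectrum ℂ N := by
  have := spectrum.smul_mem_smul_iff (a := N) (s := c * z) (r := (Units.mk0 c hc)⁻¹)
  rw [← this, Units.smul_def, Units.smul_def]
  simp [hc]

theorem IsSectorialOp.integrable_neumannTerm [CompleteSpace X]
    (hA : IsSectorialOp A θ₀) (hα₀ : 0 < α)
    (hα₁ : α < 1) {γ : ℝ → ℂ} (hγ : IsContour (sector (theta1 α θ₀)) γ)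
    (M E : Matrix (Fin s) (Fin s) ℂ) (hM : ∀ x, γ x ∉ spectrum ℂ M) (n : ℕ) :
    Integrable fun x => deriv γ x • (neumannTerm (matOp X M) (matOp X E) n (γ x) *
      diagOp X s (resolventOp A ((γ x) ^ (α : ℂ)))) := by
  have hp := hγ.decayPath hα₀ hα₁.le
  exact hp.integrable_neumannTerm_mul (matOp X M) (matOp X E)
    (range_subset_iff.2 fun x => mem_resolventSet_matOp X (hM x))
    (hA.hasDecay_diagOp (s := s) hα₀ hα₁ hp.closed (range_subset_iff.2 hγ.mem)) n

variable [NeZero s]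

theorem RungeKutta.Admissible.isCQWeights (hrk : rk.Admissible) (hh : h ≠ 0)
    {V : ℕ → (Fin s → X) →L[ℂ] (Fin s → X)}
    (hV : ∀ᶠ ζ in 𝓝 (0 : ℂ), ∃ (P : Matrix (Fin s) (Fin s) ℂ)
      (Φ : (Fin s → X) →L[ℂ] (Fin s → X)),
      IsPrincipalPower ((h : ℂ)⁻¹ • rk.mat⁻¹ - ζ • ((h : ℂ)⁻¹ • rk.perturb)) α P ∧
      IsBoundedInverse (blockShift P A) Φ ∧ HasSum (fun n => ζ ^ n • V n) Φ) :
    IsCQWeights rk A α h (fun n => (h : ℂ)⁻¹ • V n) := by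
  have h1 : ∀ᶠ ζ in 𝓝 (0 : ℂ), ζ ≠ 1 := isOpen_ne.mem_nhds zero_ne_one
  obtain ⟨ρ, hρ, H⟩ := Metric.eventually_nhds_iff.1 (hV.and h1)
  refine ⟨ρ, hρ, fun ζ hζ => ?_⟩
  obtain ⟨⟨P, Φ, hP, hΦ, hs⟩, hζ1⟩ := H (show dist ζ 0 < ρ by simpa using hζ)
  refine ⟨P, Φ, ?_, hΦ, ?_⟩
  · rwa [hrk.delta_eq hζ1, smul_sub, smul_comm]
  · have hh' : (h : ℂ) ≠ 0 := by exact_mod_cast hh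
    refine hs.congr_fun fun n => ?_
    rw [smul_inv_smul₀ hh']

theorem RungeKutta.Admissible.re_pos_of_mem_spectrum_inv (hrk : rk.Admissible) {μ : ℂ}
    (hμ : μ ∈ spectrum ℂ rk.mat⁻¹) : 0 < μ.re := by
  have hdet := hrk.isUnit_det
  obtain ⟨u, hu⟩ := (Matrix.isUnit_iff_isUnit_det _).2 hdet
  have hinv : ((u⁻¹ : (Matrix (Fin s) (Fin s) ℂ)ˣ) : Matrix (Fin s) (Fin s) ℂ) = rk.mat⁻¹ := by
    rw [Matrix.coe_units_inv, hu]
  rw [← hinv] at hμ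
  have h0 : μ ≠ 0 := spectrum.ne_zero_of_mem_of_unit hμ
  have h1 := (spectrum.inv_mem_iff (r := Units.mk0 μ h0) (a := u⁻¹)).1 hμ
  rw [inv_inv, hu] at h1
  have h2 := hrk.eigenvalues _ h1
  rw [Units.val_inv_eq_inv_val, Units.val_mk0, Complex.inv_re] at h2
  exact (div_pos_iff_of_pos_right (Complex.normSq_pos.2 h0)).1 h2

theorem RungeKutta.Admissible.re_pos_of_mem_spectrum (hrk : rk.Admissible) (hh : 0 < h) {μ : ℂ}
    (hμ : μ ∈ spectrum ℂ ((h : ℂ)⁻¹ • rk.mat⁻¹)) : 0 < μ.re := by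
  have hh' : (h : ℂ) ≠ 0 := by exact_mod_cast hh.ne'
  have h1 := hrk.re_pos_of_mem_spectrum_inv ((mem_spectrum_inv_smul hh').1 hμ)
  rw [Complex.re_ofReal_mul] at h1
  exact (pos_iff_pos_of_mul_pos h1).1 hh

/-- `lastRow` as a bounded linear map. -/
noncomputable def lastRowCLM (X : Type*) [NormedAddCommGroup X] [NormedSpace ℂ X] (s : ℕ)
    [NeZero s] : ((Fin s → X) →L[ℂ] (Fin s → X)) →L[ℂ] ((Fin s → X) →L[ℂ] X) :=
  ContinuousLinearMap.compL ℂ (Fin s → X) (Fin s → X) X (ContinuousLinearMap.proj (lastStage s))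

theorem lastRowCLM_apply (W : (Fin s → X) →L[ℂ] (Fin s → X)) :
    lastRowCLM X s W = lastRow W := rfl

theorem lastRow_smul_neumannTerm (hrk : rk.Admissible) (hh : 0 < h) {γ : ℝ → ℂ}
    (hγσ : ∀ x : ℝ, (h : ℂ) * γ x ∉ spectrum ℂ rk.mat⁻¹) (n : ℕ) (x : ℝ) :
    lastRowCLM X s (deriv γ x • (neumannTerm (matOp X ((h : ℂ)⁻¹ • rk.mat⁻¹))
      (matOp X ((h : ℂ)⁻¹ • rk.perturb)) n (γ x) *
        diagOp X s (resolventOp A ((γ x) ^ (α : ℂ))))) =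
      -(h : ℂ) • pullback γ (weightKernel rk A α h n) x := by
  have hh' : (h : ℂ) ≠ 0 := by exact_mod_cast hh.ne'
  rw [map_smul, lastRowCLM_apply, hrk.lastRow_neumannTerm_mul hh (hγσ x)
    (mem_resolventSet_matOp X fun hx => hγσ x ((mem_spectrum_inv_smul hh').1 hx)), smul_comm]
  rfl

theorem pullback_cqKernel_eq (hrk : rk.Admissible) {γ : ℝ → ℂ}
    (hγσ : ∀ x : ℝ, (h : ℂ) * γ x ∉ spectrum ℂ rk.mat⁻¹) (g : ℝ → X) (N : ℕ) :
    pullback γ (cqKernel rk A α h g N) = fun x => (h : ℂ) • ∑ n ∈ Finset.range N,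
      pullback γ (weightKernel rk A α h n) x (rk.G g h (N - 1 - n)) := by
  ext1 x
  simp only [pullback]
  rw [hrk.cqKernel_eq (hγσ x), smul_comm, Finset.smul_sum]
  rfl

variable [CompleteSpace X]

/-- Up to the factor −h the kernel is the last row of a Neumann coefficient times Id ⊗ (z^α − A)⁻¹,
whose integrability is known; no position of the poles relative to the contour is needed. -/
theorem integrable_weightKernel (hA : IsSectorialOp A θ₀) (hα₀ : 0 < α) (hα₁ : α < 1)
    (hrk : rk.Admissible) (hh : 0 < h) {γ : ℝ → ℂ} (hγ : IsContour (sector (theta1 α θ₀)) γ)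
    (hγσ : ∀ x : ℝ, (h : ℂ) * γ x ∉ spectrum ℂ rk.mat⁻¹) (n : ℕ) :
    Integrable (pullback γ (weightKernel rk A α h n)) := by
  have hh' : (h : ℂ) ≠ 0 := by exact_mod_cast hh.ne'
  have h1 := (lastRowCLM X s).integrable_comp (hA.integrable_neumannTerm hα₀ hα₁ hγ
    ((h : ℂ)⁻¹ • rk.mat⁻¹) ((h : ℂ)⁻¹ • rk.perturb)
    (fun x hx => hγσ x ((mem_spectrum_inv_smul hh').1 hx)) n)
  simp_rw [lastRow_smul_neumannTerm hrk hh hγσ] at h1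
  exact (integrable_smul_iff (neg_ne_zero.2 hh') _).1 h1

theorem integrable_cqKernel_and_cqApprox_eq (hA : IsSectorialOp A θ₀) (hα₀ : 0 < α) (hα₁ : α < 1)
    (hrk : rk.Admissible) (hh : 0 < h) {γ : ℝ → ℂ} (hγ : IsContour (sector (theta1 α θ₀)) γ)
    (hγσ : ∀ x : ℝ, (h : ℂ) * γ x ∉ spectrum ℂ rk.mat⁻¹) (g : ℝ → X) (N : ℕ) :
    Integrable (pullback γ (cqKernel rk A α h g N)) ∧
      cqApprox rk A α h γ g N =
        (h : ℂ) • ∑ n ∈ Finset.range N, weight rk A α h γ n (rk.G g h (N - 1 - n)) := by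
  have hi := integrable_weightKernel hA hα₀ hα₁ hrk hh hγ hγσ
  have hi' : ∀ n ∈ Finset.range N, Integrable fun x =>
      pullback γ (weightKernel rk A α h n) x (rk.G g h (N - 1 - n)) := fun n _ =>
    (hi n).apply_continuousLinearMap _
  rw [cqApprox, contourInt, pullback_cqKernel_eq hrk hγσ]
  refine ⟨(integrable_finsetSum _ hi').smul _, ?_⟩
  rw [integral_smul, integral_finsetSum _ hi', smul_comm, Finset.smul_sum]
  congr 1
  refine Finset.sum_congr rfl fun n _ => ?_
  exact congrArg _ (ContinuousLinearMap.integral_apply (hi n) _).symm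

theorem IsSectorialOp.exists_isCQWeights (hA : IsSectorialOp A θ₀) (hα₀ : 0 < α) (hα₁ : α < 1)
    (hrk : rk.Admissible) (hh : 0 < h) : ∃ W, IsCQWeights rk A α h W := by
  obtain ⟨c, R, hR, hcR, hMR⟩ := exists_closedBall_re_pos
    ((h : ℂ)⁻¹ • rk.mat⁻¹).finite_spectrum fun μ => hrk.re_pos_of_mem_spectrum hh
  exact ⟨_, hrk.isCQWeights hh.ne' (hA.eventually_hasSum_circle hα₀ hα₁ _ hR
    (fun z hz => mem_sector_of_re_pos (theta1_nonneg hα₀ hα₁ hA.angle_pos) (hcR z hz)) hMR)⟩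

theorem IsCQWeights.lastRow_eq {W : ℕ → (Fin s → X) →L[ℂ] (Fin s → X)}
    (hW : IsCQWeights rk A α h W) (hA : IsSectorialOp A θ₀) (hα₀ : 0 < α) (hα₁ : α < 1)
    (hrk : rk.Admissible) (hh : 0 < h) {γ : ℝ → ℂ} (hγ : IsContour (sector (theta1 α θ₀)) γ)
    (hγσ : ∀ x : ℝ, (h : ℂ) * γ x ∉ spectrum ℂ rk.mat⁻¹)
    (hright : ∀ μ ∈ spectrum ℂ rk.mat⁻¹, RightOf γ (μ / h)) (n : ℕ) :
    lastRow (W n) = weight rk A α h γ n := by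
  have hh' : (h : ℂ) ≠ 0 := by exact_mod_cast hh.ne'
  -- By uniqueness W is given by the contour integrals. The signs and powers of h cancel: h⁻¹ ·
  -- (−(2πi)⁻¹) · (−h) = (2πi)⁻¹.
  have h1 := hW.unique hh.ne' (hrk.isCQWeights hh.ne' (hA.eventually_hasSum_contour hα₀ hα₁
    ((h : ℂ)⁻¹ • rk.perturb) hγ (fun μ => hrk.re_pos_of_mem_spectrum hh) fun μ hμ => by
      have := hright _ ((mem_spectrum_inv_smul hh').1 hμ)
      rwa [mul_div_cancel_left₀ _ hh'] at this))
  rw [h1, ← lastRowCLM_apply, map_smul, map_smul, ← ContinuousLinearMap.integral_comp_comm _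
    (hA.integrable_neumannTerm hα₀ hα₁ hγ _ _
      (fun x hx => hγσ x ((mem_spectrum_inv_smul hh').1 hx)) n)]
  simp_rw [lastRow_smul_neumannTerm hrk hh hγσ]
  rw [integral_smul, smul_smul, smul_smul, weight, contourInt]
  congr 1
  field_simp

end Weights

end FracCQ

open FracCQ
theorem proposition3p3 {X : Type*} [NormedAddCommGroup X] [NormedSpace ℂ X] [CompleteSpace X]
    (A : X →ₗ.[ℂ] X) (θ₀ α : ℝ) (hA : IsSectorialOp A θ₀) (hα₀ : 0 < α) (hα₁ : α < 1)
    (s : ℕ) [NeZero s] (rk : RungeKutta s) (hrk : rk.Admissible)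
    (h : ℝ) (hh : 0 < h)
    (γ : ℝ → ℂ) (hγ : IsContour (sector (theta1 α θ₀)) γ)
    (hγσ : ∀ x : ℝ, (h : ℂ) * γ x ∉ spectrum ℂ rk.mat⁻¹) :
    -- the Runge–Kutta approximations on the contour are well defined, the integrals converge, and
    -- the convolution quadrature approximation is the discrete convolution with the weights
    (∀ n : ℕ, MeasureTheory.Integrable (pullback γ (weightKernel rk A α h n))) ∧
    (∀ g : ℝ → X,
      (∀ x : ℝ, ∃! y : ℕ → X, rk.IsTrajectory (RungeKutta.linearField g (γ x)) 0 h y) ∧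
      ∀ N : ℕ,
        MeasureTheory.Integrable (pullback γ (cqKernel rk A α h g N)) ∧
        cqApprox rk A α h γ g N =
          (h : ℂ) • ∑ n ∈ Finset.range N, weight rk A α h γ n (rk.G g h (N - 1 - n))) ∧
    -- the generating function has a unique coefficient sequence, and if the poles of the
    -- integrands lie to the right of the contour, the weights are the last rows of its members
    (∃! W, IsCQWeights rk A α h W) ∧
    ((∀ μ ∈ spectrum ℂ rk.mat⁻¹, RightOf γ (μ / h)) →
      ∀ W, IsCQWeights rk A α h W →
        (∀ n : ℕ, lastRow (W n) = weight rk A α h γ n) ∧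
        ∀ (g : ℝ → X) (N : ℕ),
          (h : ℂ) • (∑ n ∈ Finset.range N, W n (rk.G g h (N - 1 - n))) (lastStage s) =
              cqApprox rk A α h γ g N ∧
          (h : ℂ) • (∑ n ∈ Finset.range N, W n (rk.G g h (N - 1 - n))) (lastStage s) =
            (h : ℂ) • ∑ n ∈ Finset.range N, weight rk A α h γ n (rk.G g h (N - 1 - n))) := by
  have hcq := integrable_cqKernel_and_cqApprox_eq hA hα₀ hα₁ hrk hh hγ hγσ
  refine ⟨integrable_weightKernel hA hα₀ hα₁ hrk hh hγ hγσ,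
    fun g => ⟨fun x => hrk.existsUnique_trajectory (hγσ x) g, hcq g⟩, ?_, fun hright W hW => ?_⟩
  · obtain ⟨W, hW⟩ := hA.exists_isCQWeights hα₀ hα₁ hrk hh
    exact ⟨W, hW, fun W' hW' => hW'.unique hh.ne' hW⟩
  · have hrow := hW.lastRow_eq hA hα₀ hα₁ hrk hh hγ hγσ hright
    have hsum : ∀ (g : ℝ → X) (N : ℕ),
        (h : ℂ) • (∑ n ∈ Finset.range N, W n (rk.G g h (N - 1 - n))) (lastStage s) =
          (h : ℂ) • ∑ n ∈ Finset.range N, weight rk A α h γ n (rk.G g h (N - 1 - n)) := by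
      intro g N
      rw [Finset.sum_apply]
      simp_rw [← hrow]
      rfl
    exact ⟨hrow, fun g N => ⟨(hsum g N).trans (hcq g N).2.symm, hsum g N⟩⟩
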